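/- Let $M$ be a compact Kähler manifold of complex dimension $m$ and let $(L,h)\to M$ be a holomorphic line bundle with a $\mathcal C^\infty$ Hermitian metric. Let $\mathcal S\subset H^0(M,L)$ be a linear subspace of the space of holomorphic sections, endowed with a Hermitian inner product, with orthonormal basis $S_1,\dots,S_n$, and suppose that $\mathcal S$ is base point free, i.e. for every $z\in M$ there is $s\in\mathcal S$ with $s(z)\neq 0$. Let $\gamma$ be the Gaussian probability measure on $\mathcal S$ given by $$d\gamma(s)=\frac1{\pi^n}e^{-|c|^2}\,dc,\qquad s=\sum_{j=1}^n c_jS_j,\quad c\in\mathbb C^n,$$ and let $\Pi_{\mathcal S}(z,z)=\sum_{j=1}^n\|S_j(z)\|_h^2$. Let $c_1(L,h)$ be the Chern form, given by $\frac{\sqrt{-1}}{2\pi}\partial\bar\partial\log\|e_L\|_h^{-2}$ for any local holomorphic frame $e_L$ of $L$. Let $1\le k\le m$. Then for $\gamma^k$-almost every $(s_1,\dots,s_k)\in\mathcal S^k$ the set $\{z\in M: s_1(z)=\dots=s_k(z)=0\}$ is a (possibly empty) complex submanifold of $M$ of codimension $k$; let $Z_{s_1,\dots,s_k}$ denote the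 current of integration over it, $(Z_{s_1,\dots,s_k},\phi)=\int_{\{s_1=\dots=s_k=0\}}\phi$. The expected value of this current is $$\mathbf E_{\gamma^k}\big(Z_{s_1,\dots,s_k}\big)=\left(\frac{\sqrt{-1}}{2\pi}\,\partial\bar\partial\log\Pi_{\mathcal S}(z,z)+c_1(L,h)\right)^k ;$$ that is, for every $\mathcal C^\infty$ form $\phi$ on $M$ of bidegree $(m-k,m-k)$, the random variable $(Z_{s_1,\dots,s_k},\phi)$ is $\gamma^k$-integrable and $$\int_{\mathcal S^k}\big(Z_{s_1,\dots,s_k},\phi\big)\,d\gamma^k(s_1,\dots,s_k)=\int_M\left(\frac{\sqrt{-1}}{2\pi}\,\partial\bar\partial\log\Pi_{\mathcal S}(z,z)+c_1(L,h)\right)^k\wedge\phi .$$ -/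

import Mathlib

open scoped Manifold ContDiff Bundle

noncomputable section

namespace ZeroCurrent

/-! ### Differential forms

An `m`-dimensional complex manifold `M` is modelled on `Fin m → ℂ`; its real tangent space at any
point, `TangentSpace 𝓘(ℝ, Fin m → ℂ) x`, is by definition `Fin m → ℂ`. -/

/-- Complex-valued alternating `r`-forms, over `ℝ`, on the vector space `ℂ^m`. -/
abbrev AltForm (m r : ℕ) : Type := (Fin m → ℂ) [⋀^Fin r]→L[ℝ] ℂ

/-- (Not necessarily continuous) complex-valued differential `r`-forms on `M`. -/
abbrev DForm (m : ℕ) (M : Type*) (r : ℕ) : Type _ := M → AltForm m r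

/-- The underlying algebraic alternating map of the wedge product: the sum over `(p, q)`-shuffles,
so that `(dx ∧ dy) (∂x, ∂y) = 1`. -/
def wedgeAlg {m p q : ℕ} (a : AltForm m p) (b : AltForm m q) :
    (Fin m → ℂ) [⋀^Fin (p + q)]→ₗ[ℝ] ℂ :=
  ((LinearMap.mul' ℝ ℂ).compAlternatingMap
    (a.toAlternatingMap.domCoprod b.toAlternatingMap)).domDomCongr finSumFinEquiv

theorem wedgeAlg_continuous {m p q : ℕ} (a : AltForm m p) (b : AltForm m q) :
    Continuous (wedgeAlg a b) := by
  have h : ∀ σ : Equiv.Perm.ModSumCongr (Fin p) (Fin q),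
      Continuous fun v : Fin p ⊕ Fin q → (Fin m → ℂ) =>
        LinearMap.mul' ℝ ℂ
          (AlternatingMap.domCoprod.summand a.toAlternatingMap b.toAlternatingMap σ v) := by
    intro σ
    induction σ using Quotient.inductionOn' with
    | h σ =>
      have : (fun v : Fin p ⊕ Fin q → (Fin m → ℂ) =>
          LinearMap.mul' ℝ ℂ (AlternatingMap.domCoprod.summand a.toAlternatingMap
            b.toAlternatingMap (Quotient.mk'' σ) v)) =
          fun v => Equiv.Perm.sign σ •
            (a (fun i => v (σ (Sum.inl i))) * b (fun i => v (σ (Sum.inr i)))) := by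
        funext v
        rcases Int.units_eq_one_or (Equiv.Perm.sign σ) with h | h <;>
        simp [AlternatingMap.domCoprod.summand_mk'', h]
      rw [this]
      refine Continuous.const_smul (Continuous.mul ?_ ?_) _
      · exact a.cont.comp (by fun_prop)
      · exact b.cont.comp (by fun_prop)
  have h2 : Continuous fun v : Fin p ⊕ Fin q → (Fin m → ℂ) =>
      ∑ σ : Equiv.Perm.ModSumCongr (Fin p) (Fin q), LinearMap.mul' ℝ ℂ
        (AlternatingMap.domCoprod.summand a.toAlternatingMap b.toAlternatingMap σ v) :=
    continuous_finsetSum _ fun σ _ => h σ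
  have h3 : ⇑(wedgeAlg a b) = (fun v : Fin p ⊕ Fin q → (Fin m → ℂ) =>
      ∑ σ : Equiv.Perm.ModSumCongr (Fin p) (Fin q), LinearMap.mul' ℝ ℂ
        (AlternatingMap.domCoprod.summand a.toAlternatingMap b.toAlternatingMap σ v)) ∘
      fun v i => v (finSumFinEquiv i) := by
    funext v
    simp [wedgeAlg, AlternatingMap.domCoprod_apply, Function.comp_def]
  rw [h3]
  exact h2.comp (by fun_prop)

/-- The wedge product of alternating forms. -/
def wedge {m p q : ℕ} (a : AltForm m p) (b : AltForm m q) : AltForm m (p + q) :=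
  { wedgeAlg a b with cont := wedgeAlg_continuous a b }

/-- The `k`-fold wedge power of a `2`-form. -/
def wedgePow {m : ℕ} (a : AltForm m 2) : (k : ℕ) → AltForm m (2 * k)
  | 0 => ContinuousAlternatingMap.constOfIsEmpty ℝ (Fin m → ℂ) (Fin 0) 1
  | k + 1 => wedge (wedgePow a k) a

/-- For a `2`-form `a` and a `2 (m - k)`-form `b` on `ℂ^m`, the top-degree form `a^k ∧ b`. -/
def powWedge {m k : ℕ} (hk : k ≤ m) (a : AltForm m 2) (b : AltForm m (2 * (m - k))) :
    AltForm m (2 * m) :=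
  { (wedge (wedgePow a k) b).toAlternatingMap.domDomCongr
      (finCongr (by omega : 2 * k + 2 * (m - k) = 2 * m)) with
    cont := (wedge (wedgePow a k) b).cont.comp (continuous_pi fun _ => continuous_apply _) }

section Forms

variable {m : ℕ} {M : Type*} [TopologicalSpace M] [ChartedSpace (Fin m → ℂ) M]

/-- The pull-back `f^* φ` of a form on `M` by a map `f : ℂ^d → M`. -/
def pullback {d r : ℕ} (f : (Fin d → ℂ) → M) (φ : DForm m M r) : (Fin d → ℂ) → AltForm d r :=
  fun w => (φ (f w)).compContinuousLinearMap
    (mfderiv 𝓘(ℝ, Fin d → ℂ) 𝓘(ℝ, Fin m → ℂ) f w)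

/-- The form `φ` is `C^∞`: its expression in every chart is `C^∞`. -/
def IsSmooth {r : ℕ} (φ : DForm m M r) : Prop :=
  ∀ e ∈ atlas (Fin m → ℂ) M, ContDiffOn ℝ ∞ (pullback e.symm φ) e.target

/-- The form `φ` is closed: `dφ = 0` in every chart. -/
def IsClosedForm {r : ℕ} (φ : DForm m M r) : Prop :=
  ∀ e ∈ atlas (Fin m → ℂ) M, ∀ z ∈ e.target, extDeriv (pullback e.symm φ) z = 0

/-- The `r`-form `φ` has bidegree `(p, q)`, where `p + q = r`: multiplying all tangent vectors by
a complex number `c` multiplies its value by `c ^ p * conj c ^ q`. -/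
def HasBidegree {r : ℕ} (φ : DForm m M r) (p q : ℕ) : Prop :=
  p + q = r ∧ ∀ (x : M) (c : ℂ) (v : Fin r → Fin m → ℂ),
    φ x (fun j => c • v j) = c ^ p * (starRingEnd ℂ c) ^ q * φ x v

/-- The `C^∞` forms of bidegree `(p, p)`. On a compact manifold these are the test forms, that is,
the compactly supported ones. -/
def IsTestForm {p : ℕ} (φ : DForm m M (2 * p)) : Prop :=
  IsSmooth φ ∧ HasBidegree φ p p

variable (m M) in
/-- `M` carries a Kähler form: a `C^∞` closed real `(1,1)`-form `κ` with `κ (v, i v) > 0` for all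
nonzero tangent vectors `v`. -/
def IsKahler : Prop :=
  ∃ κ : DForm m M 2, IsSmooth κ ∧ IsClosedForm κ ∧ HasBidegree κ 1 1 ∧
    (∀ x v, (κ x v).im = 0) ∧
    ∀ (x : M) (v : Fin m → ℂ), v ≠ 0 → 0 < (κ x ![v, Complex.I • v]).re

/-- On `ℂ^m`, the form `∂̄u`, `∂̄u (v) = (du (v) + i du (i v)) / 2`. -/
def dbar (u : (Fin m → ℂ) → ℂ) (z : Fin m → ℂ) : AltForm m 1 :=
  ContinuousAlternatingMap.ofSubsingleton ℝ (Fin m → ℂ) ℂ (0 : Fin 1)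
    ((1 / 2 : ℂ) • (fderiv ℝ u z + Complex.I •
      (fderiv ℝ u z).comp (Complex.I • ContinuousLinearMap.id ℝ (Fin m → ℂ))))

/-- The form `∂∂̄u` on `M`, computed at `x` in a holomorphic chart around `x`; in that chart it is
`d(∂̄u)`, since `∂̄∂̄u = 0`. -/
def ddbar (u : M → ℂ) : DForm m M 2 := fun x =>
  (extDeriv (dbar (u ∘ (chartAt (Fin m → ℂ) x).symm))
      (chartAt (Fin m → ℂ) x x)).compContinuousLinearMap
    (mfderiv 𝓘(ℝ, Fin m → ℂ) 𝓘(ℝ, Fin m → ℂ) (chartAt (Fin m → ℂ) x) x)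

end Forms

/-! ### Complex submanifolds and integration over them -/

section Integration

/-- The inclusion of `ℂ^d` in `ℂ^m` as the first `d` coordinates. -/
def incl (d m : ℕ) (w : Fin d → ℂ) : Fin m → ℂ :=
  fun i => if h : (i : ℕ) < d then w ⟨i, h⟩ else 0

/-- The positively oriented real frame `e₁, i e₁, …, e_d, i e_d` of `ℂ^d`. -/
def stdFrame (d : ℕ) (j : Fin (2 * d)) : Fin d → ℂ :=
  Pi.single ⟨(j : ℕ) / 2, by omega⟩ (if (j : ℕ) % 2 = 0 then 1 else Complex.I)

variable {m : ℕ} {M : Type*} [TopologicalSpace M] [ChartedSpace (Fin m → ℂ) M]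

/-- `e` is a holomorphic chart of `M` in which `Y` is the slice `{z | z_i = 0 for i > d}`
(coordinates `z_1, …, z_m`). -/
def IsSliceChart (d : ℕ) (Y : Set M) (e : OpenPartialHomeomorph M (Fin m → ℂ)) : Prop :=
  e ∈ IsManifold.maximalAtlas 𝓘(ℂ, Fin m → ℂ) ω M ∧
    ∀ x ∈ e.source, x ∈ Y ↔ ∀ i : Fin m, d ≤ (i : ℕ) → e x i = 0

variable (m) in
/-- `Y` is a (possibly empty) complex submanifold of `M` of pure dimension `d`. -/
def IsComplexSubmanifold (d : ℕ) (Y : Set M) : Prop :=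
  ∀ y ∈ Y, ∃ e : OpenPartialHomeomorph M (Fin m → ℂ), IsSliceChart d Y e ∧ y ∈ e.source

/-- The integral over the slice `z_{d+1} = … = z_m = 0` of the chart `e` of a `2d`-form. -/
def sliceIntegral {d : ℕ} (e : OpenPartialHomeomorph M (Fin m → ℂ)) (φ : DForm m M (2 * d)) : ℂ :=
  ∫ w in {w : Fin d → ℂ | incl d m w ∈ e.target},
    pullback (fun w => e.symm (incl d m w)) φ w (stdFrame d)

variable (m) in
/-- A finite `C^∞` partition of unity along `Y`, subordinate to slice charts of `Y`. -/
structure SlicePartition (d : ℕ) (Y : Set M) where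
  size : ℕ
  chart : Fin size → OpenPartialHomeomorph M (Fin m → ℂ)
  isSliceChart : ∀ j, IsSliceChart d Y (chart j)
  weight : Fin size → M → ℝ
  smooth : ∀ j, ContMDiff 𝓘(ℝ, Fin m → ℂ) 𝓘(ℝ, ℝ) ∞ (weight j)
  tsupport_subset : ∀ j, tsupport (weight j) ⊆ (chart j).source
  sum_eq_one : ∀ y ∈ Y, ∑ j, weight j y = 1

/-- The integral of a `2d`-form computed with a given partition of unity. -/
def SlicePartition.integral {d : ℕ} {Y : Set M} (P : SlicePartition m d Y)
    (φ : DForm m M (2 * d)) : ℂ :=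
  ∑ j, sliceIntegral (P.chart j) (fun x => ((P.weight j x : ℝ) : ℂ) • φ x)

open Classical in
/-- The integral `∫_Y φ` of a smooth `2d`-form over a closed complex submanifold `Y` of dimension
`d` of a compact complex manifold `M`, that is, the value at `φ` of the current of integration
`[Y]`. It does not depend on the partition of unity used to compute it. The junk value `0` is taken
if there is no partition of unity, so in particular if `Y` is not a submanifold of dimension `d`. -/
def integralOver {d : ℕ} (Y : Set M) (φ : DForm m M (2 * d)) : ℂ :=
  if h : Nonempty (SlicePartition m d Y) then h.some.integral φ else 0

end Integration

/-! ### Hermitian holomorphic line bundles and Gaussian random sections -/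

section Bundle

variable {m : ℕ} {M : Type*} [TopologicalSpace M] [ChartedSpace (Fin m → ℂ) M]
  (L : M → Type*) [∀ x, AddCommGroup (L x)] [∀ x, Module ℂ (L x)]
  [∀ x, TopologicalSpace (L x)] [TopologicalSpace (Bundle.TotalSpace ℂ L)]
  [FiberBundle ℂ L]

/-- The local holomorphic frame `e_L` of `L` around `x` given by the preferred trivialization
at `x`. -/
def localFrame (x y : M) : L y := (trivializationAt ℂ L x).symm y 1

variable (m) in
/-- A `C^∞` Hermitian metric on the line bundle `L`. -/
structure HermitianMetric where
  core : ∀ x, InnerProductSpace.Core ℂ (L x)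
  smooth : ∀ x : M, ContMDiffOn 𝓘(ℝ, Fin m → ℂ) 𝓘(ℝ, ℝ) ∞
    (fun y => ((core y).inner (localFrame L x y) (localFrame L x y)).re)
    (trivializationAt ℂ L x).baseSet

variable {L}

/-- The squared norm `‖v‖_h^2`. -/
def HermitianMetric.normSq (h : HermitianMetric m L) {x : M} (v : L x) : ℝ :=
  ((h.core x).inner v v).re

/-- The Chern form `c₁(L, h) = (i / 2π) ∂∂̄ log a`, `a = ‖e_L‖_h^{-2}`. -/
def HermitianMetric.chernForm (h : HermitianMetric m L) : DForm m M 2 := fun x =>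
  (Complex.I / (2 * Real.pi)) •
    ddbar (fun y => ((Real.log (h.normSq (localFrame L x y))⁻¹ : ℝ) : ℂ)) x

variable [VectorBundle ℂ ℂ L]

variable (m L) in
/-- The space `H⁰(M, L)` of global holomorphic sections. -/
abbrev HolSection : Type _ := Cₛ^ω⟮𝓘(ℂ, Fin m → ℂ); ℂ, L⟯

/-- The σ-algebra on a space of sections generated by its linear functionals (in finite dimension,
the Borel σ-algebra). -/
instance instMeasurableSpaceSections (S : Submodule ℂ (HolSection m L)) : MeasurableSpace S :=
  ⨆ l : S →ₗ[ℂ] ℂ, MeasurableSpace.comap l inferInstance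

/-- The subspace `S` is base point free. -/
def IsBasePointFree (S : Submodule ℂ (HolSection m L)) : Prop :=
  ∀ x : M, ∃ s ∈ S, s x ≠ 0

/-- The standard complex Gaussian measure `π^{-n} e^{-|c|²} dc` on `ℂ^n`. -/
def stdGaussian (n : ℕ) : MeasureTheory.Measure (Fin n → ℂ) :=
  MeasureTheory.volume.withDensity fun c =>
    ENNReal.ofReal ((Real.pi ^ n)⁻¹ * Real.exp (-∑ j, ‖c j‖ ^ 2))

/-- The Gaussian measure `γ` on `S`: the law of `∑ c_j S_j` for `c` standard complex Gaussian, where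
`(S_j)` is the given (orthonormal) basis. -/
def gaussian {S : Submodule ℂ (HolSection m L)} {n : ℕ} (b : Module.Basis (Fin n) ℂ S) :
    MeasureTheory.Measure S :=
  (stdGaussian n).map fun c => ∑ j, c j • b j

/-- The Szegő kernel on the diagonal, `Π_S(z, z) = ∑ ‖S_j(z)‖_h²`, where `(S_j)` is the given
(orthonormal) basis. -/
def szego (h : HermitianMetric m L) {S : Submodule ℂ (HolSection m L)} {n : ℕ}
    (b : Module.Basis (Fin n) ℂ S) (z : M) : ℝ :=
  ∑ j, h.normSq ((b j : HolSection m L) z)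

/-- The form `(i / 2π) ∂∂̄ log Π_S(z, z) + c₁(L, h)`. -/
def expectedForm (h : HermitianMetric m L) {S : Submodule ℂ (HolSection m L)} {n : ℕ}
    (b : Module.Basis (Fin n) ℂ S) : DForm m M 2 := fun x =>
  (Complex.I / (2 * Real.pi)) • ddbar (fun z => ((Real.log (szego h b z) : ℝ) : ℂ)) x
    + h.chernForm x

/-- The simultaneous zero set of `k` sections. -/
def zeroSet {S : Submodule ℂ (HolSection m L)} {k : ℕ} (s : Fin k → S) : Set M :=
  {z | ∀ i, (s i : HolSection m L) z = 0}

/-- The simultaneous zero current `Z_{s₁,…,s_k}`, evaluated at the form `φ`: the integral of `φ`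
over the simultaneous zero set. -/
def zeroCurrent {S : Submodule ℂ (HolSection m L)} {k : ℕ} (s : Fin k → S)
    (φ : DForm m M (2 * (m - k))) : ℂ :=
  integralOver (zeroSet s) φ

end Bundle

end ZeroCurrent

end

/-! Dividing by a basis section `S_{j₀}` without zeros near a point turns the random sections into
linear combinations `∑_j C_{ij} φ_j`, where `φ_j = S_j / S_{j₀}` is holomorphic, `φ_{j₀} = 1` and
`C` is a Gaussian `k × n` matrix. By a partition of unity and polarization (`mem_span_volForm`),
every test form is a finite sum of forms `ρ · e^*(α^* vol)` with `e` a chart and `α : ℂ^m → ℂ^(m-k)`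
linear. Integrating such a form over a submanifold `Y` amounts to counting preimages: holomorphic
maps preserve orientation, so by the area formula the result is the integral over `t` of the sum of
`ρ(z)` over the `z ∈ Y` with `α(e(z)) = t` (`sliceIntegral_chartForm`). No slice chart is left in
that expression once the weights of a partition are summed.

The expectation is then a Kac–Rice computation. The incidence map `(C, z) ↦ (C, Cφ(z), α(z))` has
real Jacobian `|det (C dφ, α)|²`, and the area formula relates integrals over `(C, z)` to sums over
the solutions of `Cφ(z) = τ`, `α(z) = t`. Alone this gives information only for almost every `τ`,
while `τ = 0` is wanted. Because `φ_{j₀} = 1`, subtracting `τ` from column `j₀` of `C` turns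
solutions of `Cφ = τ` into zeros. So `(C, z)` is weighted by the Gaussian density of the shifted
matrix times a Gaussian density in `τ`; after a measure-preserving shear the `τ`-integral splits off
with value `1` (`integrable_and_integral_fibreSum`).

In the other order of integration, with `z` fixed, a linear change of variables on matrices (`tilt`)
makes the weight Gaussian again and replaces `dφ` by `B`, its projection orthogonal to `φ` divided
by `|φ|`. Second moments of independent Gaussians leave `π^{-k} ∑_J |det (B_{J₁}, …, B_{J_k}, α)|²`
(`integrable_and_integral_shiftCol`), which is the density of `((i/2π) ∑ B_j ∧ B̄_j)^k ∧ α^* vol`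
(`powWedge_sumPair_volForm`). Finally `∑ B_j ∧ B̄_j = ∂∂̄ log ∑ |φ_j|²`, a pulled back Fubini–Study
form (`extDeriv_dbar_log`). In a local frame `log Π_S = log ∑ |f_j|² + log ‖e_L‖²`, and the last
term cancels against the Chern form (`expectedForm_eq`).

That the zero set is almost surely a submanifold is Sard's theorem for `(C, z) ↦ C - Cφ(z) e_{j₀}`:
if `C` is a regular value of this map, then `0` is a regular value of `Cφ`
(`ae_surjective_fderiv_combo`). -/

noncomputable section

namespace ZeroCurrent

/-! ### The area formula with multiplicities -/

section AreaFormula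

open MeasureTheory Set Function

/-- A series of functions with summable `L¹`-norms converges almost everywhere, its sum is
integrable and can be integrated termwise. -/
theorem integrable_tsum_of_tsum_lintegral_ne_top {X F : Type*} [MeasurableSpace X] {μ : Measure X}
    [NormedAddCommGroup F] [NormedSpace ℝ F] [CompleteSpace F] {v : ℕ → X → F}
    (hv : ∀ n, AEStronglyMeasurable (v n) μ) (h : ∑' n, ∫⁻ a, ‖v n a‖ₑ ∂μ ≠ ⊤) :
    (∀ᵐ a ∂μ, Summable fun n => v n a) ∧ Integrable (fun a => ∑' n, v n a) μ ∧
      ∫ a, ∑' n, v n a ∂μ = ∑' n, ∫ a, v n a ∂μ := by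
  have h2 : ∫⁻ a, ∑' n, ‖v n a‖ₑ ∂μ ≠ ⊤ := by
    rwa [lintegral_tsum fun n => (hv n).enorm]
  have h3 : ∀ᵐ a ∂μ, Summable fun n => v n a := by
    filter_upwards [ae_lt_top' (AEMeasurable.tsum fun n => (hv n).enorm) h2] with a ha
    have : Summable fun n => ‖v n a‖₊ := ENNReal.tsum_coe_ne_top_iff_summable.1 ha.ne
    exact this.of_nnnorm
  refine ⟨h3, ⟨?_, ?_⟩, integral_tsum hv h⟩
  · refine aestronglyMeasurable_of_tendsto_ae (u := Filter.atTop)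
      (f := fun N a => ∑ n ∈ Finset.range N, v n a) (fun N => ?_) ?_
    · exact Finset.aestronglyMeasurable_fun_sum _ fun n _ => hv n
    · filter_upwards [h3] with a ha using ha.hasSum.tendsto_sum_nat
  · exact (lintegral_mono fun a => enorm_tsum_le_tsum_enorm).trans_lt h2.lt_top

variable {E F : Type*} [NormedAddCommGroup E] [NormedSpace ℝ E] [FiniteDimensional ℝ E]
  [MeasurableSpace E] [BorelSpace E] [NormedAddCommGroup F] [NormedSpace ℝ F] [CompleteSpace F]

/-- A set on which a map has invertible derivative is a countable union of disjoint measurable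
pieces on which the map is injective. -/
theorem exists_partition_injOn {s : Set E} {f : E → E} {f' : E → E →L[ℝ] E}
    (hf : ∀ x ∈ s, HasFDerivWithinAt f (f' x) s x) (hdet : ∀ x ∈ s, (f' x).det ≠ 0) :
    ∃ t : ℕ → Set E, Pairwise (Disjoint on t) ∧ (∀ n, MeasurableSet (t n)) ∧ (s ⊆ ⋃ n, t n) ∧
      ∀ n, InjOn f (s ∩ t n) := by
  rcases s.eq_empty_or_nonempty with rfl | hne
  · exact ⟨fun _ => ∅, fun i j _ => by simp [Function.onFun], fun _ => .empty, by simp, by simp⟩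
  -- A map that is closer to an invertible `A` than `1 / ‖A⁻¹‖` is injective; half of that bound is
  -- strict. Singular `A` get the dummy radius `1`: every piece of the partition is attached to some
  -- `f' y` with `y ∈ s`, which is invertible.
  have hr : ∀ A : E →L[ℝ] E, ∃ r : NNReal, r ≠ 0 ∧
      (A.det ≠ 0 → ∀ t, ApproximatesLinearOn f A t r → InjOn f t) := by
    intro A
    by_cases hA : A.det = 0
    · exact ⟨1, one_ne_zero, fun h => absurd hA h⟩
    rcases subsingleton_or_nontrivial E with hE | hE
    · exact ⟨1, one_ne_zero, fun _ t _ => fun a _ b _ _ => Subsingleton.elim a b⟩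
    let B := A.toContinuousLinearEquivOfDetNeZero hA
    have hpos : 0 < ‖(B.symm : E →L[ℝ] E)‖₊⁻¹ := by
      have := B.symm.norm_pos
      simpa using inv_pos.2 (show 0 < ‖(B.symm : E →L[ℝ] E)‖₊ from this)
    refine ⟨‖(B.symm : E →L[ℝ] E)‖₊⁻¹ / 2, by positivity, fun _ t ht => ?_⟩
    have ht' : ApproximatesLinearOn f (B : E →L[ℝ] E) t (‖(B.symm : E →L[ℝ] E)‖₊⁻¹ / 2) := ht
    exact ht'.injOn (Or.inr (NNReal.half_lt_self hpos.ne'))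
  choose r hr0 hr using hr
  obtain ⟨t, A, h1, h2, h3, h4, h5⟩ :=
    exists_partition_approximatesLinearOn_of_hasFDerivWithinAt f s f' hf r hr0
  refine ⟨t, h1, h2, h3, fun n => hr (A n) ?_ _ (h4 n)⟩
  obtain ⟨y, hy, hAy⟩ := h5 hne n
  rw [hAy]; exact hdet y hy

/-- **Area formula** with multiplicities: integrating the sums over the fibres of `f`. -/
theorem area_formula (μ : Measure E) [μ.IsAddHaarMeasure] {s : Set E} (hs : MeasurableSet s)
    {f : E → E} {f' : E → E →L[ℝ] E} (hf : ∀ x ∈ s, HasFDerivWithinAt f (f' x) s x)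
    (hf' : ContinuousOn f' s) {u : E → F}
    (hu : IntegrableOn (fun x => |(f' x).det| • u x) s μ) :
    (∀ᵐ y ∂μ, Summable fun x : {x // x ∈ s ∧ f x = y} => u x) ∧
      Integrable (fun y => ∑' x : {x // x ∈ s ∧ f x = y}, u x) μ ∧
      ∫ y, ∑' x : {x // x ∈ s ∧ f x = y}, u x ∂μ = ∫ x in s, |(f' x).det| • u x ∂μ := by
  classical
  have hdetc : ContinuousOn (fun x => (f' x).det) s :=
    ContinuousLinearMap.continuous_det.comp_continuousOn hf'
  obtain ⟨o, ho, hos⟩ := (continuousOn_iff'.1 hdetc) {0}ᶜ isOpen_compl_singleton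
  -- The noncritical points. They form a relatively open subset of `s`, hence a measurable one,
  -- because the determinant is continuous on `s`.
  set s0 : Set E := o ∩ s with hs0
  have hs0' : s0 = {x | x ∈ s ∧ (f' x).det ≠ 0} := by
    rw [← hos]; ext x; simp [and_comm]
  have hs0m : MeasurableSet s0 := ho.measurableSet.inter hs
  have hs0s : s0 ⊆ s := inter_subset_right
  have hdet0 : ∀ x ∈ s0, (f' x).det ≠ 0 := fun x hx => by rw [hs0'] at hx; exact hx.2
  obtain ⟨t, ht1, ht2, ht3, ht4⟩ := exists_partition_injOn
    (fun x hx => (hf x (hs0s hx)).mono hs0s) hdet0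
  set p : ℕ → Set E := fun n => s0 ∩ t n with hp
  have hps : ∀ n, p n ⊆ s := fun n => inter_subset_left.trans hs0s
  have hpm : ∀ n, MeasurableSet (p n) := fun n => hs0m.inter (ht2 n)
  have hfp : ∀ n, ∀ x ∈ p n, HasFDerivWithinAt f (f' x) (p n) x :=
    fun n x hx => (hf x (hps n hx)).mono (hps n)
  have hpU : ⋃ n, p n = s0 := by
    rw [hp, ← inter_iUnion]; exact inter_eq_left.2 ht3
  have hpd : Pairwise (Disjoint on p) :=
    fun i j hij => (ht1 hij).mono inter_subset_right inter_subset_right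
  -- `g n y` is the value of `u` at the unique preimage of `y` in the piece `p n`, and `0` if there
  -- is none. The injective change of variables applies to each `g n` separately.
  set g : ℕ → E → F := fun n y => if h : ∃ x ∈ p n, f x = y then u h.choose else 0 with hg
  have hgf : ∀ n, ∀ x ∈ p n, g n (f x) = u x := by
    intro n x hx
    have h : ∃ x' ∈ p n, f x' = f x := ⟨x, hx, rfl⟩
    simp only [hg, dif_pos h]
    congr 1
    exact ht4 n h.choose_spec.1 hx h.choose_spec.2
  have hg0 : ∀ n y, y ∉ f '' p n → g n y = 0 := by
    intro n y hy
    simp only [hg]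
    rw [dif_neg]
    rintro ⟨x, hx, rfl⟩; exact hy ⟨x, hx, rfl⟩
  have hgind : ∀ n, g n = (f '' p n).indicator (g n) := by
    intro n; ext y; by_cases hy : y ∈ f '' p n
    · rw [indicator_of_mem hy]
    · rw [indicator_of_notMem hy, hg0 n y hy]
  have hfpm : ∀ n, MeasurableSet (f '' p n) := fun n =>
    measurable_image_of_fderivWithin (hpm n) (hfp n) (ht4 n)
  have hInt : ∀ n, Integrable (g n) μ := by
    intro n
    rw [hgind, integrable_indicator_iff (hfpm n),
      integrableOn_image_iff_integrableOn_abs_det_fderiv_smul μ (hpm n) (hfp n) (ht4 n)]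
    refine (hu.mono_set (hps n)).congr_fun (fun x hx => ?_) (hpm n)
    simp only [hgf n x hx]
  have hval : ∀ n, ∫ y, g n y ∂μ = ∫ x in p n, |(f' x).det| • u x ∂μ := by
    intro n
    rw [hgind, integral_indicator (hfpm n),
      integral_image_eq_integral_abs_det_fderiv_smul μ (hpm n) (hfp n) (ht4 n)]
    refine setIntegral_congr_fun (hpm n) (fun x hx => ?_)
    simp only [hgf n x hx]
  have hnorm : ∀ n, ∫⁻ y, ‖g n y‖ₑ ∂μ = ∫⁻ x in p n, ‖|(f' x).det| • u x‖ₑ ∂μ := by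
    intro n
    have : (fun y => ‖g n y‖ₑ) = (f '' p n).indicator (fun y => ‖g n y‖ₑ) := by
      ext y; by_cases hy : y ∈ f '' p n
      · rw [indicator_of_mem hy]
      · rw [indicator_of_notMem hy, hg0 n y hy, enorm_zero]
    rw [this, lintegral_indicator (hfpm n),
      lintegral_image_eq_lintegral_abs_det_fderiv_mul μ (hpm n) (hfp n) (ht4 n)]
    refine setLIntegral_congr_fun (hpm n) (fun x hx => ?_)
    simp only [hgf n x hx, enorm_smul]
    rw [Real.enorm_eq_ofReal (abs_nonneg _)]
  have hsum : ∑' n, ∫⁻ y, ‖g n y‖ₑ ∂μ ≠ ⊤ := by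
    simp_rw [hnorm]
    rw [← lintegral_iUnion hpm hpd, hpU]
    exact (lt_of_le_of_lt (lintegral_mono_set hs0s) hu.2).ne
  obtain ⟨hA, hB, hC⟩ := integrable_tsum_of_tsum_lintegral_ne_top (fun n => (hInt n).1) hsum
  -- Critical values are negligible, so almost every fibre lies entirely in the pieces.
  have hcrit : μ (f '' (s \ s0)) = 0 := by
    refine addHaar_image_eq_zero_of_det_fderivWithin_eq_zero μ
      (fun x hx => (hf x hx.1).mono sdiff_subset) (fun x hx => ?_)
    by_contra h
    exact hx.2 (by rw [hs0']; exact ⟨hx.1, h⟩)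
  have hae : ∀ᵐ y ∂μ, y ∉ f '' (s \ s0) := by
    exact measure_eq_zero_iff_ae_notMem.1 hcrit
  -- Off the critical values, each point of a fibre lies in exactly one piece and each piece holds
  -- at most one point, so the sum over the fibre is a reindexing of `∑ g n y`. Phrasing it with
  -- `HasSum` transfers summability together with the value.
  have hfib : ∀ y, y ∉ f '' (s \ s0) → ∀ a,
      HasSum (fun x : {x // x ∈ s ∧ f x = y} => u x) a ↔ HasSum (fun n => g n y) a := by
    intro y hy a
    have hx0 : ∀ x : {x // x ∈ s ∧ f x = y}, ∃ n, (x : E) ∈ p n := by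
      intro x
      have : (x : E) ∈ s0 := by
        by_contra h
        exact hy ⟨x, ⟨x.2.1, h⟩, x.2.2⟩
      rw [← hpU] at this
      exact mem_iUnion.1 this
    choose N hN using hx0
    have hNinj : Injective N := by
      intro x x' h
      have h2 := hN x'
      rw [← h] at h2
      exact Subtype.ext (ht4 _ (hN x) h2 (x.2.2.trans x'.2.2.symm))
    rw [← hNinj.hasSum_iff]
    · have : (fun x : {x // x ∈ s ∧ f x = y} => u x) = (fun n => g n y) ∘ N := by
        ext x
        simp only [comp_apply]
        rw [← hgf (N x) x (hN x), x.2.2]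
      rw [this]
    · intro n hn
      refine hg0 n y ?_
      rintro ⟨x, hx, hxy⟩
      refine hn ⟨⟨x, hps n hx, hxy⟩, ?_⟩
      by_contra hne
      exact (disjoint_left.1 (hpd hne)) (hN ⟨x, hps n hx, hxy⟩) hx
  have htsum : (fun y => ∑' n, g n y) =ᵐ[μ] fun y => ∑' x : {x // x ∈ s ∧ f x = y}, u x := by
    filter_upwards [hA, hae] with y h1 h2
    exact ((hfib y h2 _).2 h1.hasSum).tsum_eq.symm
  refine ⟨?_, hB.congr htsum, ?_⟩
  · filter_upwards [hA, hae] with y h1 h2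
    exact ((hfib y h2 _).2 h1.hasSum).summable
  · rw [← integral_congr_ae htsum, hC]
    simp_rw [hval]
    have h1 : HasSum (fun n => ∫ x in p n, |(f' x).det| • u x ∂μ)
        (∫ x in ⋃ n, p n, |(f' x).det| • u x ∂μ) :=
      hasSum_integral_iUnion hpm hpd (by rw [hpU]; exact hu.mono_set hs0s)
    rw [h1.tsum_eq, hpU]
    refine setIntegral_eq_of_subset_of_forall_sdiff_eq_zero hs hs0s (fun x hx => ?_) |>.symm
    have : (f' x).det = 0 := by
      by_contra h
      exact hx.2 (by rw [hs0']; exact ⟨hx.1, h⟩)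
    simp [this]

end AreaFormula

/-! ### Sard's theorem for holomorphic maps -/

section Sard

open MeasureTheory Set Function Filter Topology

/-- The holomorphic inverse function theorem. -/
theorem exists_openPartialHomeomorph_of_fderiv_eq_equiv {E E' : Type*} [NormedAddCommGroup E]
    [NormedSpace ℂ E] [CompleteSpace E] [NormedAddCommGroup E'] [NormedSpace ℂ E']
    [CompleteSpace E'] {Φ : E → E'} {z₀ : E} (hΦ : ContDiffAt ℂ ω Φ z₀) (A : E ≃L[ℂ] E')
    (hA : fderiv ℂ Φ z₀ = A) {U : Set E} (hU : U ∈ 𝓝 z₀) :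
    ∃ ψ : OpenPartialHomeomorph E E', z₀ ∈ ψ.source ∧ ψ.source ⊆ U ∧ (∀ z, ψ z = Φ z) ∧
      ContDiffOn ℂ ω Φ ψ.source ∧ ContDiffOn ℂ ω ψ.symm ψ.target := by
  have hd : HasFDerivAt Φ (A : E →L[ℂ] E') z₀ := by
    rw [← hA]; exact (hΦ.differentiableAt (by simp)).hasFDerivAt
  let ψ₀ := hΦ.toOpenPartialHomeomorph Φ hd (by simp)
  have hψ₀ : ∀ z, ψ₀ z = Φ z := fun z => rfl
  -- Invertibility of the derivative and analyticity are open conditions; restricting to where both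
  -- hold makes the inverse analytic on the whole target, not only at the image of `z₀`.
  have hev : ∀ᶠ z in 𝓝 z₀, z ∈ U ∧ ContDiffAt ℂ ω Φ z ∧
      ∃ B : E ≃L[ℂ] E', (B : E →L[ℂ] E') = fderiv ℂ Φ z := by
    refine (eventually_mem_set.2 hU).and ((hΦ.eventually (by simp)).and ?_)
    have hc : ContinuousAt (fderiv ℂ Φ) z₀ :=
      (hΦ.fderiv_right (m := 0) (by simp)).continuousAt
    have : range ((↑) : (E ≃L[ℂ] E') → E →L[ℂ] E') ∈ 𝓝 (fderiv ℂ Φ z₀) := by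
      rw [hA]; exact A.nhds
    exact hc this
  obtain ⟨O, hOsub, hO, hzO⟩ := eventually_nhds_iff.1 hev |>.imp fun O h => h
  refine ⟨ψ₀.restrOpen O hO, ⟨hΦ.mem_toOpenPartialHomeomorph_source hd (by simp), hzO⟩, ?_,
    fun z => rfl, ?_, ?_⟩
  · exact fun z hz => (hOsub z hz.2).1
  · exact fun z hz => (hOsub z hz.2).2.1.contDiffWithinAt
  · intro y hy
    have hz := (ψ₀.restrOpen O hO).map_target hy
    obtain ⟨-, h1, B, hB⟩ := hOsub _ hz.2
    refine ((ψ₀.restrOpen O hO).contDiffAt_symm hy (f₀' := B) ?_ h1).contDiffWithinAt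
    rw [hB]
    exact (h1.differentiableAt (by simp)).hasFDerivAt

/-- Near a point where `dw ≠ 0`, the function `w` is a coordinate. -/
theorem exists_straightening {E : Type*} [NormedAddCommGroup E] [NormedSpace ℂ E]
    [FiniteDimensional ℂ E] {w : E → ℂ} {z₀ : E} (hw : ContDiffAt ℂ ω w z₀)
    (hdw : fderiv ℂ w z₀ ≠ 0) {U : Set E} (hU : U ∈ 𝓝 z₀) :
    ∃ (T : Set (ℂ × (fderiv ℂ w z₀).ker)) (h : ℂ × (fderiv ℂ w z₀).ker → E)
      (q : E → (fderiv ℂ w z₀).ker), IsOpen T ∧ ContDiffOn ℂ ω h T ∧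
      (∀ y ∈ T, h y ∈ U ∧ w (h y) = y.1) ∧ ∀ᶠ z in 𝓝 z₀, (w z, q z) ∈ T ∧ h (w z, q z) = z := by
  have := FiniteDimensional.complete ℂ E
  set a := fderiv ℂ w z₀ with ha
  obtain ⟨v, hv⟩ : ∃ v, a v = 1 := by
    obtain ⟨v, hv⟩ := DFunLike.ne_iff.1 hdw
    exact ⟨(a v)⁻¹ • v, by simpa using inv_mul_cancel₀ hv⟩
  -- `P` is the projection onto `ker a` along `v`, where `a v = 1`. Thus `z ↦ (a z, P z)` is an
  -- isomorphism with inverse `(c, κ) ↦ c v + κ`, and it is the derivative of `z ↦ (w z, P z)` at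
  -- `z₀`.
  let P : E →L[ℂ] a.ker := (ContinuousLinearMap.id ℂ E - a.smulRight v).codRestrict a.ker
    (fun z => by simp [hv])
  let A : E ≃L[ℂ] ℂ × a.ker := ContinuousLinearEquiv.equivOfInverse (a.prod P)
    ((ContinuousLinearMap.fst ℂ ℂ a.ker).smulRight v + a.ker.subtypeL ∘L
      ContinuousLinearMap.snd ℂ ℂ a.ker)
    (fun z => by simp [P])
    (fun y => by
      have h2 : a (y.2 : E) = 0 := y.2.2
      ext <;> simp [P, hv, h2])
  obtain ⟨ψ, h1, h2, h3, h4, h5⟩ := exists_openPartialHomeomorph_of_fderiv_eq_equiv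
    (Φ := fun z => (w z, P z)) (hw.prodMk P.contDiff.contDiffAt) A
    (by
      have := (hw.differentiableAt (by simp)).hasFDerivAt.prodMk (P.hasFDerivAt (x := z₀))
      rw [this.fderiv]; rfl) hU
  refine ⟨ψ.target, ψ.symm, P, ψ.open_target, h5, fun y hy => ⟨h2 (ψ.map_target hy), ?_⟩, ?_⟩
  · have := ψ.right_inv hy
    rw [h3] at this
    exact congrArg Prod.fst this
  · filter_upwards [ψ.open_source.mem_nhds h1] with z hz
    have := h3 z
    rw [← this]
    exact ⟨ψ.map_source hz, ψ.left_inv hz⟩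

theorem finrank_ker_lt {E : Type*} [AddCommGroup E] [Module ℂ E]
    [FiniteDimensional ℂ E] [TopologicalSpace E] {a : E →L[ℂ] ℂ} (ha : a ≠ 0) :
    Module.finrank ℂ a.ker < Module.finrank ℂ E := by
  apply Submodule.finrank_lt
  intro h
  apply ha
  ext z
  have : z ∈ a.ker := by rw [h]; trivial
  exact this

/-- Second countability extracts a countable subcover of `A` from the given neighbourhoods. -/
theorem measure_image_eq_zero_of_locally {E Y : Type*} [TopologicalSpace E]
    [SecondCountableTopology E] [MeasurableSpace Y] {μ : Measure Y} {g : E → Y} {A : Set E}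
    (h : ∀ z ∈ A, ∃ V ∈ 𝓝 z, μ (g '' (A ∩ V)) = 0) : μ (g '' A) = 0 := by
  choose! V hV hV0 using h
  obtain ⟨t, htA, htc, ht⟩ := TopologicalSpace.countable_cover_nhdsWithin
    (fun z hz => mem_nhdsWithin_of_mem_nhds (hV z hz))
  refine measure_mono_null (t := ⋃ z ∈ t, g '' (A ∩ V z)) ?_
    ((measure_biUnion_null_iff htc).2 fun z hz => hV0 z (htA hz))
  rintro _ ⟨z, hz, rfl⟩
  obtain ⟨x, hx, hzx⟩ := mem_iUnion₂.1 (ht hz)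
  exact mem_iUnion₂.2 ⟨x, hx, z, ⟨hz, hzx⟩, rfl⟩

/-- A holomorphic map all of whose derivatives vanish at a point is locally constant there. -/
theorem eventually_eq_of_iteratedFDeriv_eq_zero {E F : Type*} [NormedAddCommGroup E]
    [NormedSpace ℂ E] [NormedAddCommGroup F] [NormedSpace ℂ F] [CompleteSpace F] {g : E → F}
    {z₀ : E} (hg : ContDiffAt ℂ ω g z₀) (h : ∀ j, 1 ≤ j → iteratedFDeriv ℂ j g z₀ = 0) :
    ∀ᶠ z in 𝓝 z₀, g z = g z₀ := by
  obtain ⟨p, r, hp⟩ := hg.analyticAt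
  have hb : Metric.eball z₀ r ∈ 𝓝 z₀ := Metric.eball_mem_nhds _ hp.r_pos
  filter_upwards [hb] with z hz
  have hy : z - z₀ ∈ Metric.eball (0 : E) r := by
    simpa [edist_eq_enorm_sub] using hz
  have h1 := hp.hasSum_iteratedFDeriv hy
  have h2 : HasSum (fun n : ℕ => ((n.factorial : ℂ))⁻¹ • iteratedFDeriv ℂ n g z₀
      fun _ => z - z₀) (g z₀) := by
    convert hasSum_single 0 ?_ using 1
    · simp
    · intro n hn
      rw [h n (Nat.one_le_iff_ne_zero.2 hn)]; simp
  simpa using h1.unique h2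

/-- Surjectivity onto `ℂ^k` says that the rank is at least `k`, and rank is lower semicontinuous. -/
theorem isOpen_setOf_surjective {E : Type*} [NormedAddCommGroup E] [NormedSpace ℂ E] {k : ℕ} :
    IsOpen {f : E →L[ℂ] (Fin k → ℂ) | Surjective f} := by
  have : {f : E →L[ℂ] (Fin k → ℂ) | Surjective f} =
      {f : E →L[ℂ] (Fin k → ℂ) | (k : Cardinal) ≤ (f : E →ₗ[ℂ] (Fin k → ℂ)).rank} := by
    ext f
    simp only [mem_ofPred_eq, LinearMap.rank]
    rw [← Module.finrank_eq_rank, Nat.cast_le]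
    constructor
    · intro h
      have h2 : LinearMap.range (f : E →ₗ[ℂ] (Fin k → ℂ)) = ⊤ := LinearMap.range_eq_top.2 h
      rw [h2]
      simp
    · intro h
      have h2 : LinearMap.range (f : E →ₗ[ℂ] (Fin k → ℂ)) = ⊤ :=
        Submodule.eq_top_of_finrank_eq
          (le_antisymm (Submodule.finrank_le _) (by simpa using h))
      exact LinearMap.range_eq_top.1 h2
  rw [this]
  exact isOpen_setOfPred_nat_le_rank k

/-- The set of critical points of `g` in `U`. -/
def critSet {E F : Type*} [NormedAddCommGroup E] [NormedSpace ℂ E] [NormedAddCommGroup F]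
    [NormedSpace ℂ F] (g : E → F) (U : Set E) : Set E :=
  {z ∈ U | ¬ Surjective (fderiv ℂ g z)}

/-- Induction on the source dimension. The critical set splits by the order to which the derivative
vanishes: not at all, to finite order, or to infinite order. The first two kinds lie locally on, or
are sliced by, hypersurfaces of smaller dimension. The third is harmless for holomorphic maps, which
are locally constant at such points; no Taylor estimate of volumes is needed. The space `E` varies
in the induction because the hypothesis is used on the kernel of a linear form. -/
theorem sard_aux (N : ℕ) : ∀ (E : Type*) [NormedAddCommGroup E] [NormedSpace ℂ E]
    [FiniteDimensional ℂ E], Module.finrank ℂ E = N → ∀ (k : ℕ) (U : Set E), IsOpen U →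
    ∀ g : E → Fin k → ℂ, ContDiffOn ℂ ω g U → volume (g '' critSet g U) = 0 := by
  induction N using Nat.strong_induction_on with
  | _ N ih =>
  intro E _ _ _ hE k U hU g hg
  have : ProperSpace E := FiniteDimensional.proper ℂ E
  obtain _ | k := k
  · have : critSet g U = ∅ := by
      ext z
      simp only [critSet, mem_ofPred_eq, mem_empty_iff_false, iff_false, not_and, not_not]
      exact fun _ => Function.surjective_to_subsingleton _
    simp [this]
  have hgat : ∀ z ∈ U, ContDiffAt ℂ ω g z := fun z hz => hg.contDiffAt (hU.mem_nhds hz)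
  have hgd : ∀ z ∈ U, DifferentiableAt ℂ g z := fun z hz => (hgat z hz).differentiableAt (by simp)
  set A0 : Set E := {z ∈ critSet g U | fderiv ℂ g z ≠ 0} with hA0
  set A : ℕ → Set E := fun i => {z ∈ critSet g U | fderiv ℂ g z = 0 ∧
    iteratedFDeriv ℂ i g z = 0 ∧ iteratedFDeriv ℂ (i + 1) g z ≠ 0} with hA
  set B : Set E := {z ∈ critSet g U | ∀ j, 1 ≤ j → iteratedFDeriv ℂ j g z = 0} with hB
  have hcover : critSet g U ⊆ A0 ∪ ((⋃ i, A i) ∪ B) := by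
    intro z hz
    by_cases h0 : fderiv ℂ g z = 0
    swap
    · exact Or.inl ⟨hz, h0⟩
    right
    by_cases h1 : ∀ j, 1 ≤ j → iteratedFDeriv ℂ j g z = 0
    · exact Or.inr ⟨hz, h1⟩
    left
    push Not at h1
    classical
    have hfind := Nat.find_spec h1
    have hmin := fun j => Nat.find_min h1 (m := j)
    set j := Nat.find h1 with hj
    have h11 : iteratedFDeriv ℂ 1 g z = 0 := by
      ext v
      rw [iteratedFDeriv_one_apply, h0]; rfl
    have hj1 : j ≠ 1 := fun h => hfind.2 (by rw [h]; exact h11)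
    obtain ⟨i, hi⟩ : ∃ i, j = i + 1 := ⟨j - 1, by omega⟩
    refine mem_iUnion.2 ⟨i, hz, h0, ?_, by rw [← hi]; exact hfind.2⟩
    have := hmin i (by omega)
    push Not at this
    exact this (by omega)
  -- points where all derivatives vanish
  have hBnull : volume (g '' B) = 0 := by
    refine measure_image_eq_zero_of_locally fun z hz => ?_
    refine ⟨_, eventually_eq_of_iteratedFDeriv_eq_zero (hgat z hz.1.1) hz.2,
      measure_mono_null (t := {g z}) ?_ (measure_singleton _)⟩
    rintro _ ⟨x, hx, rfl⟩
    exact hx.2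
  -- points where the derivative vanishes to finite order
  have hAnull : ∀ i, volume (g '' A i) = 0 := by
    intro i
    refine measure_image_eq_zero_of_locally fun z₀ hz₀ => ?_
    obtain ⟨v, hv⟩ : ∃ v, iteratedFDeriv ℂ (i + 1) g z₀ v ≠ 0 := by
      by_contra h
      push Not at h
      exact hz₀.2.2.2 (ContinuousMultilinearMap.ext h)
    obtain ⟨l, hl⟩ := Function.ne_iff.1 hv
    -- The function `w` is a component of the `i`-th derivative. It vanishes on `A i`, but its
    -- differential at `z₀` is nonzero on `v 0`. So near `z₀` the set `A i` lies on the hypersurface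
    -- `w = 0`; its points remain critical for the restriction of `g`, since `dg = 0` there.
    let ev : ContinuousMultilinearMap ℂ (fun _ : Fin i => E) (Fin (k + 1) → ℂ) →L[ℂ] ℂ :=
      (ContinuousLinearMap.proj l).comp
        (ContinuousMultilinearMap.apply ℂ (fun _ : Fin i => E) (Fin (k + 1) → ℂ) (Fin.tail v))
    set w : E → ℂ := fun z => ev (iteratedFDeriv ℂ i g z) with hw
    have hit : ContDiffAt ℂ ω (iteratedFDeriv ℂ i g) z₀ :=
      (hgat z₀ hz₀.1.1).iteratedFDeriv_right (m := ω) (by simp)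
    have hwc : ContDiffAt ℂ ω w z₀ := ev.contDiff.contDiffAt.comp z₀ hit
    have hdw : fderiv ℂ w z₀ ≠ 0 := by
      intro h
      apply hl
      have h1 : HasFDerivAt w (ev.comp (fderiv ℂ (iteratedFDeriv ℂ i g) z₀)) z₀ :=
        ev.hasFDerivAt.comp z₀ (hit.differentiableAt (by simp)).hasFDerivAt
      rw [h1.fderiv] at h
      have h2 := DFunLike.congr_fun h (v 0)
      rw [iteratedFDeriv_succ_apply_left]
      exact h2
    obtain ⟨T, h, q, hT, hh, hhT, hq⟩ := exists_straightening hwc hdw (hU.mem_nhds hz₀.1.1)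
    refine ⟨_, hq, ?_⟩
    let K := (fderiv ℂ w z₀).ker
    set T0 : Set K := {κ | ((0 : ℂ), κ) ∈ T} with hT0
    have hT0o : IsOpen T0 := hT.preimage (by fun_prop)
    have hG : ContDiffOn ℂ ω (fun κ : K => g (h (0, κ))) T0 := by
      refine hg.comp (hh.comp (by fun_prop) fun κ hκ => hκ) fun κ hκ => (hhT _ hκ).1
    have hnull := ih _ (by rw [← hE]; exact finrank_ker_lt hdw) K rfl (k + 1) T0 hT0o _ hG
    refine measure_mono_null ?_ hnull
    rintro _ ⟨z, ⟨hz, hzT, hzh⟩, rfl⟩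
    have hwz : w z = 0 := by
      simp only [hw]; rw [hz.2.2.1, map_zero]
    rw [hwz] at hzT hzh
    refine ⟨q z, ⟨hzT, ?_⟩, by simp only [hzh]⟩
    have hd : HasFDerivAt (fun κ : K => g (h (0, κ))) (0 : K →L[ℂ] (Fin (k + 1) → ℂ)) (q z) := by
      have h1 : DifferentiableAt ℂ (fun κ : K => h (0, κ)) (q z) := by
        have h2 : DifferentiableAt ℂ h (0, q z) :=
          (hh.contDiffAt (hT.mem_nhds hzT)).differentiableAt (by simp)
        exact h2.comp (q z) (by fun_prop)
      have h3 : HasFDerivAt g (0 : E →L[ℂ] (Fin (k + 1) → ℂ)) (h (0, q z)) := by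
        rw [hzh, ← hz.2.1]; exact (hgd z hz.1.1).hasFDerivAt
      simpa using h3.comp (q z) h1.hasFDerivAt
    rw [hd.fderiv]
    intro hs
    obtain ⟨x, hx⟩ := hs (fun _ => 1)
    have := congrFun hx 0
    simp at this
  -- critical points with nonzero derivative: slice along a component of `g`
  have hA0null : volume (g '' A0) = 0 := by
    refine measure_image_eq_zero_of_locally fun z₀ hz₀ => ?_
    obtain ⟨v, hv⟩ := DFunLike.ne_iff.1 hz₀.2
    obtain ⟨l, hl⟩ := Function.ne_iff.1 hv
    set w : E → ℂ := fun z => g z l with hw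
    have hwc : ContDiffAt ℂ ω w z₀ := contDiffAt_pi.1 (hgat z₀ hz₀.1.1) l
    have hwd : ∀ z ∈ U, HasFDerivAt w ((ContinuousLinearMap.proj l).comp (fderiv ℂ g z)) z :=
      fun z hz => ((ContinuousLinearMap.proj (R := ℂ) (φ := fun _ : Fin (k + 1) => ℂ)
        l).hasFDerivAt).comp z (hgd z hz).hasFDerivAt
    have hdw : fderiv ℂ w z₀ ≠ 0 := by
      rw [(hwd z₀ hz₀.1.1).fderiv]
      intro h
      exact hl (DFunLike.congr_fun h v)
    obtain ⟨T, h, q, hT, hh, hhT, hq⟩ := exists_straightening hwc hdw (hU.mem_nhds hz₀.1.1)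
    obtain ⟨r, hr, hball⟩ := Metric.nhds_basis_closedBall.mem_iff.1
      (inter_mem hq (hU.mem_nhds hz₀.1.1))
    refine ⟨Metric.closedBall z₀ r, Metric.closedBall_mem_nhds _ hr, ?_⟩
    refine measure_mono_null (image_mono (inter_subset_inter_left _ (fun z hz => hz.1))) ?_
    -- Fubini below requires a measurable set. Cutting down to a closed ball makes the critical set,
    -- and with it its image, compact.
    have hcl : IsCompact (critSet g U ∩ Metric.closedBall z₀ r) := by
      have hfc : ContinuousOn (fderiv ℂ g) (Metric.closedBall z₀ r) := fun z hz =>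
        ((hgat z (hball hz).2).fderiv_right (m := 0) (by simp)).continuousAt.continuousWithinAt
      have h1 : IsClosed (Metric.closedBall z₀ r ∩
          fderiv ℂ g ⁻¹' {f : E →L[ℂ] (Fin (k + 1) → ℂ) | Surjective f}ᶜ) :=
        hfc.preimage_isClosed_of_isClosed Metric.isClosed_closedBall
          isOpen_setOf_surjective.isClosed_compl
      have h2 : critSet g U ∩ Metric.closedBall z₀ r = Metric.closedBall z₀ r ∩
          fderiv ℂ g ⁻¹' {f : E →L[ℂ] (Fin (k + 1) → ℂ) | Surjective f}ᶜ := by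
        ext z
        constructor
        · rintro ⟨⟨_, h3⟩, h4⟩; exact ⟨h4, h3⟩
        · rintro ⟨h4, h3⟩; exact ⟨⟨(hball h4).2, h3⟩, h4⟩
      rw [h2]
      exact (isCompact_closedBall z₀ r).of_isClosed_subset h1 inter_subset_left
    have himg : IsCompact (g '' (critSet g U ∩ Metric.closedBall z₀ r)) :=
      hcl.image_of_continuousOn fun z hz => (hgat z hz.1.1).continuousAt.continuousWithinAt
    set S := g '' (critSet g U ∩ Metric.closedBall z₀ r) with hS
    have hSm : MeasurableSet S := himg.isClosed.measurableSet
    let e := MeasurableEquiv.piFinSuccAbove (fun _ : Fin (k + 1) => ℂ) l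
    have he : MeasurePreserving e volume volume :=
      volume_preserving_piFinSuccAbove (fun _ : Fin (k + 1) => ℂ) l
    have hvol : volume S = volume (e.symm ⁻¹' S) :=
      (he.symm e |>.measure_preimage_equiv S).symm
    -- By Fubini it is enough that each slice of the critical values at a fixed value `t` of
    -- component `l` is null. Such a slice consists of critical values of the remaining components
    -- on the hypersurface `w = t`.
    rw [hvol, Measure.volume_eq_prod, Measure.measure_prod_null (e.symm.measurable hSm)]
    refine Eventually.of_forall fun t => ?_
    let K := (fderiv ℂ w z₀).ker
    set Tt : Set K := {κ | (t, κ) ∈ T} with hTt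
    have hTto : IsOpen Tt := hT.preimage (by fun_prop)
    set R : (Fin (k + 1) → ℂ) →L[ℂ] (Fin k → ℂ) :=
      ContinuousLinearMap.pi fun i => ContinuousLinearMap.proj (l.succAbove i) with hR
    have hG : ContDiffOn ℂ ω (fun κ : K => R (g (h (t, κ)))) Tt := by
      refine R.contDiff.comp_contDiffOn
        (hg.comp (hh.comp (by fun_prop) fun κ hκ => hκ) fun κ hκ => (hhT _ hκ).1)
    have hnull := ih _ (by rw [← hE]; exact finrank_ker_lt hdw) K rfl k Tt hTto _ hG
    refine measure_mono_null ?_ hnull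
    intro y hy
    obtain ⟨z, ⟨hz, hzb⟩, hzy⟩ : e.symm (t, y) ∈ S := hy
    have hzy' : g z = l.insertNth t y := hzy
    obtain ⟨⟨hzT, hzh⟩, -⟩ := hball hzb
    have hwz : w z = t := by simp only [hw, hzy', Fin.insertNth_apply_same]
    rw [hwz] at hzT hzh
    refine ⟨q z, ⟨hzT, fun hs => hz.2 ?_⟩, ?_⟩
    · set H := fderiv ℂ h (t, q z) with hHdef
      have hHd : HasFDerivAt h H (t, q z) :=
        ((hh.contDiffAt (hT.mem_nhds hzT)).differentiableAt (by simp)).hasFDerivAt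
      have hgz : HasFDerivAt g (fderiv ℂ g z) (h (t, q z)) := by
        rw [hzh]; exact (hgd z hz.1).hasFDerivAt
      have hdG : HasFDerivAt (fun κ : K => R (g (h (t, κ))))
          (R.comp ((fderiv ℂ g z).comp (H.comp (ContinuousLinearMap.inr ℂ ℂ K)))) (q z) := by
        have h0 : HasFDerivAt (fun κ : K => (t, κ)) (ContinuousLinearMap.inr ℂ ℂ K) (q z) :=
          hasFDerivAt_prodMk_right t (q z)
        exact R.hasFDerivAt.comp (q z) (hgz.comp (q z) (hHd.comp (q z) h0))
      rw [hdG.fderiv] at hs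
      -- In the straightened coordinates component `l` of `g` is the first coordinate. Hence if the
      -- remaining components were submersive along the slice, `g` would be a submersion at `z`: the
      -- first coordinate reaches the `l`-th entry of a target vector, and `κ` corrects the others.
      have hlc : ∀ y : ℂ × K, fderiv ℂ g z (H y) l = y.1 := by
        have h1 : HasFDerivAt (fun y : ℂ × K => w (h y))
            (((ContinuousLinearMap.proj l).comp (fderiv ℂ g z)).comp H) (t, q z) := by
          have h3 : HasFDerivAt w ((ContinuousLinearMap.proj l).comp (fderiv ℂ g z))
              (h (t, q z)) := by
            rw [hzh]; exact hwd z hz.1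
          exact h3.comp (t, q z) hHd
        have h2 : HasFDerivAt (fun y : ℂ × K => w (h y)) (ContinuousLinearMap.fst ℂ ℂ K)
            (t, q z) := by
          refine (ContinuousLinearMap.fst ℂ ℂ K).hasFDerivAt.congr_of_eventuallyEq ?_
          filter_upwards [hT.mem_nhds hzT] with y hy using (hhT y hy).2
        intro y
        exact DFunLike.congr_fun (h1.unique h2) y
      intro y'
      obtain ⟨κ, hκ⟩ := hs (R (y' - fderiv ℂ g z (H (y' l, 0))))
      refine ⟨H (y' l, κ), ?_⟩
      have hsplit : H (y' l, κ) = H (y' l, 0) + H (0, κ) := by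
        rw [← map_add]; simp
      ext i
      rcases Fin.eq_self_or_eq_succAbove l i with rfl | ⟨j, rfl⟩
      · exact hlc _
      · have h3 := congrFun hκ j
        simp [hR] at h3
        rw [hsplit, map_add, Pi.add_apply, h3]
        ring
    · simp only [hzh, hzy']
      ext i
      simp [hR]
  exact measure_mono_null (image_mono hcover) (by
    rw [image_union, image_union, image_iUnion]
    exact measure_union_null hA0null (measure_union_null (measure_iUnion_null hAnull) hBnull))

/-- **Sard's theorem** for holomorphic maps: the critical values form a null set. -/
theorem sard {E F : Type*} [NormedAddCommGroup E] [NormedSpace ℂ E]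
    [FiniteDimensional ℂ E] [NormedAddCommGroup F] [NormedSpace ℂ F] [FiniteDimensional ℂ F]
    [NormedSpace ℝ F] [IsScalarTower ℝ ℂ F] [MeasurableSpace F] [BorelSpace F] (μ : Measure F)
    [μ.IsAddHaarMeasure] {U : Set E} (hU : IsOpen U) {g : E → F} (hg : ContDiffOn ℂ ω g U) :
    μ (g '' critSet g U) = 0 := by
  let A : F ≃L[ℂ] (Fin (Module.finrank ℂ F) → ℂ) := ContinuousLinearEquiv.ofFinrankEq (by simp)
  have hnull := sard_aux _ E rfl _ U hU _ (A.contDiff.comp_contDiffOn hg)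
  have hcrit : critSet (A ∘ g) U = critSet g U := by
    ext z
    simp only [critSet, mem_ofPred_eq, and_congr_right_iff, not_iff_not]
    intro hz
    have h1 : fderiv ℂ (A ∘ g) z = (A : F →L[ℂ] _).comp (fderiv ℂ g z) := by
      exact A.comp_fderiv
    rw [h1]
    constructor
    · intro h y
      obtain ⟨x, hx⟩ := h (A y)
      exact ⟨x, A.injective hx⟩
    · intro h
      exact A.surjective.comp h
  rw [hcrit, image_comp] at hnull
  have : (μ.map A).IsAddHaarMeasure := A.toContinuousAddEquiv.isAddHaarMeasure_map μ
  have h2 : (μ.map A) (A '' (g '' critSet g U)) = 0 := by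
    have := Measure.absolutelyContinuous_isAddHaarMeasure (μ.map A)
      (volume : Measure (Fin (Module.finrank ℂ F) → ℂ))
    exact this hnull
  change (μ.map A.toHomeomorph.toMeasurableEquiv) (A '' (g '' critSet g U)) = 0 at h2
  rw [A.toHomeomorph.toMeasurableEquiv.map_apply] at h2
  have h3 : A.toHomeomorph.toMeasurableEquiv ⁻¹' (A '' (g '' critSet g U)) = g '' critSet g U :=
    preimage_image_eq _ A.injective
  rwa [h3] at h2

end Sard

/-! ### Products of one-forms -/

section Forms

open Equiv

variable {m : ℕ}

/-- The summand depends only on the class of a permutation modulo the two blocks, so it may be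
evaluated at the representative `σ.out`. -/
theorem wedge_apply {p q : ℕ} (a : AltForm m p) (b : AltForm m q) (v : Fin (p + q) → Fin m → ℂ) :
    wedge a b v = ∑ σ : Perm.ModSumCongr (Fin p) (Fin q), Perm.sign σ.out •
      (a (fun i => v (finSumFinEquiv (σ.out (Sum.inl i)))) *
        b (fun i => v (finSumFinEquiv (σ.out (Sum.inr i))))) := by
  have h : wedge a b v = wedgeAlg a b v := rfl
  rw [h]
  simp only [wedgeAlg, AlternatingMap.domDomCongr_apply, LinearMap.compAlternatingMap_apply,
    AlternatingMap.domCoprod_apply, sum_apply, map_sum]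
  refine Finset.sum_congr rfl fun σ _ => ?_
  have key : ∀ τ : Perm (Fin p ⊕ Fin q), LinearMap.mul' ℝ ℂ
      (AlternatingMap.domCoprod.summand a.toAlternatingMap b.toAlternatingMap
        (Quotient.mk'' τ) fun i => v (finSumFinEquiv i)) = Perm.sign τ •
      (a (fun i => v (finSumFinEquiv (τ (Sum.inl i)))) *
        b (fun i => v (finSumFinEquiv (τ (Sum.inr i))))) := by
    intro τ
    rcases Int.units_eq_one_or (Perm.sign τ) with h | h <;>
      simp [AlternatingMap.domCoprod.summand_mk'', h]
  have := key σ.out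
  rwa [Quotient.out_eq'] at this

theorem wedge_smul_left {p q : ℕ} (c : ℂ) (a : AltForm m p) (b : AltForm m q) :
    wedge (c • a) b = c • wedge a b := by
  ext v
  simp only [wedge_apply, ContinuousAlternatingMap.smul_apply, smul_eq_mul, Finset.mul_sum]
  refine Finset.sum_congr rfl fun σ _ => ?_
  rw [mul_assoc, mul_smul_comm]

theorem wedge_smul_right {p q : ℕ} (c : ℂ) (a : AltForm m p) (b : AltForm m q) :
    wedge a (c • b) = c • wedge a b := by
  ext v
  simp only [wedge_apply, ContinuousAlternatingMap.smul_apply, smul_eq_mul, Finset.mul_sum]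
  refine Finset.sum_congr rfl fun σ _ => ?_
  rw [mul_left_comm, mul_smul_comm]

theorem wedge_sum_left {ι : Type*} {p q : ℕ} (s : Finset ι) (a : ι → AltForm m p)
    (b : AltForm m q) : wedge (∑ i ∈ s, a i) b = ∑ i ∈ s, wedge (a i) b := by
  ext v
  simp only [wedge_apply, ContinuousAlternatingMap.sum_apply, Finset.sum_mul, Finset.smul_sum]
  exact Finset.sum_comm

theorem wedge_sum_right {ι : Type*} {p q : ℕ} (s : Finset ι) (a : AltForm m p)
    (b : ι → AltForm m q) : wedge a (∑ i ∈ s, b i) = ∑ i ∈ s, wedge a (b i) := by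
  ext v
  simp only [wedge_apply, ContinuousAlternatingMap.sum_apply, Finset.mul_sum, Finset.smul_sum]
  exact Finset.sum_comm

/-- The product of one-forms as a multilinear map. -/
def prodMultilinear {ι : Type*} [Fintype ι] (ξ : ι → (Fin m → ℂ) →L[ℝ] ℂ) :
    MultilinearMap ℝ (fun _ : ι => Fin m → ℂ) ℂ :=
  (MultilinearMap.mkPiAlgebra ℝ ι ℂ).compLinearMap fun i => (ξ i : (Fin m → ℂ) →ₗ[ℝ] ℂ)

theorem alternatization_prodMultilinear {ι : Type*} [Fintype ι] [DecidableEq ι]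
    (ξ : ι → (Fin m → ℂ) →L[ℝ] ℂ) (v : ι → Fin m → ℂ) :
    MultilinearMap.alternatization (prodMultilinear ξ) v =
      Matrix.det (Matrix.of fun i j => ξ j (v i)) := by
  rw [MultilinearMap.alternatization_apply, Matrix.det_apply]
  refine Finset.sum_congr rfl fun σ _ => ?_
  simp [prodMultilinear]

/-- The wedge product `ξ_1 ∧ … ∧ ξ_r` of one-forms. -/
def prodForm {r : ℕ} (ξ : Fin r → (Fin m → ℂ) →L[ℝ] ℂ) : AltForm m r :=
  { MultilinearMap.alternatization (prodMultilinear ξ) with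
    cont := by
      have : (fun v => MultilinearMap.alternatization (prodMultilinear ξ) v) = fun v =>
          Matrix.det (Matrix.of fun i j => ξ j (v i)) := by
        ext v; rw [alternatization_prodMultilinear]
      change Continuous (fun v => MultilinearMap.alternatization (prodMultilinear ξ) v)
      rw [this]
      exact Continuous.matrix_det (by
        refine continuous_matrix fun i j => ?_
        exact (ξ j).continuous.comp (continuous_apply i)) }

theorem prodForm_apply {r : ℕ} (ξ : Fin r → (Fin m → ℂ) →L[ℝ] ℂ) (v : Fin r → Fin m → ℂ) :
    prodForm ξ v = Matrix.det (Matrix.of fun i j => ξ j (v i)) :=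
  alternatization_prodMultilinear ξ v

/-- Summing over shuffles after alternating within each block is the same as alternating over all
permutations at once. This is what reduces wedge products of one-forms to determinants. -/
theorem wedge_prodForm {p q : ℕ} (ξ : Fin p → (Fin m → ℂ) →L[ℝ] ℂ)
    (η : Fin q → (Fin m → ℂ) →L[ℝ] ℂ) :
    wedge (prodForm ξ) (prodForm η) = prodForm (Fin.append ξ η) := by
  ext v
  have h1 : wedge (prodForm ξ) (prodForm η) v = LinearMap.mul' ℝ ℂ
      (((MultilinearMap.alternatization (prodMultilinear ξ)).domCoprod
        (MultilinearMap.alternatization (prodMultilinear η))) fun i => v (finSumFinEquiv i)) := rfl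
  have h3 : (LinearMap.mul' ℝ ℂ).compMultilinearMap
      (MultilinearMap.domCoprod (prodMultilinear ξ) (prodMultilinear η)) =
      prodMultilinear (Sum.elim ξ η) := by
    ext v
    simp [prodMultilinear]
  have h2 := congrArg (fun f => LinearMap.mul' ℝ ℂ (f fun i => v (finSumFinEquiv i)))
    (MultilinearMap.domCoprod_alternization (prodMultilinear ξ) (prodMultilinear η))
  have h4 := DFunLike.congr_fun (LinearMap.compMultilinearMap_alternatization (LinearMap.mul' ℝ ℂ)
    (MultilinearMap.domCoprod (prodMultilinear ξ) (prodMultilinear η)))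
    (fun i => v (finSumFinEquiv i))
  rw [h1, ← h2]
  rw [h3, alternatization_prodMultilinear] at h4
  refine h4.symm.trans ?_
  rw [prodForm_apply, ← Matrix.det_submatrix_equiv_self finSumFinEquiv]
  congr 1
  ext i j
  simp only [Matrix.submatrix_apply, Matrix.of_apply]
  congr 1
  rcases j with j | j <;> simp

/-- Complex conjugate of a complex linear form. -/
def conjForm (α : (Fin m → ℂ) →L[ℂ] ℂ) : (Fin m → ℂ) →L[ℝ] ℂ :=
  (Complex.conjCLE : ℂ →L[ℝ] ℂ).comp (α.restrictScalars ℝ)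

@[simp]
theorem conjForm_apply (α : (Fin m → ℂ) →L[ℂ] ℂ) (v : Fin m → ℂ) :
    conjForm α v = starRingEnd ℂ (α v) := rfl

/-- The sequence `α_1, β̄_1, α_2, β̄_2, …`. -/
def pairSeq {p : ℕ} (α β : Fin p → (Fin m → ℂ) →L[ℂ] ℂ) (j : Fin (2 * p)) :
    (Fin m → ℂ) →L[ℝ] ℂ :=
  if (j : ℕ) % 2 = 0 then (α ⟨(j : ℕ) / 2, by omega⟩).restrictScalars ℝ
  else conjForm (β ⟨(j : ℕ) / 2, by omega⟩)

/-- The pull-back `(i/2)^p α_1 ∧ ᾱ_1 ∧ … ∧ α_p ∧ ᾱ_p` of the volume form of `ℂ^p`. -/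
def volForm {p : ℕ} (α : Fin p → (Fin m → ℂ) →L[ℂ] ℂ) : AltForm m (2 * p) :=
  (Complex.I / 2) ^ p • prodForm (pairSeq α α)

/-- Splitting an index in `Fin (2 * p)` into quotient and remainder. -/
def pairIndex (p : ℕ) : Fin p × Fin 2 ≃ Fin (2 * p) :=
  finProdFinEquiv.trans (finCongr (Nat.mul_comm p 2))

theorem pairIndex_div {p : ℕ} (l : Fin p) (a : Fin 2) : (pairIndex p (l, a) : ℕ) / 2 = l := by
  simp [pairIndex, finProdFinEquiv]; omega

theorem pairIndex_mod {p : ℕ} (l : Fin p) (a : Fin 2) : (pairIndex p (l, a) : ℕ) % 2 = a := by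
  simp [pairIndex, finProdFinEquiv]; omega

/-- The matrix of `ℂ`-linear forms in the standard basis. -/
def formMatrix {p : ℕ} (γ : Fin p → (Fin p → ℂ) →L[ℂ] ℂ) : Matrix (Fin p) (Fin p) ℂ :=
  Matrix.of fun l j => γ j (Pi.single l 1)

-- Pairing each `γ_j` with its conjugate and each `e_l` with `i e_l`, the evaluation matrix factors
-- as `(1 ⊗ c)` times the block diagonal matrix of `G` and its conjugate. Here `c` has rows `(1, 1)`
-- and `(i, -i)` and determinant `-2i`.
open scoped Kronecker in
theorem prodForm_pairSeq_stdFrame {p : ℕ} (γ : Fin p → (Fin p → ℂ) →L[ℂ] ℂ) :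
    prodForm (pairSeq γ γ) (stdFrame p) =
      (-2 * Complex.I) ^ p * ((‖(formMatrix γ).det‖ ^ 2 : ℝ) : ℂ) := by
  rw [prodForm_apply, ← Matrix.det_submatrix_equiv_self (pairIndex p)]
  set c : Matrix (Fin 2) (Fin 2) ℂ := !![1, 1; Complex.I, -Complex.I] with hc
  set G := formMatrix γ with hG
  have hM : (Matrix.of fun i j => pairSeq γ γ j (stdFrame p i)).submatrix
      (pairIndex p) (pairIndex p) = ((1 : Matrix (Fin p) (Fin p) ℂ) ⊗ₖ c) *
        Matrix.blockDiagonal fun b : Fin 2 => if b = 0 then G else G.map (starRingEnd ℂ) := by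
    ext ⟨l, a⟩ ⟨j, b⟩
    simp only [Matrix.mul_apply, Fintype.sum_prod_type, Matrix.kroneckerMap_apply,
      Matrix.blockDiagonal_apply, Matrix.one_apply, ite_mul, one_mul, zero_mul, mul_ite, mul_zero]
    simp only [Finset.sum_ite_eq, Finset.mem_univ, if_true, Finset.sum_ite_eq', Finset.sum_ite,
      Finset.sum_const_zero, add_zero, Finset.filter_eq, Finset.sum_singleton]
    have hs : stdFrame p (pairIndex p (l, a)) =
        (if a = 0 then (1 : ℂ) else Complex.I) • Pi.single l (1 : ℂ) := by
      have h1 := pairIndex_div l a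
      have h2 := pairIndex_mod l a
      unfold stdFrame
      have h3 : (⟨(pairIndex p (l, a) : ℕ) / 2, by omega⟩ : Fin p) = l := Fin.ext h1
      rw [h3, h2]
      fin_cases a <;> simp [← Pi.single_smul]
    have hξ : pairSeq γ γ (pairIndex p (j, b)) =
        if b = 0 then (γ j).restrictScalars ℝ else conjForm (γ j) := by
      have h1 := pairIndex_div j b
      have h2 := pairIndex_mod j b
      unfold pairSeq
      have h3 : (⟨(pairIndex p (j, b) : ℕ) / 2, by omega⟩ : Fin p) = j := Fin.ext h1
      rw [h3, h2]
      fin_cases b <;> simp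
    simp only [Matrix.submatrix_apply, Matrix.of_apply, hs, hξ]
    fin_cases a <;> fin_cases b <;>
      simp [hc, hG, formMatrix, map_smul]
  rw [hM, Matrix.det_mul, Matrix.det_kronecker, Matrix.det_blockDiagonal]
  have h1 : (G.map (starRingEnd ℂ)).det = starRingEnd ℂ G.det := by
    rw [RingHom.map_det]; rfl
  simp only [Matrix.det_one, one_pow, one_mul, Fintype.card_fin, Fin.prod_univ_two, if_true]
  have hdc : c.det = -2 * Complex.I := by rw [hc, Matrix.det_fin_two_of]; ring
  rw [hdc, if_neg (by decide : ¬ (1 : Fin 2) = 0), h1, Complex.mul_conj, Complex.normSq_eq_norm_sq]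

/-- The factor `(i/2)^p` in `volForm` cancels `(-2i)^p`, so what remains is the real Jacobian of a
complex linear map: positive and with constant `1`. -/
theorem volForm_stdFrame {p : ℕ} (α : Fin p → (Fin m → ℂ) →L[ℂ] ℂ) (A : (Fin p → ℂ) →L[ℂ] Fin m → ℂ) :
    volForm α (fun i => A (stdFrame p i)) =
      ((‖(formMatrix fun j => (α j).comp A).det‖ ^ 2 : ℝ) : ℂ) := by
  have h1 : prodForm (pairSeq α α) (fun i => A (stdFrame p i)) =
      prodForm (pairSeq (fun j => (α j).comp A) (fun j => (α j).comp A)) (stdFrame p) := by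
    rw [prodForm_apply, prodForm_apply]
    congr 1
    ext i j
    simp only [Matrix.of_apply, pairSeq]
    split_ifs <;> rfl
  rw [volForm, ContinuousAlternatingMap.smul_apply, h1, prodForm_pairSeq_stdFrame, smul_eq_mul,
    ← mul_assoc, ← mul_pow]
  have : Complex.I / 2 * (-2 * Complex.I) = 1 := by
    have := Complex.I_mul_I
    linear_combination (-1 : ℂ) * this
  rw [this, one_pow, one_mul]

/-- Concatenation of a family of length `k` and one of length `m - k`. -/
def joinFam {X : Type*} {m k : ℕ} (β : Fin k → X) (α : Fin (m - k) → X) (i : Fin m) : X :=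
  if h : (i : ℕ) < k then β ⟨i, h⟩ else α ⟨(i : ℕ) - k, by omega⟩

/-- The form `∑_j B_j ∧ B̄_j`. -/
def sumPair {n : ℕ} (B : Fin n → (Fin m → ℂ) →L[ℂ] ℂ) : AltForm m 2 :=
  ∑ j, prodForm (pairSeq (p := 1) (fun _ => B j) (fun _ => B j))

theorem wedgePow_smul (c : ℂ) (a : AltForm m 2) (k : ℕ) :
    wedgePow (c • a) k = c ^ k • wedgePow a k := by
  induction k with
  | zero => simp [wedgePow]
  | succ k ih =>
    rw [wedgePow, ih, wedge_smul_left, wedge_smul_right, smul_smul, ← pow_succ]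
    rfl

/-- Two-forms have even degree, so expanding the power produces no signs. Tuples `J` with
repetitions are kept; their determinants vanish by themselves. -/
theorem wedgePow_sumPair {n : ℕ} (B : Fin n → (Fin m → ℂ) →L[ℂ] ℂ) (k : ℕ) :
    wedgePow (sumPair B) k =
      ∑ J : Fin k → Fin n, prodForm (pairSeq (fun i => B (J i)) (fun i => B (J i))) := by
  induction k with
  | zero =>
    ext v
    simp [wedgePow, prodForm_apply]
  | succ k ih =>
    rw [wedgePow, ih, wedge_sum_left]
    rw [← (Fin.snocEquiv (fun _ : Fin (k + 1) => Fin n)).sum_comp, Fintype.sum_prod_type_right]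
    refine Finset.sum_congr rfl fun J _ => ?_
    rw [sumPair, wedge_sum_right]
    refine Finset.sum_congr rfl fun j _ => ?_
    rw [wedge_prodForm]
    congr 1
    ext1 i
    refine Fin.addCases (m := 2 * k) (n := 2) (fun i => ?_) (fun i => ?_) i
    · rw [Fin.append_left]
      simp only [pairSeq, Fin.snocEquiv, Equiv.coe_fn_mk, Fin.val_castAdd]
      have h : ∀ h', (⟨(i : ℕ) / 2, h'⟩ : Fin (k + 1)) = Fin.castSucc ⟨(i : ℕ) / 2, by omega⟩ :=
        fun _ => rfl
      simp only [h, Fin.snoc_castSucc]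
    · refine (Fin.append_right (m := 2 * k) (n := 2) _ _ i).trans ?_
      simp only [pairSeq, Fin.snocEquiv, Equiv.coe_fn_mk, Fin.val_natAdd]
      have h : ∀ h', (⟨(2 * k + (i : ℕ)) / 2, h'⟩ : Fin (k + 1)) = Fin.last k :=
        fun _ => Fin.ext (by simp; omega)
      have h2 : (2 * k + (i : ℕ)) % 2 = i % 2 := by omega
      simp only [h, h2, Fin.snoc_last]

theorem powWedge_apply {k : ℕ} (hk : k ≤ m) (a : AltForm m 2) (b : AltForm m (2 * (m - k)))
    (v : Fin (2 * m) → Fin m → ℂ) : powWedge hk a b v = wedge (wedgePow a k) b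
      (fun i => v (finCongr (by omega : 2 * k + 2 * (m - k) = 2 * m) i)) := rfl

theorem powWedge_smul_right {k : ℕ} (hk : k ≤ m) (a : AltForm m 2) (c : ℂ)
    (b : AltForm m (2 * (m - k))) : powWedge hk a (c • b) = c • powWedge hk a b := by
  ext v
  rw [powWedge_apply, wedge_smul_right]; rfl

theorem powWedge_sum_right {ι : Type*} {k : ℕ} (hk : k ≤ m) (a : AltForm m 2) (s : Finset ι)
    (b : ι → AltForm m (2 * (m - k))) :
    powWedge hk a (∑ i ∈ s, b i) = ∑ i ∈ s, powWedge hk a (b i) := by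
  ext v
  rw [powWedge_apply, wedge_sum_right]
  simp only [ContinuousAlternatingMap.sum_apply, powWedge_apply]

/-- This computes the right-hand side of the formula pointwise. Each `J` contributes a squared
determinant, and the constants combine to `(i/2π)^k (i/2)^(m-k) (-2i)^m = π^{-k}`. -/
theorem powWedge_sumPair_volForm {n k : ℕ} (hk : k ≤ m) (B : Fin n → (Fin m → ℂ) →L[ℂ] ℂ)
    (α : Fin (m - k) → (Fin m → ℂ) →L[ℂ] ℂ) :
    powWedge hk ((Complex.I / (2 * Real.pi)) • sumPair B) (volForm α) (stdFrame m) =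
      (((Real.pi ^ k)⁻¹ * ∑ J : Fin k → Fin n,
        ‖(formMatrix (joinFam (fun i => B (J i)) α)).det‖ ^ 2 : ℝ) : ℂ) := by
  rw [powWedge_apply, wedgePow_smul, wedge_smul_left, wedgePow_sumPair, wedge_sum_left, volForm]
  simp only [wedge_smul_right, wedge_prodForm, ContinuousAlternatingMap.smul_apply,
    ContinuousAlternatingMap.sum_apply]
  have h1 : ∀ J : Fin k → Fin n,
      prodForm (Fin.append (pairSeq (fun i => B (J i)) fun i => B (J i)) (pairSeq α α))
        (fun i => stdFrame m (finCongr (by omega : 2 * k + 2 * (m - k) = 2 * m) i)) =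
      prodForm (pairSeq (joinFam (fun i => B (J i)) α) (joinFam (fun i => B (J i)) α))
        (stdFrame m) := by
    intro J
    rw [prodForm_apply, prodForm_apply, ← Matrix.det_submatrix_equiv_self
      (finCongr (by omega : 2 * k + 2 * (m - k) = 2 * m))]
    congr 1
    ext i j
    simp only [Matrix.of_apply, Matrix.submatrix_apply]
    congr 1
    refine Fin.addCases (fun j => ?_) (fun j => ?_) j
    · rw [Fin.append_left]
      simp only [pairSeq, joinFam, finCongr_apply, Fin.val_cast, Fin.val_castAdd]
      have h : (j : ℕ) / 2 < k := by omega
      simp only [h, dif_pos]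
    · rw [Fin.append_right]
      simp only [pairSeq, joinFam, finCongr_apply, Fin.val_cast, Fin.val_natAdd]
      have h : ¬ (2 * k + (j : ℕ)) / 2 < k := by omega
      have h2 : (2 * k + (j : ℕ)) % 2 = j % 2 := by omega
      have h3 : (2 * k + (j : ℕ)) / 2 - k = j / 2 := by omega
      simp only [h, dif_neg, h2, h3, not_false_eq_true]
  have hc : (Complex.I / (2 * Real.pi)) ^ k * (Complex.I / 2) ^ (m - k) *
      (-2 * Complex.I) ^ m = ((Real.pi ^ k)⁻¹ : ℝ) := by
    obtain ⟨d, rfl⟩ := Nat.exists_eq_add_of_le hk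
    have hpi : (Real.pi : ℂ) ≠ 0 := by exact_mod_cast Real.pi_ne_zero
    have e1 : Complex.I / (2 * Real.pi) * (-2 * Complex.I) = (Real.pi : ℂ)⁻¹ := by
      have := Complex.I_mul_I
      field_simp
      linear_combination (-1 : ℂ) * this
    have e2 : Complex.I / 2 * (-2 * Complex.I) = 1 := by
      have := Complex.I_mul_I
      linear_combination (-1 : ℂ) * this
    rw [show k + d - k = d by omega, pow_add (-2 * Complex.I), mul_mul_mul_comm, ← mul_pow,
      ← mul_pow, e1, e2]
    simp
  simp only [h1, prodForm_pairSeq_stdFrame, smul_eq_mul]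
  rw [Finset.mul_sum]
  push_cast at hc ⊢
  rw [Finset.mul_sum]
  refine Finset.sum_congr rfl fun J _ => ?_
  rw [← hc]
  ring

end Forms

/-! ### Forms of bidegree `(p, p)` are combinations of pulled back volume forms -/

section Polarization

open Equiv Function

variable {m : ℕ}

theorem prodForm_apply_eq_detRow {r : ℕ} (ξ : Fin r → (Fin m → ℂ) →L[ℝ] ℂ)
    (v : Fin r → Fin m → ℂ) :
    prodForm ξ v = Matrix.detRowAlternating (R := ℂ) (fun j i => ξ j (v i)) := by
  rw [prodForm_apply, ← Matrix.det_transpose]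
  rfl

theorem prodForm_comp_perm {r : ℕ} (ξ : Fin r → (Fin m → ℂ) →L[ℝ] ℂ) (σ : Perm (Fin r)) :
    prodForm (ξ ∘ σ) = ((Perm.sign σ : ℤ) : ℂ) • prodForm ξ := by
  ext v
  rw [ContinuousAlternatingMap.smul_apply, prodForm_apply_eq_detRow, prodForm_apply_eq_detRow]
  have := (Matrix.detRowAlternating (R := ℂ)).map_perm (fun j i => ξ j (v i)) σ
  refine Eq.trans this ?_
  rcases Int.units_eq_one_or (Perm.sign σ) with h | h <;> simp [h]

theorem prodForm_update_add {r : ℕ} (ξ : Fin r → (Fin m → ℂ) →L[ℝ] ℂ) (j : Fin r)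
    (a b : (Fin m → ℂ) →L[ℝ] ℂ) :
    prodForm (update ξ j (a + b)) = prodForm (update ξ j a) + prodForm (update ξ j b) := by
  ext v
  have h : ∀ x, (fun l i => update ξ j x l (v i)) =
      update (fun l i => ξ l (v i)) j (fun i => x (v i)) := by
    intro x; ext l i; by_cases hl : l = j
    · subst hl; simp
    · simp [hl]
  rw [ContinuousAlternatingMap.add_apply]
  simp only [prodForm_apply_eq_detRow, h]
  exact (Matrix.detRowAlternating (R := ℂ)).map_update_add (fun l i => ξ l (v i)) j
    (fun i => a (v i)) (fun i => b (v i))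

theorem prodForm_update_smul {r : ℕ} (ξ : Fin r → (Fin m → ℂ) →L[ℝ] ℂ) (j : Fin r)
    (c : ℂ) (a : (Fin m → ℂ) →L[ℝ] ℂ) :
    prodForm (update ξ j (c • a)) = c • prodForm (update ξ j a) := by
  ext v
  have h : ∀ x, (fun l i => update ξ j x l (v i)) =
      update (fun l i => ξ l (v i)) j (fun i => x (v i)) := by
    intro x; ext l i; by_cases hl : l = j
    · subst hl; simp
    · simp [hl]
  rw [ContinuousAlternatingMap.smul_apply]
  simp only [prodForm_apply_eq_detRow, h]
  exact (Matrix.detRowAlternating (R := ℂ)).map_update_smul (fun l i => ξ l (v i)) j c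
    (fun i => a (v i))

theorem pairSeq_update_left {p : ℕ} (α β : Fin p → (Fin m → ℂ) →L[ℂ] ℂ) (l : Fin p)
    (x : (Fin m → ℂ) →L[ℂ] ℂ) : pairSeq (update α l x) β =
      update (pairSeq α β) ⟨2 * l, by omega⟩ (x.restrictScalars ℝ) := by
  ext1 j
  by_cases hj : j = ⟨2 * l, by omega⟩
  · subst hj
    simp [pairSeq]
  · rw [update_of_ne hj]
    unfold pairSeq
    split_ifs with h
    · rw [update_of_ne]
      intro h2
      apply hj
      have := congrArg Fin.val h2
      simp only at this
      ext; simp only; omega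
    · rfl

theorem pairSeq_update_right {p : ℕ} (α β : Fin p → (Fin m → ℂ) →L[ℂ] ℂ) (l : Fin p)
    (x : (Fin m → ℂ) →L[ℂ] ℂ) : pairSeq α (update β l x) =
      update (pairSeq α β) ⟨2 * l + 1, by omega⟩ (conjForm x) := by
  ext1 j
  by_cases hj : j = ⟨2 * l + 1, by omega⟩
  · subst hj
    have h1 : (2 * (l : ℕ) + 1) % 2 = 1 := by omega
    have h2 : (2 * (l : ℕ) + 1) / 2 = l := by omega
    simp [pairSeq, h1, h2]
  · rw [update_of_ne hj]
    unfold pairSeq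
    split_ifs with h
    · rfl
    · rw [update_of_ne]
      intro h2
      apply hj
      have := congrArg Fin.val h2
      simp only at this
      ext; simp only; omega

/-- Linear in the slot `α l`, antilinear in the slot `β l`: a sesquilinear expansion, to be inverted
by polarization. -/
theorem prodForm_pairSeq_update {p : ℕ} (α β : Fin p → (Fin m → ℂ) →L[ℂ] ℂ) (l : Fin p)
    (x y : (Fin m → ℂ) →L[ℂ] ℂ) (c : ℂ) :
    prodForm (pairSeq (update α l (x + c • y)) (update β l (x + c • y))) =
      prodForm (pairSeq (update α l x) (update β l x)) +
      (starRingEnd ℂ c) • prodForm (pairSeq (update α l x) (update β l y)) +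
      c • prodForm (pairSeq (update α l y) (update β l x)) +
      (c * starRingEnd ℂ c) • prodForm (pairSeq (update α l y) (update β l y)) := by
  have hR : ∀ α : Fin p → (Fin m → ℂ) →L[ℂ] ℂ, prodForm (pairSeq α (update β l (x + c • y))) =
      prodForm (pairSeq α (update β l x)) +
        (starRingEnd ℂ c) • prodForm (pairSeq α (update β l y)) := by
    intro α
    simp only [pairSeq_update_right]
    rw [← prodForm_update_smul, ← prodForm_update_add]
    congr 2
    ext v; simp
  have hL : ∀ β : Fin p → (Fin m → ℂ) →L[ℂ] ℂ, prodForm (pairSeq (update α l (x + c • y)) β) =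
      prodForm (pairSeq (update α l x) β) + c • prodForm (pairSeq (update α l y) β) := by
    intro β
    simp only [pairSeq_update_left]
    rw [← prodForm_update_smul, ← prodForm_update_add]
    rfl
  rw [hR, hL, hL, smul_add, smul_smul, mul_comm c]
  abel

/-- Polarization. -/
theorem prodForm_pairSeq_mem_span {p : ℕ} (s : Finset (Fin p)) :
    ∀ α β : Fin p → (Fin m → ℂ) →L[ℂ] ℂ, (∀ l ∉ s, α l = β l) →
      prodForm (pairSeq α β) ∈ Submodule.span ℂ (Set.range
        fun γ : Fin p → (Fin m → ℂ) →L[ℂ] ℂ => prodForm (pairSeq γ γ)) := by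
  induction s using Finset.induction with
  | empty =>
    intro α β h
    have : α = β := funext fun l => h l (by simp)
    subst this
    exact Submodule.subset_span ⟨α, rfl⟩
  | insert l s hl ih =>
    intro α β h
    have hmem : ∀ γ, prodForm (pairSeq (update α l γ) (update β l γ)) ∈ Submodule.span ℂ (Set.range
        fun γ : Fin p → (Fin m → ℂ) →L[ℂ] ℂ => prodForm (pairSeq γ γ)) := by
      intro γ
      refine ih _ _ fun j hj => ?_
      by_cases hjl : j = l
      · subst hjl; simp
      · rw [update_of_ne hjl, update_of_ne hjl]
        exact h j (by simp [hjl, hj])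
    have e : ∀ c, _ := prodForm_pairSeq_update α β l (α l) (β l)
    -- Summing `c · Q(x + c y)` over the fourth roots of unity `c` kills the terms with factors `c`,
    -- `c²` and `c |c|²`, and leaves four times the mixed term with factor `c c̄`.
    have key : prodForm (pairSeq α β) = (1 / 4 : ℂ) •
        (prodForm (pairSeq (update α l (α l + (1 : ℂ) • β l)) (update β l (α l + (1 : ℂ) • β l))) +
        Complex.I • prodForm (pairSeq (update α l (α l + Complex.I • β l))
          (update β l (α l + Complex.I • β l))) +
        (-1 : ℂ) • prodForm (pairSeq (update α l (α l + (-1 : ℂ) • β l))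
          (update β l (α l + (-1 : ℂ) • β l))) +
        (-Complex.I) • prodForm (pairSeq (update α l (α l + (-Complex.I) • β l))
          (update β l (α l + (-Complex.I) • β l)))) := by
      rw [e, e, e, e]
      simp only [update_eq_self]
      ext v
      simp only [ContinuousAlternatingMap.smul_apply, ContinuousAlternatingMap.add_apply,
        smul_eq_mul, map_one, map_neg, Complex.conj_I]
      linear_combination (-(1 / 2) * prodForm (pairSeq α β) v +
        (1 / 2) * prodForm (pairSeq (update α l (β l)) (update β l (α l))) v) * (-Complex.I_sq)
    rw [key]
    refine Submodule.smul_mem _ _ (Submodule.add_mem _ (Submodule.add_mem _ (Submodule.add_mem _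
      (hmem _) (Submodule.smul_mem _ _ (hmem _))) (Submodule.smul_mem _ _ (hmem _)))
      (Submodule.smul_mem _ _ (hmem _)))

/-- The real coordinates on `ℂ^m` are `a + ā` for the following `ℂ`-linear forms `a`. -/
def halfCoord (t : Fin m × Fin 2) : (Fin m → ℂ) →L[ℂ] ℂ :=
  (if t.2 = 0 then (1 / 2 : ℂ) else -Complex.I / 2) • ContinuousLinearMap.proj t.1

/-- The real basis `e_l`, `i e_l` of `ℂ^m`. -/
def realFrame (t : Fin m × Fin 2) : Fin m → ℂ :=
  Pi.single t.1 (if t.2 = 0 then 1 else Complex.I)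

theorem sum_realFrame (v : Fin m → ℂ) :
    v = ∑ t : Fin m × Fin 2, (2 * (halfCoord t v).re) • realFrame t := by
  ext l
  rw [Fintype.sum_prod_type]
  simp only [Fin.sum_univ_two, halfCoord, realFrame, Finset.sum_apply, Pi.add_apply,
    Pi.smul_apply]
  rw [Finset.sum_eq_single l]
  · apply Complex.ext
    · simp
    · simp; ring
  · intro b _ hb
    simp [Pi.single_apply, hb.symm]
  · simp

theorem map_eq_sum_realFrame {r : ℕ} (φ : AltForm m r) (v : Fin r → Fin m → ℂ) :
    φ v = ∑ s : Fin r → Fin m × Fin 2, φ (fun j => realFrame (s j)) *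
      ∏ j, (halfCoord (s j) (v j) + starRingEnd ℂ (halfCoord (s j) (v j))) := by
  have h1 : φ v = φ fun j => ∑ t : Fin m × Fin 2, (2 * (halfCoord t (v j)).re) • realFrame t := by
    congr 1; ext1 j; exact sum_realFrame (v j)
  have h2 := φ.toMultilinearMap.map_sum
    (fun (j : Fin r) (t : Fin m × Fin 2) => (2 * (halfCoord t (v j)).re) • realFrame t)
  rw [h1]
  refine h2.trans (Finset.sum_congr rfl fun s _ => ?_)
  rw [MultilinearMap.map_smul_univ]
  simp only [Complex.add_conj]
  rw [mul_comm, Complex.real_smul]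
  push_cast
  rfl

/-- Expanding `φ` in real coordinates gives products of one-forms. Antisymmetrizing both sides over
all permutations turns the products into wedge products and multiplies `φ` by `r!`. -/
theorem factorial_smul_eq_sum {r : ℕ} (φ : AltForm m r) :
    (r.factorial : ℂ) • φ = ∑ s : Fin r → Fin m × Fin 2, φ (fun j => realFrame (s j)) •
      prodForm (fun j => (halfCoord (s j)).restrictScalars ℝ + conjForm (halfCoord (s j))) := by
  ext v
  have h1 : ∀ σ : Perm (Fin r), φ v = (Perm.sign σ : ℤ) * φ (v ∘ σ) := by
    intro σ
    have := φ.toAlternatingMap.map_perm v σ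
    have h2 : φ (v ∘ σ) = Perm.sign σ • φ v := this
    rw [h2]
    rcases Int.units_eq_one_or (Perm.sign σ) with h | h <;> simp [h]
  have h3 : (r.factorial : ℂ) * φ v = ∑ σ : Perm (Fin r), (Perm.sign σ : ℤ) * φ (v ∘ σ) := by
    rw [← Finset.sum_congr rfl fun σ _ => h1 σ]
    simp [Fintype.card_perm]
  simp only [ContinuousAlternatingMap.smul_apply, ContinuousAlternatingMap.sum_apply, smul_eq_mul]
  rw [h3]
  simp_rw [map_eq_sum_realFrame φ (v ∘ _), Finset.mul_sum]
  rw [Finset.sum_comm]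
  refine Finset.sum_congr rfl fun s _ => ?_
  rw [prodForm_apply, Matrix.det_apply, Finset.mul_sum]
  refine Finset.sum_congr rfl fun σ _ => ?_
  simp only [Function.comp_apply, Matrix.of_apply]
  rcases Int.units_eq_one_or (Perm.sign σ) with h | h <;> simp [h]

/-- The sequence of one-forms with entries `a_j` for `j ∈ T` and `ā_j` for `j ∉ T`. -/
def mixSeq {r : ℕ} (T : Finset (Fin r)) (a : Fin r → (Fin m → ℂ) →L[ℂ] ℂ) (j : Fin r) :
    (Fin m → ℂ) →L[ℝ] ℂ :=
  if j ∈ T then (a j).restrictScalars ℝ else conjForm (a j)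

theorem prodForm_add_conj {r : ℕ} (a : Fin r → (Fin m → ℂ) →L[ℂ] ℂ) :
    prodForm (fun j => (a j).restrictScalars ℝ + conjForm (a j)) =
      ∑ T : Finset (Fin r), prodForm (mixSeq T a) := by
  ext v
  rw [ContinuousAlternatingMap.sum_apply]
  simp only [prodForm_apply_eq_detRow]
  have := (Matrix.detRowAlternating (R := ℂ) (n := Fin r)).toMultilinearMap.map_add_univ
    (fun j i => a j (v i)) (fun j i => starRingEnd ℂ (a j (v i)))
  refine Eq.trans this (Finset.sum_congr rfl fun T _ => ?_)
  change Matrix.detRowAlternating _ = _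
  congr 1
  ext j i
  by_cases h : j ∈ T <;> simp [mixSeq, h]

/-- The bidegree of a product is read off from how it scales; this separates the types in
`mem_span_volForm`. -/
theorem prodForm_mixSeq_smul {r : ℕ} (T : Finset (Fin r)) (a : Fin r → (Fin m → ℂ) →L[ℂ] ℂ)
    (c : ℂ) (v : Fin r → Fin m → ℂ) : prodForm (mixSeq T a) (fun j => c • v j) =
      c ^ T.card * (starRingEnd ℂ c) ^ (r - T.card) * prodForm (mixSeq T a) v := by
  simp only [prodForm_apply_eq_detRow]
  have h := (Matrix.detRowAlternating (R := ℂ) (n := Fin r)).toMultilinearMap.map_smul_univ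
    (fun j => if j ∈ T then c else starRingEnd ℂ c) (fun j i => mixSeq T a j (v i))
  have h2 : (∏ j, if j ∈ T then c else starRingEnd ℂ c) =
      c ^ T.card * (starRingEnd ℂ c) ^ (r - T.card) := by
    rw [Finset.prod_ite]
    simp [Finset.filter_notMem_eq_sdiff, Finset.card_sdiff]
  rw [h2] at h
  refine Eq.trans ?_ h
  change _ = Matrix.detRowAlternating _
  congr 1
  ext j i
  by_cases hj : j ∈ T <;> simp [mixSeq, hj]

/-- When `T` has half of the indices, a permutation moves `T` to the even positions, which costs
only a sign and produces an alternating sequence to which polarization applies. -/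
theorem prodForm_mixSeq_mem_span {p : ℕ} (T : Finset (Fin (2 * p))) (hT : T.card = p)
    (a : Fin (2 * p) → (Fin m → ℂ) →L[ℂ] ℂ) :
    prodForm (mixSeq T a) ∈ Submodule.span ℂ (Set.range
        fun γ : Fin p → (Fin m → ℂ) →L[ℂ] ℂ => prodForm (pairSeq γ γ)) := by
  classical
  have hcard : Fintype.card {j : Fin (2 * p) // (j : ℕ) % 2 = 0} =
      Fintype.card {j : Fin (2 * p) // j ∈ T} := by
    rw [Fintype.card_coe, hT]
    have e : {j : Fin (2 * p) // (j : ℕ) % 2 = 0} ≃ Fin p :=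
      { toFun := fun j => ⟨(j : ℕ) / 2, by have := j.1.2; omega⟩
        invFun := fun l => ⟨⟨2 * l, by omega⟩, by simp⟩
        left_inv := fun j => by
          have := j.2
          ext; simp only; omega
        right_inv := fun l => by ext; simp }
    rw [Fintype.card_congr e, Fintype.card_fin]
  let σ : Perm (Fin (2 * p)) := (Fintype.equivOfCardEq hcard).extendSubtype
  have hσ1 : ∀ j : Fin (2 * p), (j : ℕ) % 2 = 0 → σ j ∈ T :=
    fun j hj => Equiv.extendSubtype_mem _ j hj
  have hσ2 : ∀ j : Fin (2 * p), ¬ (j : ℕ) % 2 = 0 → σ j ∉ T :=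
    fun j hj => Equiv.extendSubtype_not_mem _ j hj
  have hmem : prodForm (mixSeq T a ∘ σ) ∈ Submodule.span ℂ (Set.range
      fun γ : Fin p → (Fin m → ℂ) →L[ℂ] ℂ => prodForm (pairSeq γ γ)) := by
    have : mixSeq T a ∘ σ = pairSeq (fun l : Fin p => a (σ ⟨2 * l, by omega⟩))
        (fun l : Fin p => a (σ ⟨2 * l + 1, by omega⟩)) := by
      ext1 j
      simp only [comp_apply, mixSeq, pairSeq]
      by_cases hj : (j : ℕ) % 2 = 0
      · rw [if_pos (hσ1 j hj), if_pos hj]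
        congr 3
        ext; simp only; omega
      · rw [if_neg (hσ2 j hj), if_neg hj]
        congr 3
        ext; simp only; omega
    rw [this]
    exact prodForm_pairSeq_mem_span Finset.univ _ _ (by simp)
  rw [prodForm_comp_perm] at hmem
  have h0 : ((Perm.sign σ : ℤ) : ℂ) ≠ 0 := by
    rcases Int.units_eq_one_or (Perm.sign σ) with h | h <;> simp [h]
  exact (Submodule.smul_mem_iff _ h0).1 hmem

/-- Forms of bidegree `(p, p)` are combinations of pulled back volume forms. -/
theorem mem_span_volForm {p : ℕ} (φ : AltForm m (2 * p))
    (hφ : ∀ (c : ℂ) (v : Fin (2 * p) → Fin m → ℂ),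
      φ (fun j => c • v j) = c ^ p * (starRingEnd ℂ c) ^ p * φ v) :
    φ ∈ Submodule.span ℂ (Set.range fun γ : Fin p → (Fin m → ℂ) →L[ℂ] ℂ => volForm γ) := by
  classical
  have hspan : Submodule.span ℂ (Set.range fun γ : Fin p → (Fin m → ℂ) →L[ℂ] ℂ =>
      prodForm (pairSeq γ γ)) ≤ Submodule.span ℂ (Set.range
        fun γ : Fin p → (Fin m → ℂ) →L[ℂ] ℂ => volForm γ) := by
    rw [Submodule.span_le]
    rintro _ ⟨γ, rfl⟩
    have hI : (Complex.I / 2) ^ p ≠ 0 := pow_ne_zero _ (by simp)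
    exact (Submodule.smul_mem_iff _ hI).1 (Submodule.subset_span ⟨γ, rfl⟩)
  apply hspan
  have hfac : ((2 * p).factorial : ℂ) ≠ 0 := by exact_mod_cast (2 * p).factorial_ne_zero
  -- `ψ q` is the component of type `(q, 2p - q)` of `(2p)! φ`.
  set ψ : ℕ → AltForm m (2 * p) := fun q => ∑ s : Fin (2 * p) → Fin m × Fin 2,
    φ (fun j => realFrame (s j)) • ∑ T ∈ Finset.univ.filter fun T : Finset (Fin (2 * p)) =>
      T.card = q, prodForm (mixSeq T fun j => halfCoord (s j)) with hψ
  have hsum : ((2 * p).factorial : ℂ) • φ = ∑ q ∈ Finset.range (2 * p + 1), ψ q := by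
    rw [factorial_smul_eq_sum, hψ, Finset.sum_comm]
    refine Finset.sum_congr rfl fun s _ => ?_
    rw [prodForm_add_conj, ← Finset.smul_sum]
    congr 1
    refine (Finset.sum_fiberwise_of_maps_to (fun T _ => ?_) _).symm
    have := T.card_le_univ
    simp only [Fintype.card_fin] at this
    simp; omega
  have hψs : ∀ q (c : ℂ) (v : Fin (2 * p) → Fin m → ℂ), ψ q (fun j => c • v j) =
      c ^ q * (starRingEnd ℂ c) ^ (2 * p - q) * ψ q v := by
    intro q c v
    simp only [hψ, ContinuousAlternatingMap.sum_apply, ContinuousAlternatingMap.smul_apply,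
      smul_eq_mul, Finset.mul_sum]
    refine Finset.sum_congr rfl fun s _ => Finset.sum_congr rfl fun T hT => ?_
    rw [prodForm_mixSeq_smul, (Finset.mem_filter.1 hT).2]
    ring
  have hp : ((2 * p).factorial : ℂ) • φ = ψ p := by
    ext v
    -- Scaling all arguments by `c` and dividing by `|c|^(2p)` gives `∑_q ψ_q(v) x^q = (2p)! φ(v)
    -- x^p` for `x = c / c̄`. The values `c = 1 + n i` yield infinitely many such `x`, so this is an
    -- identity of polynomials, and its coefficient at `p` is the claim.
    set P : Polynomial ℂ := ∑ q ∈ Finset.range (2 * p + 1), Polynomial.C (ψ q v) * Polynomial.X ^ q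
      - Polynomial.C (((2 * p).factorial : ℂ) * φ v) * Polynomial.X ^ p with hP
    have hne : ∀ n : ℕ, (1 - n * Complex.I : ℂ) ≠ 0 := by
      intro n h
      have := congrArg Complex.re h
      simp at this
    have hroot : ∀ n : ℕ, P.IsRoot ((1 + n * Complex.I) / (1 - n * Complex.I)) := by
      intro n
      set c : ℂ := 1 + n * Complex.I with hc
      have hcc : starRingEnd ℂ c = 1 - n * Complex.I := by simp [hc, sub_eq_add_neg]
      have hc0 : starRingEnd ℂ c ≠ 0 := by rw [hcc]; exact hne n
      rw [← hcc]
      have h1 := congrArg (fun f : AltForm m (2 * p) => f fun j => c • v j) hsum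
      simp only [ContinuousAlternatingMap.sum_apply, ContinuousAlternatingMap.smul_apply,
        smul_eq_mul, hψs, hφ] at h1
      have h2 : ∀ q ∈ Finset.range (2 * p + 1), ψ q v * (c / starRingEnd ℂ c) ^ q =
          (c ^ q * (starRingEnd ℂ c) ^ (2 * p - q) * ψ q v) / (starRingEnd ℂ c) ^ (2 * p) := by
        intro q hq
        have hq' : q ≤ 2 * p := by simpa [Nat.lt_succ_iff] using hq
        rw [div_pow, eq_div_iff (pow_ne_zero _ hc0)]
        have : (starRingEnd ℂ c) ^ (2 * p) =
            (starRingEnd ℂ c) ^ (2 * p - q) * (starRingEnd ℂ c) ^ q := by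
          rw [← pow_add]; congr 1; omega
        rw [this]
        field_simp
      simp only [Polynomial.IsRoot, hP, Polynomial.eval_sub, Polynomial.eval_finsetSum,
        Polynomial.eval_mul, Polynomial.eval_C, Polynomial.eval_pow, Polynomial.eval_X]
      have h5 : (starRingEnd ℂ c) ^ (2 * p) = (starRingEnd ℂ c) ^ p * (starRingEnd ℂ c) ^ p := by
        rw [two_mul, pow_add]
      rw [Finset.sum_congr rfl h2, ← Finset.sum_div, ← h1, h5, div_pow]
      field_simp
      ring
    have hP0 : P = 0 := by
      refine Polynomial.eq_zero_of_infinite_isRoot _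
        (Set.infinite_of_injective_forall_mem (f := fun n : ℕ =>
          ((1 + n * Complex.I) / (1 - n * Complex.I) : ℂ)) ?_ hroot)
      intro n n' h
      simp only [div_eq_div_iff (hne n) (hne n')] at h
      have := congrArg Complex.im h
      simp at this
      have h3 : (n : ℝ) = n' := by linarith
      exact_mod_cast h3
    have h3 := congrArg (fun Q : Polynomial ℂ => Q.coeff p) hP0
    simp only [hP, Polynomial.coeff_sub, Polynomial.finsetSum_coeff, Polynomial.coeff_C_mul,
      Polynomial.coeff_X_pow, Polynomial.coeff_zero] at h3
    rw [Finset.sum_eq_single p] at h3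
    · simp only [if_true, mul_one, sub_eq_zero] at h3
      simp only [ContinuousAlternatingMap.smul_apply, smul_eq_mul]
      exact h3.symm
    · intro q _ hq
      simp [Ne.symm hq]
    · intro h
      exact absurd (Finset.mem_range.2 (by omega)) h
  refine (Submodule.smul_mem_iff _ hfac).1 ?_
  rw [hp]
  refine Submodule.sum_mem _ fun s _ => Submodule.smul_mem _ _ (Submodule.sum_mem _ fun T hT => ?_)
  exact prodForm_mixSeq_mem_span T (Finset.mem_filter.1 hT).2 _

instance finiteDimensional_altForm (r : ℕ) : FiniteDimensional ℂ (AltForm m r) := by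
  let ev : AltForm m r →ₗ[ℂ] ((Fin r → Fin m × Fin 2) → ℂ) :=
    { toFun := fun φ s => φ fun j => realFrame (s j)
      map_add' := fun _ _ => rfl
      map_smul' := fun _ _ => rfl }
  refine FiniteDimensional.of_injective ev fun φ ψ h => ?_
  ext v
  rw [map_eq_sum_realFrame φ, map_eq_sum_realFrame ψ]
  refine Finset.sum_congr rfl fun s _ => ?_
  have := congrFun h s
  change φ _ = ψ _ at this
  rw [this]

/-- Forms of bidegree `(p, p)` decompose into pulled back volume forms, with coefficients
depending linearly and continuously on the form. -/
theorem exists_volForm_decomposition (m p : ℕ) :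
    ∃ (N : ℕ) (α : Fin N → Fin p → (Fin m → ℂ) →L[ℂ] ℂ)
      (coef : Fin N → AltForm m (2 * p) →L[ℂ] ℂ), ∀ φ : AltForm m (2 * p),
      (∀ (c : ℂ) (v : Fin (2 * p) → Fin m → ℂ),
        φ (fun j => c • v j) = c ^ p * (starRingEnd ℂ c) ^ p * φ v) →
      φ = ∑ i, coef i φ • volForm (α i) := by
  classical
  set s : Set (AltForm m (2 * p)) :=
    Set.range fun γ : Fin p → (Fin m → ℂ) →L[ℂ] ℂ => volForm γ with hs
  obtain ⟨b, hbs, hspan, hli⟩ := exists_linearIndependent ℂ s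
  have hfin : Finite b := hli.finite
  have := Fintype.ofFinite b
  let e : Fin (Fintype.card b) ≃ b := (Fintype.equivFin b).symm
  let B := Module.Basis.span hli
  -- The coordinate functionals on the span are extended to all forms; continuity is automatic in
  -- finite dimension. Coefficients of a continuous family of forms are then continuous.
  have hext : ∀ i : b, ∃ g : AltForm m (2 * p) →ₗ[ℂ] ℂ, g.comp (Submodule.subtype _) = B.coord i :=
    fun i => LinearMap.exists_extend (B.coord i)
  choose g hg using hext
  have hα : ∀ i : b, ∃ γ : Fin p → (Fin m → ℂ) →L[ℂ] ℂ, volForm γ = i := fun i => hbs i.2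
  choose α hα using hα
  refine ⟨Fintype.card b, fun i => α (e i),
    fun i => LinearMap.toContinuousLinearMap (g (e i)), fun φ hφ => ?_⟩
  have hmem := mem_span_volForm φ hφ
  rw [← hs, ← hspan] at hmem
  have hmem' : φ ∈ Submodule.span ℂ (Set.range ((↑) : b → AltForm m (2 * p))) := by
    simpa using hmem
  rw [e.sum_comp fun i => (LinearMap.toContinuousLinearMap (g i)) φ • volForm (α i)]
  have h1 := congrArg (Submodule.subtype _) (B.sum_repr ⟨φ, hmem'⟩)
  rw [map_sum] at h1
  refine Eq.trans h1.symm (Finset.sum_congr rfl fun i _ => ?_)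
  have h2 := DFunLike.congr_fun (hg i) ⟨φ, hmem'⟩
  simp only [LinearMap.comp_apply, Submodule.subtype_apply, Module.Basis.coord_apply] at h2
  rw [map_smul, Submodule.subtype_apply, LinearMap.coe_toContinuousLinearMap', h2, hα,
    Module.Basis.span_apply]

end Polarization

/-! ### Complex manifolds as real manifolds -/

section RealStructure

open Set Filter Topology

variable {m : ℕ} {M : Type*} [TopologicalSpace M] [ChartedSpace (Fin m → ℂ) M]

/-- Differential forms and their pull-backs use real derivatives while charts are holomorphic; this
comparison lets one manifold carry both structures. -/
theorem contDiffGroupoid_complex_le_real :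
    contDiffGroupoid ω 𝓘(ℂ, Fin m → ℂ) ≤ contDiffGroupoid ω 𝓘(ℝ, Fin m → ℂ) := by
  apply groupoid_of_pregroupoid_le
  intro f s hfs
  exact ContDiffOn.restrict_scalars ℝ hfs

theorem isManifold_real [IsManifold 𝓘(ℂ, Fin m → ℂ) ω M] : IsManifold 𝓘(ℝ, Fin m → ℂ) ω M :=
  { hasGroupoid_of_le (inferInstanceAs (HasGroupoid M (contDiffGroupoid ω 𝓘(ℂ, Fin m → ℂ))))
      contDiffGroupoid_complex_le_real with }

theorem mem_maximalAtlas_real {e : OpenPartialHomeomorph M (Fin m → ℂ)}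
    (he : e ∈ IsManifold.maximalAtlas 𝓘(ℂ, Fin m → ℂ) ω M) :
    e ∈ IsManifold.maximalAtlas 𝓘(ℝ, Fin m → ℂ) ω M :=
  StructureGroupoid.maximalAtlas_mono contDiffGroupoid_complex_le_real he

theorem _root_.HasMFDerivAt.restrictScalars_real {d : ℕ} {N : Type*} [TopologicalSpace N]
    [ChartedSpace (Fin d → ℂ) N] {f : M → N} {x : M} {f' : (Fin m → ℂ) →L[ℂ] (Fin d → ℂ)}
    (h : HasMFDerivAt 𝓘(ℂ, Fin m → ℂ) 𝓘(ℂ, Fin d → ℂ) f x f') :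
    HasMFDerivAt 𝓘(ℝ, Fin m → ℂ) 𝓘(ℝ, Fin d → ℂ) f x (f'.restrictScalars ℝ) :=
  ⟨h.1, HasFDerivWithinAt.restrictScalars ℝ h.2⟩

variable [IsManifold 𝓘(ℂ, Fin m → ℂ) ω M]

theorem mdifferentiableAt_chart {e : OpenPartialHomeomorph M (Fin m → ℂ)}
    (he : e ∈ IsManifold.maximalAtlas 𝓘(ℂ, Fin m → ℂ) ω M) {x : M} (hx : x ∈ e.source) :
    MDifferentiableAt 𝓘(ℂ, Fin m → ℂ) 𝓘(ℂ, Fin m → ℂ) e x :=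
  (contMDiffAt_of_mem_maximalAtlas he hx).mdifferentiableAt (by simp)

theorem mdifferentiableAt_chart_symm {e : OpenPartialHomeomorph M (Fin m → ℂ)}
    (he : e ∈ IsManifold.maximalAtlas 𝓘(ℂ, Fin m → ℂ) ω M) {z : Fin m → ℂ} (hz : z ∈ e.target) :
    MDifferentiableAt 𝓘(ℂ, Fin m → ℂ) 𝓘(ℂ, Fin m → ℂ) e.symm z :=
  (contMDiffAt_symm_of_mem_maximalAtlas he hz).mdifferentiableAt (by simp)

/-- The (complex linear) differential of a holomorphic chart. -/
def chartDeriv (e : OpenPartialHomeomorph M (Fin m → ℂ)) (x : M) :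
    (Fin m → ℂ) →L[ℂ] (Fin m → ℂ) :=
  mfderiv 𝓘(ℂ, Fin m → ℂ) 𝓘(ℂ, Fin m → ℂ) e x

/-- The (complex linear) differential of the inverse of a holomorphic chart. -/
def chartSymmDeriv (e : OpenPartialHomeomorph M (Fin m → ℂ)) (z : Fin m → ℂ) :
    (Fin m → ℂ) →L[ℂ] (Fin m → ℂ) :=
  mfderiv 𝓘(ℂ, Fin m → ℂ) 𝓘(ℂ, Fin m → ℂ) e.symm z

theorem mfderiv_chart_real {e : OpenPartialHomeomorph M (Fin m → ℂ)}
    (he : e ∈ IsManifold.maximalAtlas 𝓘(ℂ, Fin m → ℂ) ω M) {x : M} (hx : x ∈ e.source) :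
    mfderiv 𝓘(ℝ, Fin m → ℂ) 𝓘(ℝ, Fin m → ℂ) e x = (chartDeriv e x).restrictScalars ℝ :=
  ((mdifferentiableAt_chart he hx).hasMFDerivAt.restrictScalars_real).mfderiv

theorem mfderiv_chart_symm_real {e : OpenPartialHomeomorph M (Fin m → ℂ)}
    (he : e ∈ IsManifold.maximalAtlas 𝓘(ℂ, Fin m → ℂ) ω M) {z : Fin m → ℂ} (hz : z ∈ e.target) :
    mfderiv 𝓘(ℝ, Fin m → ℂ) 𝓘(ℝ, Fin m → ℂ) e.symm z =
      (chartSymmDeriv e z).restrictScalars ℝ :=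
  ((mdifferentiableAt_chart_symm he hz).hasMFDerivAt.restrictScalars_real).mfderiv

theorem chartSymmDeriv_comp_chartDeriv {e : OpenPartialHomeomorph M (Fin m → ℂ)}
    (he : e ∈ IsManifold.maximalAtlas 𝓘(ℂ, Fin m → ℂ) ω M) {x : M} (hx : x ∈ e.source) :
    (chartSymmDeriv e (e x)).comp (chartDeriv e x) = ContinuousLinearMap.id ℂ (Fin m → ℂ) := by
  have hd : e.MDifferentiable 𝓘(ℂ, Fin m → ℂ) 𝓘(ℂ, Fin m → ℂ) :=
    ⟨fun x hx => (mdifferentiableAt_chart he hx).mdifferentiableWithinAt,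
      fun z hz => (mdifferentiableAt_chart_symm he hz).mdifferentiableWithinAt⟩
  exact hd.symm_comp_deriv hx

/-- Transition maps are holomorphic. -/
theorem contDiffAt_transition {e e' : OpenPartialHomeomorph M (Fin m → ℂ)}
    (he : e ∈ IsManifold.maximalAtlas 𝓘(ℂ, Fin m → ℂ) ω M)
    (he' : e' ∈ IsManifold.maximalAtlas 𝓘(ℂ, Fin m → ℂ) ω M) {z : Fin m → ℂ}
    (hz : z ∈ e.target) (hz' : e.symm z ∈ e'.source) :
    ContDiffAt ℂ ω (fun z => e' (e.symm z)) z := by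
  have h1 := contMDiffAt_symm_of_mem_maximalAtlas he hz
  have h2 := contMDiffAt_of_mem_maximalAtlas he' hz'
  exact (h2.comp z h1).contDiffAt

theorem fderiv_transition {e e' : OpenPartialHomeomorph M (Fin m → ℂ)}
    (he : e ∈ IsManifold.maximalAtlas 𝓘(ℂ, Fin m → ℂ) ω M)
    (he' : e' ∈ IsManifold.maximalAtlas 𝓘(ℂ, Fin m → ℂ) ω M) {z : Fin m → ℂ}
    (hz : z ∈ e.target) (hz' : e.symm z ∈ e'.source) :
    fderiv ℂ (fun z => e' (e.symm z)) z = (chartDeriv e' (e.symm z)).comp (chartSymmDeriv e z) := by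
  rw [← mfderiv_eq_fderiv]
  exact mfderiv_comp z (mdifferentiableAt_chart he' hz') (mdifferentiableAt_chart_symm he hz)

end RealStructure

/-! ### Integration over slices -/

section Slices

open Set Filter Topology MeasureTheory

variable {m : ℕ}

/-- The inclusion of `ℂ^d` in `ℂ^m` as a linear map. -/
def inclL (d m : ℕ) : (Fin d → ℂ) →L[ℂ] (Fin m → ℂ) :=
  ContinuousLinearMap.pi fun i =>
    if h : (i : ℕ) < d then ContinuousLinearMap.proj ⟨i, h⟩ else 0

theorem inclL_apply (d m : ℕ) (w : Fin d → ℂ) : inclL d m w = incl d m w := by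
  ext i
  by_cases h : (i : ℕ) < d <;> simp [inclL, incl, h]

theorem inclL_injective {d m : ℕ} (hd : d ≤ m) : Function.Injective (inclL d m) := by
  intro w w' h
  ext i
  have := congrFun h ⟨i, by omega⟩
  simpa [inclL_apply, incl] using this

theorem incl_eq_of_forall {d m : ℕ} (hd : d ≤ m) {z : Fin m → ℂ}
    (hz : ∀ i : Fin m, d ≤ (i : ℕ) → z i = 0) :
    inclL d m (fun i => z ⟨i, by omega⟩) = z := by
  ext i
  by_cases h : (i : ℕ) < d
  · simp [inclL_apply, incl, h]
  · simp [inclL_apply, incl, h, hz i (by omega)]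

/-- The real determinant of a complex linear map is the norm of its complex determinant. It is
nonnegative, and so the area formula, which sees absolute values, computes integrals of forms. -/
theorem abs_det_restrictScalars_pi {p : ℕ} (γ : Fin p → (Fin p → ℂ) →L[ℂ] ℂ) :
    |((ContinuousLinearMap.pi γ).restrictScalars ℝ).det| = ‖(formMatrix γ).det‖ ^ 2 := by
  have h1 : ((ContinuousLinearMap.pi γ).restrictScalars ℝ).det =
      LinearMap.det (((ContinuousLinearMap.pi γ : (Fin p → ℂ) →L[ℂ] (Fin p → ℂ)) :
        (Fin p → ℂ) →ₗ[ℂ] (Fin p → ℂ)).restrictScalars ℝ) := rfl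
  rw [h1, LinearMap.det_restrictScalars, Algebra.norm_complex_eq]
  have h2 : LinearMap.det ((ContinuousLinearMap.pi γ : (Fin p → ℂ) →L[ℂ] (Fin p → ℂ)) :
      (Fin p → ℂ) →ₗ[ℂ] (Fin p → ℂ)) = (formMatrix γ).det := by
    rw [← LinearMap.det_toMatrix', ← Matrix.det_transpose]
    congr 1
  rw [h2]
  change |Complex.normSq _| = _
  rw [Complex.normSq_eq_norm_sq, abs_of_nonneg (by positivity)]

variable {M : Type*} [TopologicalSpace M] [T2Space M] [CompactSpace M]
  [ChartedSpace (Fin m → ℂ) M] [IsManifold 𝓘(ℂ, Fin m → ℂ) ω M]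

/-- The form `ρ · e^*(α^* vol)`, where `e` is a chart of `M`, `α : ℂ^m → ℂ^d` is linear and `ρ` is a
function on `M`. -/
def chartForm {d : ℕ} (e : OpenPartialHomeomorph M (Fin m → ℂ))
    (α : Fin d → (Fin m → ℂ) →L[ℂ] ℂ) (ρ : M → ℂ) : DForm m M (2 * d) := fun x =>
  ρ x • (volForm α).compContinuousLinearMap
    (mfderiv 𝓘(ℝ, Fin m → ℂ) 𝓘(ℝ, Fin m → ℂ) e x)

/-- Points of `Y` in the domain of the chart `e` which lie over `t`. -/
abbrev SliceFibre {d : ℕ} (Y : Set M) (e : OpenPartialHomeomorph M (Fin m → ℂ))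
    (α : Fin d → (Fin m → ℂ) →L[ℂ] ℂ) (t : Fin d → ℂ) : Type _ :=
  {z : M // (z ∈ Y ∧ z ∈ e.source) ∧ (fun i => α i (e z)) = t}

/-- In the slice coordinate `w`, the map `f = α ∘ e₀ ∘ σ` is a holomorphic map between open subsets
of `ℂ^d`, and the integrand is `|det f'| · χ ρ`. The area formula converts the slice integral into
sums over the fibres of `f`, that is, over the points of `Y` above `t`. -/
theorem sliceIntegral_chartForm {d : ℕ} (hd : d ≤ m) {Y : Set M}
    {e : OpenPartialHomeomorph M (Fin m → ℂ)} (he : IsSliceChart d Y e) {χ : M → ℝ}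
    (hχ : Continuous χ) (hχe : tsupport χ ⊆ e.source) {e₀ : OpenPartialHomeomorph M (Fin m → ℂ)}
    (he₀ : e₀ ∈ IsManifold.maximalAtlas 𝓘(ℂ, Fin m → ℂ) ω M)
    (α : Fin d → (Fin m → ℂ) →L[ℂ] ℂ) {ρ : M → ℂ} (hρ : Continuous ρ)
    (hρe : tsupport ρ ⊆ e₀.source) :
    IntegrableOn (fun w => pullback (fun w => e.symm (incl d m w))
      (fun x => ((χ x : ℝ) : ℂ) • chartForm e₀ α ρ x) w (stdFrame d))
      {w : Fin d → ℂ | incl d m w ∈ e.target} ∧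
    (∀ᵐ t : Fin d → ℂ, Summable fun z : SliceFibre Y e₀ α t => (χ z : ℂ) * ρ z) ∧
    Integrable (fun t : Fin d → ℂ => ∑' z : SliceFibre Y e₀ α t, (χ z : ℂ) * ρ z) ∧
    sliceIntegral e (fun x => ((χ x : ℝ) : ℂ) • chartForm e₀ α ρ x) =
      ∫ t : Fin d → ℂ, ∑' z : SliceFibre Y e₀ α t, (χ z : ℂ) * ρ z := by
  classical
  set σ : (Fin d → ℂ) → M := fun w => e.symm (incl d m w) with hσ
  set W : Set (Fin d → ℂ) := {w | incl d m w ∈ e.target} with hW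
  -- The part of the slice inside the domain of `e₀`. On the rest of `W` the integrand vanishes,
  -- since `ρ` is supported in `e₀.source`.
  set W' : Set (Fin d → ℂ) := {w | inclL d m w ∈ e.target ∩ e.symm ⁻¹' e₀.source} with hW'
  have hWW' : W' ⊆ W := fun w hw => by
    have := hw.1; rwa [inclL_apply] at this
  have hW'o : IsOpen W' :=
    (e.symm.isOpen_inter_preimage e₀.open_source).preimage (inclL d m).continuous
  have hWo : IsOpen W := by
    have : W = inclL d m ⁻¹' e.target := by ext w; simp [hW, inclL_apply]
    rw [this]; exact e.open_target.preimage (inclL d m).continuous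
  set T : (Fin d → ℂ) → (Fin m → ℂ) := fun w => e₀ (e.symm (inclL d m w)) with hT
  have hTc : ∀ w ∈ W', ContDiffAt ℂ ω T w := fun w hw =>
    ContDiffAt.comp (g := fun z => e₀ (e.symm z)) w (contDiffAt_transition he.1 he₀ hw.1 hw.2)
      (inclL d m).contDiff.contDiffAt
  set f : (Fin d → ℂ) → (Fin d → ℂ) := fun w i => α i (T w) with hf
  have hfc : ∀ w ∈ W', ContDiffAt ℂ ω f w := fun w hw =>
    contDiffAt_pi.2 fun i => (α i).contDiff.contDiffAt.comp w (hTc w hw)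
  have hTd : ∀ w ∈ W', HasFDerivAt T (fderiv ℂ T w) w := fun w hw =>
    ((hTc w hw).differentiableAt (by simp)).hasFDerivAt
  set f' : (Fin d → ℂ) → (Fin d → ℂ) →L[ℝ] (Fin d → ℂ) := fun w =>
    (ContinuousLinearMap.pi fun i => (α i).comp (fderiv ℂ T w)).restrictScalars ℝ with hf'
  have hfd : ∀ w ∈ W', HasFDerivWithinAt f (f' w) W' w := by
    intro w hw
    refine HasFDerivAt.hasFDerivWithinAt ?_
    refine HasFDerivAt.restrictScalars ℝ ?_
    exact hasFDerivAt_pi.2 fun i => (α i).hasFDerivAt.comp w (hTd w hw)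
  have hTfc : ContinuousOn (fderiv ℂ T) W' := fun w hw =>
    ((hTc w hw).fderiv_right (m := 0) (by simp)).continuousAt.continuousWithinAt
  have hf'c : ContinuousOn f' W' := by
    have h1 : ContinuousOn (fun w => (ContinuousLinearMap.pi fun i => α i :
        (Fin m → ℂ) →L[ℂ] (Fin d → ℂ)).comp (fderiv ℂ T w)) W' :=
      continuousOn_const.clm_comp hTfc
    exact (ContinuousLinearMap.restrictScalarsL ℂ (Fin d → ℂ) (Fin d → ℂ) ℝ ℝ
      |>.continuous).comp_continuousOn h1
  set u : (Fin d → ℂ) → ℂ := fun w => (χ (σ w) : ℂ) * ρ (σ w) with hu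
  have hσc : ContinuousOn σ W := by
    refine e.continuousOn_symm.comp ?_ fun w hw => hw
    have : incl d m = inclL d m := by ext1 w; rw [inclL_apply]
    rw [this]; exact (inclL d m).continuous.continuousOn
  have huc : ContinuousOn u W :=
    (Complex.continuous_ofReal.comp hχ).comp_continuousOn hσc |>.mul (hρ.comp_continuousOn hσc)
  -- the integrand in terms of the Jacobian of `f`
  have hval : ∀ w ∈ W', pullback σ (fun x => ((χ x : ℝ) : ℂ) • chartForm e₀ α ρ x) w (stdFrame d) =
      |(f' w).det| • u w := by
    intro w hw
    have hwt : inclL d m w ∈ e.target := hw.1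
    have hws : σ w ∈ e₀.source := by have := hw.2; simp only [hσ, ← inclL_apply]; exact this
    have hσd : MDifferentiableAt 𝓘(ℂ, Fin d → ℂ) 𝓘(ℂ, Fin m → ℂ) σ w := by
      have h1 := mdifferentiableAt_chart_symm he.1 hwt
      have h2 : MDifferentiableAt 𝓘(ℂ, Fin d → ℂ) 𝓘(ℂ, Fin m → ℂ) (inclL d m) w :=
        (inclL d m).differentiableAt.mdifferentiableAt
      have h3 := h1.comp w h2
      have h4 : σ = e.symm ∘ inclL d m := by ext1 w; simp [hσ, inclL_apply]
      rw [h4]; exact h3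
    have hσr := hσd.hasMFDerivAt.restrictScalars_real
    have hTeq : T = e₀ ∘ σ := by ext1 w; simp [hT, hσ, inclL_apply]
    have hcomp : fderiv ℂ T w = (chartDeriv e₀ (σ w)).comp
        (mfderiv 𝓘(ℂ, Fin d → ℂ) 𝓘(ℂ, Fin m → ℂ) σ w) := by
      rw [← mfderiv_eq_fderiv, hTeq]
      exact mfderiv_comp w (mdifferentiableAt_chart he₀ hws) hσd
    have h5 : pullback σ (fun x => ((χ x : ℝ) : ℂ) • chartForm e₀ α ρ x) w (stdFrame d) =
        (χ (σ w) : ℂ) * (ρ (σ w) * volForm α (fun i =>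
          (mfderiv 𝓘(ℝ, Fin m → ℂ) 𝓘(ℝ, Fin m → ℂ) e₀ (σ w))
            (mfderiv 𝓘(ℝ, Fin d → ℂ) 𝓘(ℝ, Fin m → ℂ) σ w (stdFrame d i)))) := rfl
    rw [h5, mfderiv_chart_real he₀ hws, hσr.mfderiv]
    have h6 : (fun i => ((chartDeriv e₀ (σ w)).restrictScalars ℝ)
        (((mfderiv 𝓘(ℂ, Fin d → ℂ) 𝓘(ℂ, Fin m → ℂ) σ w).restrictScalars ℝ) (stdFrame d i))) =
        fun i => fderiv ℂ T w (stdFrame d i) := by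
      rw [hcomp]; rfl
    have h7 := volForm_stdFrame α (fderiv ℂ T w)
    rw [← h6] at h7
    refine (congrArg (fun y => (χ (σ w) : ℂ) * (ρ (σ w) * y)) h7).trans ?_
    rw [hf', abs_det_restrictScalars_pi, Complex.real_smul]
    simp only [hu]
    ring
  have hval0 : ∀ w ∈ W \ W',
      pullback σ (fun x => ((χ x : ℝ) : ℂ) • chartForm e₀ α ρ x) w (stdFrame d) = 0 := by
    intro w hw
    have hws : σ w ∉ e₀.source := by
      intro h
      refine hw.2 ⟨?_, ?_⟩
      · rw [inclL_apply]; exact hw.1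
      · simp only [mem_preimage, inclL_apply]; exact h
    have : ρ (σ w) = 0 := image_eq_zero_of_notMem_tsupport fun h => hws (hρe h)
    have h5 : pullback σ (fun x => ((χ x : ℝ) : ℂ) • chartForm e₀ α ρ x) w (stdFrame d) =
        (χ (σ w) : ℂ) * (ρ (σ w) * volForm α (fun i =>
          (mfderiv 𝓘(ℝ, Fin m → ℂ) 𝓘(ℝ, Fin m → ℂ) e₀ (σ w))
            (mfderiv 𝓘(ℝ, Fin d → ℂ) 𝓘(ℝ, Fin m → ℂ) σ w (stdFrame d i)))) := rfl
    rw [h5, this, zero_mul, mul_zero]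
  -- integrability
  set K : Set M := tsupport χ ∩ tsupport ρ with hK
  have hKc : IsCompact K := ((isClosed_tsupport χ).inter (isClosed_tsupport ρ)).isCompact
  -- The slice parameters of the common support of `χ` and `ρ`. This set is compact because `inclL`
  -- is a closed embedding, and it lies in `W'`, where the integrand is continuous.
  set K' : Set (Fin d → ℂ) := inclL d m ⁻¹' (e '' K) with hK'
  have hK'c : IsCompact K' := by
    have hce : IsClosedEmbedding (inclL d m) :=
      LinearMap.isClosedEmbedding_of_injective
        (f := ((inclL d m : (Fin d → ℂ) →L[ℂ] (Fin m → ℂ)) : (Fin d → ℂ) →ₗ[ℂ] (Fin m → ℂ)))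
        (LinearMap.ker_eq_bot.2 (inclL_injective hd))
    refine hce.isCompact_preimage (hKc.image_of_continuousOn ?_)
    exact e.continuousOn.mono fun x hx => hχe hx.1
  have hK'W : K' ⊆ W' := by
    rintro w ⟨x, hx, hxw⟩
    have hxe : x ∈ e.source := hχe hx.1
    refine ⟨?_, ?_⟩
    · rw [← hxw]; exact e.map_source hxe
    · rw [mem_preimage, ← hxw, e.left_inv hxe]; exact hρe hx.2
  have hudet : ContinuousOn (fun w => |(f' w).det| • u w) W' :=
    (ContinuousLinearMap.continuous_det.comp_continuousOn hf'c).abs.smul (huc.mono hWW')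
  have hInt : IntegrableOn (fun w => |(f' w).det| • u w) W' := by
    refine ((hudet.mono hK'W).integrableOn_compact hK'c).of_forall_sdiff_eq_zero
      hW'o.measurableSet fun w hw => ?_
    have : u w = 0 := by
      by_contra hne
      refine hw.2 ⟨σ w, ⟨?_, ?_⟩, ?_⟩
      · by_contra h
        exact hne (by simp [hu, image_eq_zero_of_notMem_tsupport h])
      · by_contra h
        exact hne (by simp [hu, image_eq_zero_of_notMem_tsupport h])
      · simp only [hσ, ← inclL_apply]; exact e.right_inv hw.1.1
    simp [this]
  obtain ⟨hA, hB, hC⟩ := area_formula volume hW'o.measurableSet hfd hf'c hInt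
  -- reindexing the fibres
  have hfib : ∀ (t : Fin d → ℂ) (a : ℂ), HasSum (fun w : {w // w ∈ W' ∧ f w = t} => u w) a ↔
      HasSum (fun z : SliceFibre Y e₀ α t => (χ z : ℂ) * ρ z) a := by
    intro t a
    have hmem : ∀ w : {w // w ∈ W' ∧ f w = t}, (σ w ∈ Y ∧ σ w ∈ e₀.source) ∧
        (fun i => α i (e₀ (σ w))) = t := by
      rintro ⟨w, hw, hwt⟩
      have hsrc : σ w ∈ e.source := e.map_target (hWW' hw)
      refine ⟨⟨(he.2 _ hsrc).2 fun i hi => ?_, ?_⟩, ?_⟩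
      · simp only [hσ]
        rw [e.right_inv (hWW' hw)]
        simp [incl, hi]
      · have := hw.2; simp only [hσ, ← inclL_apply]; exact this
      · refine Eq.trans ?_ hwt
        simp only [hf, hT, hσ, inclL_apply]
    set g : {w // w ∈ W' ∧ f w = t} → SliceFibre Y e₀ α t := fun w => ⟨σ w, hmem w⟩ with hg
    have hginj : Function.Injective g := by
      rintro ⟨w, hw, hwt⟩ ⟨w', hw', hwt'⟩ h
      have h1 : σ w = σ w' := congrArg Subtype.val h
      have h2 := e.symm.injOn (hWW' hw) (hWW' hw') h1
      rw [← inclL_apply, ← inclL_apply] at h2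
      exact Subtype.ext (inclL_injective hd h2)
    rw [← hginj.hasSum_iff]
    · rfl
    -- Points above `t` that the slice chart misses carry weight `χ = 0`.
    · rintro ⟨z, ⟨hzY, hze⟩, hzt⟩ hz
      by_cases hs : z ∈ e.source
      · exfalso
        apply hz
        have h0 := (he.2 z hs).1 hzY
        have h1 := incl_eq_of_forall hd h0
        have hσz : σ (fun i => e z ⟨i, by omega⟩) = z := by
          simp only [hσ, ← inclL_apply]; rw [h1]; exact e.left_inv hs
        refine ⟨⟨fun i => e z ⟨i, by omega⟩, ⟨?_, ?_⟩, ?_⟩, Subtype.ext hσz⟩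
        · rw [h1]; exact e.map_source hs
        · rw [mem_preimage, h1, e.left_inv hs]; exact hze
        · rw [← hzt]
          simp only [hf, hT]; rw [h1, e.left_inv hs]
      · have : χ z = 0 := image_eq_zero_of_notMem_tsupport fun h => hs (hχe h)
        simp [this]
  -- The equality holds for every `t`, also where the fibre is not summable: both sums then have the
  -- default value `0`.
  have hts : ∀ t : Fin d → ℂ, ∑' w : {w // w ∈ W' ∧ f w = t}, u w =
      ∑' z : SliceFibre Y e₀ α t, (χ z : ℂ) * ρ z := by
    intro t
    by_cases hs : Summable fun w : {w // w ∈ W' ∧ f w = t} => u w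
    · exact (((hfib t _).1 hs.hasSum).tsum_eq).symm
    · rw [tsum_eq_zero_of_not_summable hs, tsum_eq_zero_of_not_summable]
      intro h
      exact hs ((hfib t _).2 h.hasSum).summable
  simp only [hts] at hB hC
  have hintP : IntegrableOn (fun w => pullback σ
      (fun x => ((χ x : ℝ) : ℂ) • chartForm e₀ α ρ x) w (stdFrame d)) W := by
    refine IntegrableOn.of_forall_sdiff_eq_zero
      (hInt.congr_fun (fun w hw => (hval w hw).symm) hW'o.measurableSet) hWo.measurableSet hval0
  refine ⟨hintP, ?_, hB, ?_⟩
  · filter_upwards [hA] with t ht using ((hfib t _).1 ht.hasSum).summable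
  · rw [hC]
    change ∫ w in W, pullback σ _ w (stdFrame d) = _
    rw [setIntegral_eq_of_subset_of_forall_sdiff_eq_zero hWo.measurableSet hWW' hval0]
    exact setIntegral_congr_fun hW'o.measurableSet hval

/-- Integrals of combinations of the forms `ρ · e^*(α^* vol)` over a submanifold, computed by
counting preimages. In particular they do not depend on the partition of unity. -/
theorem SlicePartition.integral_sum_chartForm {d : ℕ} (hd : d ≤ m) {Y : Set M}
    (P : SlicePartition m d Y) {ι : Type*} [Fintype ι]
    (e : ι → OpenPartialHomeomorph M (Fin m → ℂ))
    (he : ∀ i, e i ∈ IsManifold.maximalAtlas 𝓘(ℂ, Fin m → ℂ) ω M)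
    (α : ι → Fin d → (Fin m → ℂ) →L[ℂ] ℂ) (ρ : ι → M → ℂ) (hρ : ∀ i, Continuous (ρ i))
    (hρe : ∀ i, tsupport (ρ i) ⊆ (e i).source) :
    P.integral (fun x => ∑ i, chartForm (e i) (α i) (ρ i) x) =
      ∑ i, ∫ t : Fin d → ℂ, ∑' z : SliceFibre Y (e i) (α i) t, ρ i z := by
  have key := fun j i => sliceIntegral_chartForm hd (P.isSliceChart j) (P.smooth j).continuous
    (P.tsupport_subset j) (he i) (α i) (hρ i) (hρe i)
  have h1 : ∀ j, sliceIntegral (P.chart j)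
      (fun x => ((P.weight j x : ℝ) : ℂ) • ∑ i, chartForm (e i) (α i) (ρ i) x) =
      ∑ i, sliceIntegral (P.chart j)
        (fun x => ((P.weight j x : ℝ) : ℂ) • chartForm (e i) (α i) (ρ i) x) := by
    intro j
    simp only [sliceIntegral]
    rw [← integral_finsetSum _ fun i _ => (key j i).1]
    congr 1
    ext w
    simp only [pullback, Finset.smul_sum]
    exact ContinuousAlternatingMap.sum_apply ..
  rw [SlicePartition.integral]
  simp only [h1]
  rw [Finset.sum_comm]
  refine Finset.sum_congr rfl fun i _ => ?_
  simp only [(key _ i).2.2.2]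
  rw [← integral_finsetSum _ fun j _ => (key j i).2.2.1]
  refine integral_congr_ae ?_
  have hall : ∀ᵐ t : Fin d → ℂ, ∀ j, Summable fun z : SliceFibre Y (e i) (α i) t =>
      (P.weight j z : ℂ) * ρ i z := ae_all_iff.2 fun j => (key j i).2.1
  filter_upwards [hall] with t ht
  rw [← Summable.tsum_finsetSum fun j _ => ht j]
  refine tsum_congr fun z => ?_
  -- The weights add up to `1` only on `Y`, and all points of the fibre lie on `Y`.
  rw [← Finset.sum_mul, ← Complex.ofReal_sum, P.sum_eq_one z z.2.1.1]
  simp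

/-- A closed complex submanifold of a compact complex manifold has a finite partition of unity
subordinate to slice charts. -/
theorem IsComplexSubmanifold.nonempty_slicePartition {d : ℕ} {Y : Set M}
    (hY : IsComplexSubmanifold m d Y) (hYc : IsClosed Y) : Nonempty (SlicePartition m d Y) := by
  classical
  have := isManifold_real (m := m) (M := M)
  have : IsManifold 𝓘(ℝ, Fin m → ℂ) ∞ M := IsManifold.of_le (n := ω) (by simp)
  have hY' : ∀ y : Y, ∃ e : OpenPartialHomeomorph M (Fin m → ℂ),
      IsSliceChart d Y e ∧ (y : M) ∈ e.source := fun y => hY y y.2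
  choose e he hye using hY'
  obtain ⟨t, ht⟩ := hYc.isCompact.elim_nhds_subcover' (fun y hy => (e ⟨y, hy⟩).source)
    (fun y hy => (e ⟨y, hy⟩).open_source.mem_nhds (hye ⟨y, hy⟩))
  let n := Fintype.card t
  let g : Fin n ≃ t := (Fintype.equivFin t).symm
  have hcov : Y ⊆ ⋃ j : Fin n, (e (g j)).source := by
    intro y hy
    obtain ⟨x, hx, hyx⟩ := mem_iUnion₂.1 (ht hy)
    exact mem_iUnion.2 ⟨g.symm ⟨x, hx⟩, by simpa using hyx⟩
  obtain ⟨f, hf⟩ := SmoothPartitionOfUnity.exists_isSubordinate 𝓘(ℝ, Fin m → ℂ) hYc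
    (fun j : Fin n => (e (g j)).source) (fun j => (e (g j)).open_source) hcov
  exact ⟨{ size := n
           chart := fun j => e (g j)
           isSliceChart := fun j => he (g j)
           weight := fun j => f j
           smooth := fun j => (f j).contMDiff
           tsupport_subset := hf
           sum_eq_one := fun y hy => by
            have := f.sum_eq_one hy
            rwa [finsum_eq_sum_of_fintype] at this }⟩

/-- No index `i : Fin m` satisfies `m ≤ i`, so every chart is a slice chart. Hence the integral over
`M` obeys the same fibre-counting formula as the zero current. -/
theorem isComplexSubmanifold_univ : IsComplexSubmanifold m m (univ : Set M) := by
  intro y _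
  refine ⟨chartAt _ y, ⟨?_, fun x _ => ?_⟩, mem_chart_source _ y⟩
  · exact IsManifold.chart_mem_maximalAtlas y
  · simp only [mem_univ, true_iff]
    intro i hi
    omega

theorem integralOver_sum_chartForm {d : ℕ} (hd : d ≤ m) {Y : Set M}
    (hY : IsComplexSubmanifold m d Y) (hYc : IsClosed Y) {ι : Type*} [Fintype ι]
    (e : ι → OpenPartialHomeomorph M (Fin m → ℂ))
    (he : ∀ i, e i ∈ IsManifold.maximalAtlas 𝓘(ℂ, Fin m → ℂ) ω M)
    (α : ι → Fin d → (Fin m → ℂ) →L[ℂ] ℂ) (ρ : ι → M → ℂ) (hρ : ∀ i, Continuous (ρ i))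
    (hρe : ∀ i, tsupport (ρ i) ⊆ (e i).source) :
    integralOver Y (fun x => ∑ i, chartForm (e i) (α i) (ρ i) x) =
      ∑ i, ∫ t : Fin d → ℂ, ∑' z : SliceFibre Y (e i) (α i) t, ρ i z := by
  rw [integralOver, dif_pos (hY.nonempty_slicePartition hYc)]
  exact SlicePartition.integral_sum_chartForm hd _ e he α ρ hρ hρe

end Slices

/-! ### The form `∂∂̄ log ∑ |f_j|²` -/

section LogForm

open Set Filter Topology ComplexConjugate

variable {m n : ℕ}

/-- The normalized projections `(D_j - F_j ⟨D, F⟩ / |F|²) / |F|` of the differentials `D_j` of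
functions with values `F_j`. -/
def projForm (F : Fin n → ℂ) (D : Fin n → (Fin m → ℂ) →L[ℂ] ℂ) (j : Fin n) :
    (Fin m → ℂ) →L[ℂ] ℂ :=
  ((√(∑ l, ‖F l‖ ^ 2) : ℝ) : ℂ)⁻¹ •
    (D j - (F j / ((∑ l, ‖F l‖ ^ 2 : ℝ) : ℂ)) • ∑ l, conj (F l) • D l)

theorem projForm_apply (F : Fin n → ℂ) (D : Fin n → (Fin m → ℂ) →L[ℂ] ℂ) (j : Fin n)
    (v : Fin m → ℂ) :
    projForm F D j v = ((√(∑ l, ‖F l‖ ^ 2) : ℝ) : ℂ)⁻¹ *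
      (D j v - (F j / ((∑ l, ‖F l‖ ^ 2 : ℝ) : ℂ)) * ∑ l, conj (F l) * D l v) := by
  simp [projForm, sum_apply]

theorem projForm_comp (F : Fin n → ℂ) (D : Fin n → (Fin m → ℂ) →L[ℂ] ℂ)
    (T : (Fin m → ℂ) →L[ℂ] (Fin m → ℂ)) (j : Fin n) :
    projForm F (fun l => (D l).comp T) j = (projForm F D j).comp T := by
  ext1 v
  simp [projForm_apply]

/-- A change of frame multiplies all functions by `g`. The extra term `F_j dg` of the product rule
is parallel to `F` and is killed by the projection; only a unimodular factor remains, and it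
disappears in `sumPair`. -/
theorem projForm_mul (F : Fin n → ℂ) (D : Fin n → (Fin m → ℂ) →L[ℂ] ℂ) {g : ℂ} (hg : g ≠ 0)
    (hF : 0 < ∑ l, ‖F l‖ ^ 2) (dg : (Fin m → ℂ) →L[ℂ] ℂ) (j : Fin n) :
    projForm (fun l => g * F l) (fun l => g • D l + F l • dg) j =
      (g / ((‖g‖ : ℝ) : ℂ)) • projForm F D j := by
  ext1 v
  have hN : (∑ l, ‖g * F l‖ ^ 2) = ‖g‖ ^ 2 * ∑ l, ‖F l‖ ^ 2 := by
    simp [mul_pow, Finset.mul_sum]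
  have ha : ∑ l, conj (g * F l) * (g * D l v + F l * dg v) =
      (‖g‖ : ℂ) ^ 2 * ∑ l, conj (F l) * D l v +
        conj g * ((∑ l, ‖F l‖ ^ 2 : ℝ) : ℂ) * dg v := by
    rw [← Complex.conj_mul']
    push_cast
    simp only [← Complex.conj_mul', Finset.mul_sum, Finset.sum_mul, ← Finset.sum_add_distrib, map_mul]
    refine Finset.sum_congr rfl fun l _ => ?_
    ring
  simp only [smul_apply, projForm_apply, add_apply,
    smul_eq_mul, hN, ha]
  rw [Real.sqrt_mul (by positivity), Real.sqrt_sq (norm_nonneg _)]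
  set N := ∑ l, ‖F l‖ ^ 2
  have h1 : ((√N : ℝ) : ℂ) ≠ 0 := by exact_mod_cast (Real.sqrt_pos.2 hF).ne'
  have h2 : ((N : ℝ) : ℂ) ≠ 0 := by exact_mod_cast hF.ne'
  have h3 : ((‖g‖ : ℝ) : ℂ) ≠ 0 := by exact_mod_cast (norm_pos_iff.2 hg).ne'
  have h4 : conj g = (‖g‖ : ℂ) ^ 2 / g := by
    rw [← Complex.conj_mul']; field_simp
  rw [h4]
  push_cast
  field_simp
  ring

/-- Pythagoras: projecting away from `F` subtracts `⟨Dv, F⟩⟨F, Dw⟩ / |F|²` from the Hermitian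
product of `Dv` and `Dw`. The result is the Fubini–Study form. -/
theorem sum_projForm_mul_conj (F : Fin n → ℂ) (D : Fin n → (Fin m → ℂ) →L[ℂ] ℂ)
    (hF : 0 < ∑ l, ‖F l‖ ^ 2) (v w : Fin m → ℂ) :
    ∑ j, projForm F D j v * conj (projForm F D j w) =
      (∑ j, D j v * conj (D j w)) / ((∑ l, ‖F l‖ ^ 2 : ℝ) : ℂ) -
        (∑ l, conj (F l) * D l v) * conj (∑ l, conj (F l) * D l w) /
          ((∑ l, ‖F l‖ ^ 2 : ℝ) : ℂ) ^ 2 := by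
  simp only [projForm_apply]
  have hs : (∑ l, F l * conj (F l)) = ((∑ l, ‖F l‖ ^ 2 : ℝ) : ℂ) := by
    push_cast; simp [Complex.mul_conj']
  set N := ∑ l, ‖F l‖ ^ 2
  have h2 : ((N : ℝ) : ℂ) ≠ 0 := by exact_mod_cast hF.ne'
  have h1 : (((√N : ℝ) : ℂ)⁻¹) * ((√N : ℝ) : ℂ)⁻¹ = ((N : ℝ) : ℂ)⁻¹ := by
    rw [← mul_inv, ← Complex.ofReal_mul, Real.mul_self_sqrt hF.le]
  set av := ∑ l, conj (F l) * D l v with hav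
  set aw := ∑ l, conj (F l) * D l w with haw
  have hw : conj aw = ∑ l, F l * conj (D l w) := by simp [haw]
  have key : ∀ j, (((√N : ℝ) : ℂ)⁻¹ * (D j v - F j / (N : ℂ) * av)) *
      conj (((√N : ℝ) : ℂ)⁻¹ * (D j w - F j / (N : ℂ) * aw)) =
      (N : ℂ)⁻¹ * (D j v * conj (D j w) - (conj (F j) * D j v) * (conj aw / N) -
        (F j * conj (D j w)) * (av / N) + (F j * conj (F j)) * (av * conj aw / N ^ 2)) := by
    intro j
    simp only [map_mul, map_sub, map_div₀, map_inv₀, Complex.conj_ofReal]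
    rw [← h1]
    field_simp
    ring
  rw [Finset.sum_congr rfl fun j _ => key j, ← Finset.mul_sum, Finset.sum_add_distrib,
    Finset.sum_sub_distrib, Finset.sum_sub_distrib, ← Finset.sum_mul, ← Finset.sum_mul,
    ← Finset.sum_mul, hs, ← hav, ← hw]
  field_simp
  ring

theorem sumPair_apply (B : Fin n → (Fin m → ℂ) →L[ℂ] ℂ) (v : Fin 2 → Fin m → ℂ) :
    sumPair B v = ∑ j, B j (v 0) * conj (B j (v 1)) - ∑ j, B j (v 1) * conj (B j (v 0)) := by
  simp only [sumPair, ContinuousAlternatingMap.sum_apply, prodForm_apply, ← Finset.sum_sub_distrib]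
  refine Finset.sum_congr rfl fun j _ => ?_
  rw [Matrix.det_fin_two]
  simp [pairSeq, conjForm_apply]
  ring

theorem sumPair_smul (B : Fin n → (Fin m → ℂ) →L[ℂ] ℂ) {c : ℂ} (hc : ‖c‖ = 1) :
    sumPair (fun j => c • B j) = sumPair B := by
  ext v
  have h : c * conj c = 1 := by rw [Complex.mul_conj', hc]; simp
  simp only [sumPair_apply, smul_apply, smul_eq_mul, map_mul]
  congr 1 <;> refine Finset.sum_congr rfl fun j _ => ?_
  · linear_combination B j (v 0) * conj (B j (v 1)) * h
  · linear_combination B j (v 1) * conj (B j (v 0)) * h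

theorem sumPair_comp (B : Fin n → (Fin m → ℂ) →L[ℂ] ℂ) (T : (Fin m → ℂ) →L[ℂ] (Fin m → ℂ)) :
    (sumPair B).compContinuousLinearMap (T.restrictScalars ℝ) =
      sumPair fun j => (B j).comp T := by
  ext v
  simp [sumPair_apply]

/-- Antilinear forms as `1`-forms. -/
def conjOneForm (m : ℕ) : ((Fin m → ℂ) →L[ℂ] ℂ) →L[ℝ] AltForm m 1 :=
  LinearMap.toContinuousLinearMap
    { toFun := fun T => ContinuousAlternatingMap.ofSubsingleton ℝ (Fin m → ℂ) ℂ (0 : Fin 1)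
        (conjForm T)
      map_add' := fun S T => by ext v; simp [conjForm_apply]
      map_smul' := fun c T => by ext v; simp [conjForm_apply] }

theorem conjOneForm_apply (T : (Fin m → ℂ) →L[ℂ] ℂ) (v : Fin 1 → Fin m → ℂ) :
    conjOneForm m T v = conj (T (v 0)) := by
  simp [conjOneForm, conjForm_apply]

/-- The form `∂ log ∑ |f_j|²`. -/
def dLogForm (f : Fin n → (Fin m → ℂ) → ℂ) (z : Fin m → ℂ) : (Fin m → ℂ) →L[ℂ] ℂ :=
  ((∑ l, ‖f l z‖ ^ 2 : ℝ) : ℂ)⁻¹ • ∑ l, conj (f l z) • fderiv ℂ (f l) z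

/-- The real differential of `log ∑ |f_l|²` is twice the real part of the complex linear form
`dLogForm f z`; `∂̄` selects its antilinear half. -/
theorem dbar_log {f : Fin n → (Fin m → ℂ) → ℂ} {z : Fin m → ℂ}
    (hf : ∀ j, DifferentiableAt ℂ (f j) z) (hN : 0 < ∑ l, ‖f l z‖ ^ 2) :
    dbar (fun y => ((Real.log (∑ l, ‖f l y‖ ^ 2) : ℝ) : ℂ)) z = conjOneForm m (dLogForm f z) := by
  have hd : HasFDerivAt (fun y => ((Real.log (∑ l, ‖f l y‖ ^ 2) : ℝ) : ℂ)) _ z :=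
    Complex.ofRealCLM.hasFDerivAt.comp z
      ((HasFDerivAt.fun_sum fun l _ =>
        ((hf l).hasFDerivAt.restrictScalars ℝ).norm_sq).log hN.ne')
  have hv : ∀ v, fderiv ℝ (fun y => ((Real.log (∑ l, ‖f l y‖ ^ 2) : ℝ) : ℂ)) z v =
      dLogForm f z v + conj (dLogForm f z v) := by
    intro v
    rw [hd.fderiv, Complex.add_conj]
    have h1 : (dLogForm f z v).re =
        (∑ l, ‖f l z‖ ^ 2)⁻¹ * ∑ l, (conj (f l z) * fderiv ℂ (f l) z v).re := by
      rw [← Complex.re_sum, ← Complex.re_ofReal_mul]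
      simp [dLogForm, sum_apply]
    rw [h1]
    simp [sum_apply, Complex.inner, Finset.mul_sum]
    refine Finset.sum_congr rfl fun l _ => ?_
    ring
  ext v
  rw [conjOneForm_apply]
  simp only [dbar, ContinuousAlternatingMap.ofSubsingleton_apply_apply, smul_apply, add_apply,
    ContinuousLinearMap.comp_apply, hv, ContinuousLinearMap.id_apply, map_smul, smul_eq_mul,
    map_mul, Complex.conj_I]
  linear_combination (1 / 2 : ℂ) * (dLogForm f z (v 0) - conj (dLogForm f z (v 0))) * Complex.I_mul_I

/-- Differentiating the conjugate of `∂ log ∑ |f_l|²` produces second derivatives of the `f_l` and a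
product of two values of the `(1,0)`-form. Both are symmetric in the two vectors and drop out on
alternating. What survives is the Fubini–Study expression of `sum_projForm_mul_conj`. -/
theorem extDeriv_dbar_log {f : Fin n → (Fin m → ℂ) → ℂ} {z : Fin m → ℂ}
    (hf : ∀ j, ContDiffAt ℂ ω (f j) z) (hN : 0 < ∑ l, ‖f l z‖ ^ 2) :
    extDeriv (dbar fun y => ((Real.log (∑ l, ‖f l y‖ ^ 2) : ℝ) : ℂ)) z =
      sumPair (projForm (fun j => f j z) fun j => fderiv ℂ (f j) z) := by
  have hfd : ∀ j, DifferentiableAt ℂ (f j) z := fun j => (hf j).differentiableAt (by simp)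
  have hf2 : ∀ j, DifferentiableAt ℂ (fderiv ℂ (f j)) z := fun j =>
    ((hf j).fderiv_right (m := ω) (by simp)).differentiableAt (by simp)
  have hc : ContinuousAt (fun y => ∑ l, ‖f l y‖ ^ 2) z :=
    tendsto_finset_sum _ fun l _ => ((hf l).continuousAt.norm.pow 2)
  have hev : dbar (fun y => ((Real.log (∑ l, ‖f l y‖ ^ 2) : ℝ) : ℂ)) =ᶠ[𝓝 z]
      fun y => conjOneForm m (dLogForm f y) := by
    have h1 : ∀ᶠ y in 𝓝 z, ∀ j, DifferentiableAt ℂ (f j) y := by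
      rw [eventually_all]
      intro j
      filter_upwards [(hf j).eventually (by simp)] with y hy using hy.differentiableAt (by simp)
    filter_upwards [h1, hc.eventually (lt_mem_nhds hN)] with y hy1 hy2 using dbar_log hy1 hy2
  have hNc : ∀ y, ((∑ l, ‖f l y‖ ^ 2 : ℝ) : ℂ) = ∑ l, conj (f l y) * f l y := by
    intro y; push_cast; simp [Complex.conj_mul']
  have hN0 : (∑ l, conj (f l z) * f l z) ≠ 0 := by
    rw [← hNc]; exact_mod_cast hN.ne'
  have hconj : ∀ j, HasFDerivAt (fun y => conj (f j y))
      ((Complex.conjCLE : ℂ →L[ℝ] ℂ).comp ((fderiv ℂ (f j) z).restrictScalars ℝ)) z := fun j =>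
    (Complex.conjCLE : ℂ →L[ℝ] ℂ).hasFDerivAt.comp z ((hfd j).hasFDerivAt.restrictScalars ℝ)
  have hfr : ∀ j, HasFDerivAt (f j) ((fderiv ℂ (f j) z).restrictScalars ℝ) z := fun j =>
    (hfd j).hasFDerivAt.restrictScalars ℝ
  have hf2r : ∀ j, HasFDerivAt (fderiv ℂ (f j))
      ((fderiv ℂ (fderiv ℂ (f j)) z).restrictScalars ℝ) z := fun j =>
    (hf2 j).hasFDerivAt.restrictScalars ℝ
  have hinv : HasFDerivAt (fun y => (∑ l, conj (f l y) * f l y)⁻¹) _ z :=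
    (hasFDerivAt_inv hN0).restrictScalars ℝ |>.comp z
      (HasFDerivAt.fun_sum fun l _ => (hconj l).mul (hfr l))
  obtain ⟨G', hG, hval⟩ : ∃ G' : (Fin m → ℂ) →L[ℝ] (Fin m → ℂ) →L[ℂ] ℂ,
      HasFDerivAt (dLogForm f) G' z ∧ ∀ w v, G' w v =
        ((∑ l, ‖f l z‖ ^ 2 : ℝ) : ℂ)⁻¹ * ((∑ l, conj (f l z) * fderiv ℂ (fderiv ℂ (f l)) z w v) +
          ∑ l, fderiv ℂ (f l) z v * conj (fderiv ℂ (f l) z w)) -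
        (∑ l, conj (f l z) * fderiv ℂ (f l) z w + conj (∑ l, conj (f l z) * fderiv ℂ (f l) z w)) *
          (∑ l, conj (f l z) * fderiv ℂ (f l) z v) / ((∑ l, ‖f l z‖ ^ 2 : ℝ) : ℂ) ^ 2 := by
    have : dLogForm f = fun y => (∑ l, conj (f l y) * f l y)⁻¹ •
        ∑ l, conj (f l y) • fderiv ℂ (f l) y := by
      funext y; rw [dLogForm, hNc]
    rw [this]
    refine ⟨_, hinv.smul (HasFDerivAt.fun_sum fun l _ => (hconj l).smul (hf2r l)), fun w v => ?_⟩
    have e1 : (∑ l, (conj (f l z) * fderiv ℂ (f l) z w + f l z * conj (fderiv ℂ (f l) z w))) =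
        ∑ l, conj (f l z) * fderiv ℂ (f l) z w + conj (∑ l, conj (f l z) * fderiv ℂ (f l) z w) := by
      simp [Finset.sum_add_distrib]
    rw [← e1, hNc z]
    simp [sum_apply, Finset.sum_add_distrib, mul_comm (fderiv ℂ (f _) z v)]
    simp only [div_eq_mul_inv, ← Finset.sum_mul]
    field_simp
    ring
  have hω := (conjOneForm m).hasFDerivAt.comp z hG
  have hsymm : ∀ (l : Fin n) (v w : Fin m → ℂ), fderiv ℂ (fderiv ℂ (f l)) z v w =
      fderiv ℂ (fderiv ℂ (f l)) z w v := fun l v w =>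
    (hf l).isSymmSndFDerivAt (by simp) v w
  have hω' : fderiv ℝ (fun y => conjOneForm m (dLogForm f y)) z = (conjOneForm m).comp G' :=
    hω.fderiv
  rw [hev.extDeriv_eq, extDeriv, hω']
  ext v
  rw [ContinuousAlternatingMap.alternatizeUncurryFin_apply, sumPair_apply,
    sum_projForm_mul_conj _ _ hN, sum_projForm_mul_conj _ _ hN]
  refine (Fin.sum_univ_two _).trans ?_
  have r0 : (0 : Fin (1 + 1)).removeNth v 0 = v 1 := rfl
  have r1 : (1 : Fin (1 + 1)).removeNth v 0 = v 0 := rfl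
  simp only [Fin.val_zero, Fin.val_one, pow_zero, pow_one, one_smul, neg_smul,
    ContinuousLinearMap.comp_apply, conjOneForm_apply, hval, r0, r1]
  simp_rw [hsymm _ (v 0) (v 1)]
  simp only [map_sub, map_add, map_mul, map_div₀, map_pow, Complex.conj_conj, map_inv₀,
    Complex.conj_ofReal, map_sum]
  have hN' : ((∑ l, ‖f l z‖ ^ 2 : ℝ) : ℂ) ≠ 0 := by exact_mod_cast hN.ne'
  simp only [mul_comm (conj (fderiv ℂ (f _) z _)) (fderiv ℂ (f _) z _)]
  field_simp
  ring

end LogForm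

/-! ### Sections in local frames -/

section Frames

open Set Filter Topology ComplexConjugate

variable {m : ℕ} {M : Type*} [TopologicalSpace M] [ChartedSpace (Fin m → ℂ) M]
  {L : M → Type*} [∀ x, AddCommGroup (L x)] [∀ x, Module ℂ (L x)]
  [∀ x, TopologicalSpace (L x)] [TopologicalSpace (Bundle.TotalSpace ℂ L)]
  [FiberBundle ℂ L]

theorem HermitianMetric.normSq_smul (h : HermitianMetric m L) {x : M} (c : ℂ) (v : L x) :
    h.normSq (c • v) = ‖c‖ ^ 2 * h.normSq v := by
  have h1 : (h.core x).inner (c • v) (c • v) = ((‖c‖ ^ 2 : ℝ) : ℂ) * (h.core x).inner v v := by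
    rw [(h.core x).smul_left, ← (h.core x).conj_inner_symm v (c • v), (h.core x).smul_left, map_mul,
      (h.core x).conj_inner_symm, Complex.conj_conj, ← mul_assoc, Complex.conj_mul']
    push_cast; rfl
  rw [normSq, h1, Complex.re_ofReal_mul, normSq]

theorem HermitianMetric.normSq_pos (h : HermitianMetric m L) {x : M} {v : L x} (hv : v ≠ 0) :
    0 < h.normSq v := by
  refine lt_of_le_of_ne ((h.core x).re_inner_nonneg v) fun h0 => hv ((h.core x).definite v ?_)
  apply Complex.ext
  · exact h0.symm
  · have := congrArg Complex.im ((h.core x).conj_inner_symm v v)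
    rw [Complex.conj_im] at this
    simp only [Complex.zero_im]
    linarith

variable [VectorBundle ℂ ℂ L]

theorem sum_smul_section_apply {n : ℕ} (c : Fin n → ℂ) (s : Fin n → HolSection m L) (y : M) :
    (∑ j, c j • s j : HolSection m L) y = ∑ j, c j • s j y := by
  have := congrFun (map_sum (ContMDiffSection.coeAddHom 𝓘(ℂ, Fin m → ℂ) ℂ ω L)
    (fun j => c j • s j) Finset.univ) y
  refine this.trans ?_
  rw [Finset.sum_apply]
  rfl

/-- The coordinate of a section in the local frame around `a`. -/
def frameCoord (a : M) (s : HolSection m L) (y : M) : ℂ := (trivializationAt ℂ L a ⟨y, s y⟩).2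

theorem localFrame_ne_zero {a y : M} (hy : y ∈ (trivializationAt ℂ L a).baseSet) :
    localFrame L a y ≠ 0 := by
  intro h
  have h1 := (trivializationAt ℂ L a).apply_mk_symm hy (1 : ℂ)
  rw [localFrame] at h
  rw [h] at h1
  have h2 : (trivializationAt ℂ L a ⟨y, 0⟩).2 = (0 : ℂ) :=
    (((trivializationAt ℂ L a).linear ℂ hy).mk' _).map_zero
  rw [h1] at h2
  exact one_ne_zero h2

theorem frameCoord_smul_localFrame {a y : M} (hy : y ∈ (trivializationAt ℂ L a).baseSet)
    (s : HolSection m L) : frameCoord a s y • localFrame L a y = s y := by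
  have h1 := (((trivializationAt ℂ L a).linear ℂ hy).mk' _).map_smul (frameCoord a s y)
    (localFrame L a y)
  have h2 : (trivializationAt ℂ L a ⟨y, frameCoord a s y • localFrame L a y⟩).2 =
      frameCoord a s y := by
    refine h1.trans ?_
    change frameCoord a s y • (trivializationAt ℂ L a ⟨y, localFrame L a y⟩).2 = _
    rw [localFrame, (trivializationAt ℂ L a).apply_mk_symm hy]
    simp
  rw [← (trivializationAt ℂ L a).symm_apply_apply_mk hy (_ • localFrame L a y), h2, frameCoord,
    (trivializationAt ℂ L a).symm_apply_apply_mk hy]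

theorem frameCoord_eq_zero_iff {a y : M} (hy : y ∈ (trivializationAt ℂ L a).baseSet)
    (s : HolSection m L) : frameCoord a s y = 0 ↔ s y = 0 := by
  rw [← frameCoord_smul_localFrame hy s, smul_eq_zero, or_iff_left (localFrame_ne_zero hy)]

theorem frameCoord_sum {a y : M} (hy : y ∈ (trivializationAt ℂ L a).baseSet) {n : ℕ}
    (c : Fin n → ℂ) (s : Fin n → HolSection m L) :
    frameCoord a (∑ j, c j • s j) y = ∑ j, c j * frameCoord a (s j) y := by
  have h1 : (∑ j, c j • s j : HolSection m L) y =
      (∑ j, c j * frameCoord a (s j) y) • localFrame L a y := by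
    rw [Finset.sum_smul]
    rw [sum_smul_section_apply]
    refine Finset.sum_congr rfl fun j _ => ?_
    rw [mul_smul, frameCoord_smul_localFrame hy]
  rw [← frameCoord_smul_localFrame hy, ← sub_eq_zero, ← sub_smul, smul_eq_zero,
    or_iff_left (localFrame_ne_zero hy), sub_eq_zero] at h1
  exact h1

variable [IsManifold 𝓘(ℂ, Fin m → ℂ) ω M] [ContMDiffVectorBundle ω ℂ L 𝓘(ℂ, Fin m → ℂ)]

theorem contMDiffOn_frameCoord (a : M) (s : HolSection m L) :
    ContMDiffOn 𝓘(ℂ, Fin m → ℂ) 𝓘(ℂ, ℂ) ω (frameCoord a s) (trivializationAt ℂ L a).baseSet :=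
  (trivializationAt ℂ L a).contMDiffOn_section_baseSet_iff.1 s.contMDiff.contMDiffOn

theorem contDiffAt_frameCoord_comp_symm {e : OpenPartialHomeomorph M (Fin m → ℂ)}
    (he : e ∈ IsManifold.maximalAtlas 𝓘(ℂ, Fin m → ℂ) ω M) {a : M} {z : Fin m → ℂ}
    (hz : z ∈ e.target) (hza : e.symm z ∈ (trivializationAt ℂ L a).baseSet) (s : HolSection m L) :
    ContDiffAt ℂ ω (fun w => frameCoord a s (e.symm w)) z :=
  (((contMDiffOn_frameCoord a s).contMDiffAt
    ((trivializationAt ℂ L a).open_baseSet.mem_nhds hza)).comp z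
      (contMDiffAt_symm_of_mem_maximalAtlas he hz)).contDiffAt

end Frames

/-! ### The expected form in local coordinates -/

section ExpectedForm

open Set Filter Topology ComplexConjugate

variable {m : ℕ}

/-- The linear map on differentials underlying `∂̄`. -/
def dbarL (m : ℕ) : ((Fin m → ℂ) →L[ℝ] ℂ) →L[ℝ] AltForm m 1 :=
  LinearMap.toContinuousLinearMap
    { toFun := fun T => ContinuousAlternatingMap.ofSubsingleton ℝ (Fin m → ℂ) ℂ (0 : Fin 1)
        ((1 / 2 : ℂ) • (T + Complex.I • T.comp (Complex.I • ContinuousLinearMap.id ℝ (Fin m → ℂ))))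
      map_add' := fun S T => by ext v; simp; ring
      map_smul' := fun c T => by ext v; simp; ring }

theorem dbar_eq_dbarL (u : (Fin m → ℂ) → ℂ) (z : Fin m → ℂ) : dbar u z = dbarL m (fderiv ℝ u z) :=
  rfl

theorem differentiableAt_dbar {u : (Fin m → ℂ) → ℂ} {z : Fin m → ℂ} (hu : ContDiffAt ℝ 2 u z) :
    DifferentiableAt ℝ (dbar u) z :=
  (dbarL m).differentiableAt.comp z
    ((hu.fderiv_right (m := 1) (by norm_num)).differentiableAt (by simp))

theorem extDeriv_dbar_add {u v : (Fin m → ℂ) → ℂ} {z : Fin m → ℂ} (hu : ContDiffAt ℝ 2 u z)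
    (hv : ContDiffAt ℝ 2 v z) :
    extDeriv (dbar fun y => u y + v y) z = extDeriv (dbar u) z + extDeriv (dbar v) z := by
  rw [← extDeriv_add (differentiableAt_dbar hu) (differentiableAt_dbar hv)]
  refine Filter.EventuallyEq.extDeriv_eq ?_
  filter_upwards [hu.eventually (by simp), hv.eventually (by simp)] with y hy1 hy2
  have := fderiv_add (hy1.differentiableAt (by simp)) (hy2.differentiableAt (by simp))
  simp only [dbar_eq_dbarL, Pi.add_apply]
  rw [← map_add, ← this]
  rfl

variable {M : Type*} [TopologicalSpace M] [ChartedSpace (Fin m → ℂ) M]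
  [IsManifold 𝓘(ℂ, Fin m → ℂ) ω M]
  {L : M → Type*} [∀ x, AddCommGroup (L x)] [∀ x, Module ℂ (L x)]
  [∀ x, TopologicalSpace (L x)] [TopologicalSpace (Bundle.TotalSpace ℂ L)]
  [FiberBundle ℂ L] [VectorBundle ℂ ℂ L] [ContMDiffVectorBundle ω ℂ L 𝓘(ℂ, Fin m → ℂ)]
  {S : Submodule ℂ (HolSection m L)} {n : ℕ}

theorem IsBasePointFree.exists_basis_ne_zero (hS : IsBasePointFree S)
    (b : Module.Basis (Fin n) ℂ S) (x : M) : ∃ j, (b j : HolSection m L) x ≠ 0 := by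
  obtain ⟨s, hs, hsx⟩ := hS x
  by_contra! hb
  apply hsx
  have h1 : s = ∑ j, b.repr ⟨s, hs⟩ j • (b j : HolSection m L) := by
    have := congrArg (Subtype.val) (b.sum_repr ⟨s, hs⟩)
    rw [AddSubmonoidClass.coe_finset_sum] at this
    exact this.symm
  rw [h1]
  rw [sum_smul_section_apply]
  exact Finset.sum_eq_zero fun j _ => by rw [hb j, smul_zero]

theorem IsBasePointFree.sum_frameCoord_pos (hS : IsBasePointFree S)
    (b : Module.Basis (Fin n) ℂ S) {a y : M} (hy : y ∈ (trivializationAt ℂ L a).baseSet) :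
    0 < ∑ j, ‖frameCoord a (b j).1 y‖ ^ 2 := by
  obtain ⟨j, hj⟩ := hS.exists_basis_ne_zero b y
  refine Finset.sum_pos' (fun _ _ => by positivity) ⟨j, Finset.mem_univ _, ?_⟩
  have := (frameCoord_eq_zero_iff hy (b j : HolSection m L)).not.2 hj
  positivity

theorem szego_eq_mul (h : HermitianMetric m L) (b : Module.Basis (Fin n) ℂ S) {a y : M}
    (hy : y ∈ (trivializationAt ℂ L a).baseSet) :
    szego h b y = (∑ j, ‖frameCoord a (b j).1 y‖ ^ 2) * h.normSq (localFrame L a y) := by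
  rw [szego, Finset.sum_mul]
  refine Finset.sum_congr rfl fun j _ => ?_
  rw [← h.normSq_smul, frameCoord_smul_localFrame hy]

theorem contDiffAt_log_normSq (h : HermitianMetric m L) {e : OpenPartialHomeomorph M (Fin m → ℂ)}
    (he : e ∈ IsManifold.maximalAtlas 𝓘(ℂ, Fin m → ℂ) ω M) {a : M} {z : Fin m → ℂ}
    (hz : z ∈ e.target) (hza : e.symm z ∈ (trivializationAt ℂ L a).baseSet) :
    ContDiffAt ℝ 2 (fun w => ((Real.log (h.normSq (localFrame L a (e.symm w))) : ℝ) : ℂ)) z := by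
  have := isManifold_real (m := m) (M := M)
  have h1 : ContMDiffAt 𝓘(ℝ, Fin m → ℂ) 𝓘(ℝ, ℝ) 2 (fun y => h.normSq (localFrame L a y))
      (e.symm z) :=
    ((h.smooth a).contMDiffAt ((trivializationAt ℂ L a).open_baseSet.mem_nhds hza)).of_le
      (WithTop.coe_le_coe.2 le_top)
  have h2 : ContMDiffAt 𝓘(ℝ, Fin m → ℂ) 𝓘(ℝ, Fin m → ℂ) 2 e.symm z :=
    (contMDiffAt_symm_of_mem_maximalAtlas (mem_maximalAtlas_real he) hz).of_le le_top
  have h3 : ContDiffAt ℝ 2 (fun w => h.normSq (localFrame L a (e.symm w))) z :=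
    (h1.comp z h2).contDiffAt
  exact Complex.ofRealCLM.contDiff.contDiffAt.comp z
    (h3.log (h.normSq_pos (localFrame_ne_zero hza)).ne')

/-- Locally `Π_S = ∑ |f_j|² ‖e_L‖²`. The logarithm splits, and the `‖e_L‖²` part cancels against the
Chern form. Both forms are defined at `x` through the preferred chart and frame at `x`, so that is
where the cancellation is carried out. -/
theorem expectedForm_eq_chartAt (h : HermitianMetric m L) (hS : IsBasePointFree S)
    (b : Module.Basis (Fin n) ℂ S) (x : M) :
    expectedForm h b x = ((Complex.I / (2 * Real.pi)) •
      sumPair (projForm (fun j => frameCoord x (b j).1 x) fun j =>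
        fderiv ℂ (fun w => frameCoord x (b j).1 ((chartAt (Fin m → ℂ) x).symm w))
          (chartAt (Fin m → ℂ) x x))).compContinuousLinearMap
      (mfderiv 𝓘(ℝ, Fin m → ℂ) 𝓘(ℝ, Fin m → ℂ) (chartAt (Fin m → ℂ) x) x) := by
  let c := chartAt (Fin m → ℂ) x
  have hc : c ∈ IsManifold.maximalAtlas 𝓘(ℂ, Fin m → ℂ) ω M := IsManifold.chart_mem_maximalAtlas x
  have hx : x ∈ c.source := mem_chart_source _ x
  have hxb : x ∈ (trivializationAt ℂ L x).baseSet := FiberBundle.mem_baseSet_trivializationAt' x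
  have hz : c x ∈ c.target := c.map_source hx
  have hzb : c.symm (c x) ∈ (trivializationAt ℂ L x).baseSet := by rwa [c.left_inv hx]
  let f : Fin n → (Fin m → ℂ) → ℂ := fun j w => frameCoord x (b j).1 (c.symm w)
  have hf : ∀ j, ContDiffAt ℂ ω (f j) (c x) := fun j =>
    contDiffAt_frameCoord_comp_symm hc hz hzb _
  have hN : 0 < ∑ j, ‖f j (c x)‖ ^ 2 := hS.sum_frameCoord_pos b hzb
  have hU := contDiffAt_log_normSq h hc hz hzb
  have hu : ContDiffAt ℝ 2 (fun w => ((Real.log (∑ j, ‖f j w‖ ^ 2) : ℝ) : ℂ)) (c x) := by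
    refine Complex.ofRealCLM.contDiff.contDiffAt.comp (c x) (ContDiffAt.log ?_ hN.ne')
    exact ContDiffAt.sum fun j _ =>
      (((hf j).of_le le_top).restrict_scalars ℝ).norm_sq ℝ
  have e1 : ((fun z => ((Real.log (szego h b z) : ℝ) : ℂ)) ∘ c.symm) =ᶠ[𝓝 (c x)]
      fun w => ((Real.log (∑ j, ‖f j w‖ ^ 2) : ℝ) : ℂ) +
        ((Real.log (h.normSq (localFrame L x (c.symm w))) : ℝ) : ℂ) := by
    have : ∀ᶠ w in 𝓝 (c x), c.symm w ∈ (trivializationAt ℂ L x).baseSet :=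
      (c.continuousAt_symm hz).eventually ((trivializationAt ℂ L x).open_baseSet.mem_nhds hzb)
    filter_upwards [this] with w hw
    rw [Function.comp_apply, szego_eq_mul h b hw, Real.log_mul (hS.sum_frameCoord_pos b hw).ne'
      (h.normSq_pos (localFrame_ne_zero hw)).ne', Complex.ofReal_add]
  have e2 : ((fun y => ((Real.log (h.normSq (localFrame L x y))⁻¹ : ℝ) : ℂ)) ∘ c.symm) =
      fun w => -((Real.log (h.normSq (localFrame L x (c.symm w))) : ℝ) : ℂ) := by
    funext w
    simp
  have hdb : ∀ {u v : (Fin m → ℂ) → ℂ} {z}, u =ᶠ[𝓝 z] v →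
      extDeriv (dbar u) z = extDeriv (dbar v) z := by
    intro u v z huv
    refine Filter.EventuallyEq.extDeriv_eq ?_
    filter_upwards [huv.eventuallyEq_nhds] with y hy
    rw [dbar_eq_dbarL, dbar_eq_dbarL, hy.fderiv_eq]
  have key : extDeriv (dbar ((fun z => ((Real.log (szego h b z) : ℝ) : ℂ)) ∘ c.symm)) (c x) +
      extDeriv (dbar ((fun y => ((Real.log (h.normSq (localFrame L x y))⁻¹ : ℝ) : ℂ)) ∘ c.symm))
        (c x) = sumPair (projForm (fun j => f j (c x)) fun j => fderiv ℂ (f j) (c x)) := by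
    rw [hdb e1, e2, ← extDeriv_dbar_add (hu.add hU) hU.neg, ← extDeriv_dbar_log hf hN]
    congr 2
    funext w
    simp
  have hfx : (fun j => frameCoord x (b j).1 x) = fun j => f j (c x) := by
    funext j; simp only [f]; rw [c.left_inv hx]
  rw [hfx, ← key, smul_add]
  rfl

/-- The local expression does not depend on chart or frame: a change of frame is absorbed by
`projForm_mul` and `sumPair_smul`, a change of chart by the chain rule. -/
theorem expectedForm_eq (h : HermitianMetric m L) (hS : IsBasePointFree S)
    (b : Module.Basis (Fin n) ℂ S) {e : OpenPartialHomeomorph M (Fin m → ℂ)}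
    (he : e ∈ IsManifold.maximalAtlas 𝓘(ℂ, Fin m → ℂ) ω M) {a x : M} (hx : x ∈ e.source)
    (hxa : x ∈ (trivializationAt ℂ L a).baseSet) :
    expectedForm h b x = ((Complex.I / (2 * Real.pi)) •
      sumPair (projForm (fun j => frameCoord a (b j).1 x) fun j =>
        fderiv ℂ (fun w => frameCoord a (b j).1 (e.symm w)) (e x))).compContinuousLinearMap
      (mfderiv 𝓘(ℝ, Fin m → ℂ) 𝓘(ℝ, Fin m → ℂ) e x) := by
  let c := chartAt (Fin m → ℂ) x
  have hc : c ∈ IsManifold.maximalAtlas 𝓘(ℂ, Fin m → ℂ) ω M := IsManifold.chart_mem_maximalAtlas x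
  have hxc : x ∈ c.source := mem_chart_source _ x
  have hxb : x ∈ (trivializationAt ℂ L x).baseSet := FiberBundle.mem_baseSet_trivializationAt' x
  have hz : c x ∈ c.target := c.map_source hxc
  have hzb : c.symm (c x) ∈ (trivializationAt ℂ L x).baseSet := by rwa [c.left_inv hxc]
  have hza : c.symm (c x) ∈ (trivializationAt ℂ L a).baseSet := by rwa [c.left_inv hxc]
  have hze : c.symm (c x) ∈ e.source := by rwa [c.left_inv hxc]
  obtain ⟨i, hi⟩ := hS.exists_basis_ne_zero b x
  let fx : Fin n → (Fin m → ℂ) → ℂ := fun j w => frameCoord x (b j).1 (c.symm w)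
  let fa : Fin n → (Fin m → ℂ) → ℂ := fun j w => frameCoord a (b j).1 (c.symm w)
  let fe : Fin n → (Fin m → ℂ) → ℂ := fun j w => frameCoord a (b j).1 (e.symm w)
  have hfx : ∀ j, ContDiffAt ℂ ω (fx j) (c x) := fun j =>
    contDiffAt_frameCoord_comp_symm hc hz hzb _
  have hfa : ∀ j, ContDiffAt ℂ ω (fa j) (c x) := fun j =>
    contDiffAt_frameCoord_comp_symm hc hz hza _
  have hfe : ∀ j, ContDiffAt ℂ ω (fe j) (e x) := fun j =>
    contDiffAt_frameCoord_comp_symm he (e.map_source hx) (by rwa [e.left_inv hx]) _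
  have hvx : ∀ j, fx j (c x) = frameCoord x (b j).1 x := fun j => by
    simp only [fx]; rw [c.left_inv hxc]
  have hva : ∀ j, fa j (c x) = frameCoord a (b j).1 x := fun j => by
    simp only [fa]; rw [c.left_inv hxc]
  have hxi : fx i (c x) ≠ 0 := by
    rw [hvx]; exact (frameCoord_eq_zero_iff hxb _).not.2 hi
  have hai : fa i (c x) ≠ 0 := by
    rw [hva]; exact (frameCoord_eq_zero_iff hxa _).not.2 hi
  -- The transition function between the two frames, written as a quotient of the coordinates of one
  -- section that does not vanish at `x`; this makes its holomorphy immediate.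
  let g : (Fin m → ℂ) → ℂ := fun w => fx i w / fa i w
  have hg : ContDiffAt ℂ ω g (c x) := (hfx i).div (hfa i) hai
  have hg0 : g (c x) ≠ 0 := div_ne_zero hxi hai
  have hmul : ∀ j, fx j =ᶠ[𝓝 (c x)] fun w => g w * fa j w := by
    intro j
    have h1 : ∀ᶠ w in 𝓝 (c x), c.symm w ∈ (trivializationAt ℂ L x).baseSet :=
      (c.continuousAt_symm hz).eventually ((trivializationAt ℂ L x).open_baseSet.mem_nhds hzb)
    have h2 : ∀ᶠ w in 𝓝 (c x), c.symm w ∈ (trivializationAt ℂ L a).baseSet :=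
      (c.continuousAt_symm hz).eventually ((trivializationAt ℂ L a).open_baseSet.mem_nhds hza)
    filter_upwards [h1, h2, (hfa i).continuousAt.eventually_ne hai] with w hw1 hw2 hw3
    have key : ∀ l, fx l w = fa l w * (trivializationAt ℂ L x
        ⟨c.symm w, localFrame L a (c.symm w)⟩).2 := by
      intro l
      have h3 : (trivializationAt ℂ L x ⟨c.symm w, frameCoord a (b l).1 (c.symm w) •
          localFrame L a (c.symm w)⟩).2 = frameCoord a (b l).1 (c.symm w) •
            (trivializationAt ℂ L x ⟨c.symm w, localFrame L a (c.symm w)⟩).2 :=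
        (((trivializationAt ℂ L x).linear ℂ hw1).mk' _).map_smul _ _
      rw [frameCoord_smul_localFrame hw2] at h3
      exact h3
    simp only [g]
    rw [key j, key i]
    field_simp
  have hvg : ∀ j, fx j (c x) = g (c x) * fa j (c x) := fun j => (hmul j).self_of_nhds
  have hdg : ∀ j, fderiv ℂ (fx j) (c x) =
      g (c x) • fderiv ℂ (fa j) (c x) + fa j (c x) • fderiv ℂ g (c x) := by
    intro j
    rw [(hmul j).fderiv_eq]
    exact fderiv_mul (hg.differentiableAt (by simp)) ((hfa j).differentiableAt (by simp))
  let T : (Fin m → ℂ) →L[ℂ] (Fin m → ℂ) := fderiv ℂ (fun w => e (c.symm w)) (c x)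
  have hT : T = (chartDeriv e x).comp (chartSymmDeriv c (c x)) := by
    have := fderiv_transition hc he hz hze
    rwa [c.left_inv hxc] at this
  have hde : ∀ j, fderiv ℂ (fa j) (c x) = (fderiv ℂ (fe j) (e x)).comp T := by
    intro j
    have h1 : fa j =ᶠ[𝓝 (c x)] (fe j) ∘ fun w => e (c.symm w) := by
      have h2 : ∀ᶠ w in 𝓝 (c x), c.symm w ∈ e.source :=
        (c.continuousAt_symm hz).eventually (e.open_source.mem_nhds hze)
      filter_upwards [h2] with w hw
      simp only [fa, fe, Function.comp_apply]
      rw [e.left_inv hw]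
    have h3 : e (c.symm (c x)) = e x := by rw [c.left_inv hxc]
    rw [h1.fderiv_eq, fderiv_comp _ (by rw [h3]; exact (hfe j).differentiableAt (by simp))
      ((contDiffAt_transition hc he hz hze).differentiableAt (by simp)), h3]
  have hph : ‖g (c x) / ((‖g (c x)‖ : ℝ) : ℂ)‖ = 1 := by
    rw [norm_div, Complex.norm_real, norm_norm, div_self (norm_ne_zero_iff.2 hg0)]
  have hNa : 0 < ∑ j, ‖fa j (c x)‖ ^ 2 := by
    simp only [hva]; exact hS.sum_frameCoord_pos b hxa
  have hproj : projForm (fun j => frameCoord x (b j).1 x) (fun j => fderiv ℂ (fx j) (c x)) =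
      fun j => (g (c x) / ((‖g (c x)‖ : ℝ) : ℂ)) •
        (projForm (fun j => frameCoord a (b j).1 x) (fun j => fderiv ℂ (fe j) (e x)) j).comp T := by
    funext j
    have e1 : (fun j => frameCoord x (b j).1 x) = fun j => g (c x) * fa j (c x) := by
      funext l; rw [← hvg, hvx]
    rw [e1, funext hdg, projForm_mul _ _ hg0 hNa, funext hde, projForm_comp, funext hva]
  rw [expectedForm_eq_chartAt h hS b x]
  have hfin : (sumPair (projForm (fun j => frameCoord x (b j).1 x)
      (fun j => fderiv ℂ (fx j) (c x)))) =
      (sumPair (projForm (fun j => frameCoord a (b j).1 x)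
        (fun j => fderiv ℂ (fe j) (e x)))).compContinuousLinearMap (T.restrictScalars ℝ) := by
    rw [hproj, sumPair_smul (fun j => (projForm (fun j => frameCoord a (b j).1 x)
      (fun j => fderiv ℂ (fe j) (e x)) j).comp T) hph, sumPair_comp]
  have hTc : (T.restrictScalars ℝ).comp ((chartDeriv c x).restrictScalars ℝ) =
      (chartDeriv e x).restrictScalars ℝ := by
    have := congrArg (fun A => (chartDeriv e x).comp A) (chartSymmDeriv_comp_chartDeriv hc hxc)
    rw [hT]
    ext1 v
    exact congrArg (fun A => A v) this
  have h1 := mfderiv_chart_real hc hxc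
  have h2 := mfderiv_chart_real he hx
  rw [h2, h1, ← hTc]
  change _ = _
  ext v
  have := congrArg (fun A => A (fun i => chartDeriv c x (v i))) hfin
  exact congrArg (fun t => (Complex.I / (2 * Real.pi)) • t) this

end ExpectedForm

/-! ### Regular values of random linear combinations -/

section Regular

open Set Filter Topology MeasureTheory Function

variable {m n k : ℕ}

/-- The `k` linear combinations `∑_j C_{ij} φ_j`. -/
def combo (C : Fin k → Fin n → ℂ) (φ : Fin n → (Fin m → ℂ) → ℂ) (z : Fin m → ℂ) (i : Fin k) : ℂ :=
  ∑ j, C i j * φ j z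

/-- The `k` linear combinations `∑_j C_{ij} D_j` of linear forms. -/
def rowForm (C : Fin k → Fin n → ℂ) (D : Fin n → (Fin m → ℂ) →L[ℂ] ℂ) (i : Fin k) :
    (Fin m → ℂ) →L[ℂ] ℂ :=
  ∑ j, C i j • D j

theorem rowForm_apply (C : Fin k → Fin n → ℂ) (D : Fin n → (Fin m → ℂ) →L[ℂ] ℂ) (i : Fin k)
    (v : Fin m → ℂ) : rowForm C D i v = ∑ j, C i j * D j v := by
  simp [rowForm, sum_apply]

theorem hasFDerivAt_combo (C : Fin k → Fin n → ℂ) {φ : Fin n → (Fin m → ℂ) → ℂ} {z : Fin m → ℂ}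
    (hφ : ∀ j, DifferentiableAt ℂ (φ j) z) :
    HasFDerivAt (combo C φ) (ContinuousLinearMap.pi (rowForm C fun j => fderiv ℂ (φ j) z)) z := by
  rw [hasFDerivAt_pi]
  intro i
  exact HasFDerivAt.fun_sum fun j _ => (hφ j).hasFDerivAt.const_mul (C i j)

/-- For almost all matrices `C`, zero is a regular value of `∑_j C_{ij} φ_j`, if one of the `φ_j`
is the constant `1`. -/
theorem ae_surjective_fderiv_combo {U : Set (Fin m → ℂ)} (hU : IsOpen U)
    {φ : Fin n → (Fin m → ℂ) → ℂ} (hφ : ∀ j, ContDiffOn ℂ ω (φ j) U) {j₀ : Fin n}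
    (hj₀ : ∀ z ∈ U, φ j₀ z = 1) :
    ∀ᵐ C : Fin k → Fin n → ℂ, ∀ z ∈ U, combo C φ z = 0 →
      Surjective (fderiv ℂ (combo C φ) z) := by
  -- For each `z`, `G(·, z)` projects onto the matrices annihilating `φ(z)`, and `G(C, z) = C` when
  -- `Cφ(z) = 0`. Thus `G` parametrizes the incidence variety by an open set in a vector space, and
  -- a bad `C` is a critical value of `G`.
  let G : (Fin k → Fin n → ℂ) × (Fin m → ℂ) → Fin k → Fin n → ℂ :=
    fun p i j => p.1 i j - combo p.1 φ p.2 i * (if j = j₀ then 1 else 0)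
  have hV : IsOpen ((univ : Set (Fin k → Fin n → ℂ)) ×ˢ U) := isOpen_univ.prod hU
  have hG : ContDiffOn ℂ ω G (univ ×ˢ U) := by
    rw [contDiffOn_pi]
    intro i
    rw [contDiffOn_pi]
    intro j
    refine ContDiffOn.sub (by fun_prop) (ContDiffOn.mul ?_ contDiffOn_const)
    refine ContDiffOn.sum fun l _ => ContDiffOn.mul (by fun_prop) ?_
    exact (hφ l).comp contDiffOn_snd fun p hp => hp.2
  have : (volume : Measure (Fin k → Fin n → ℂ)).IsAddHaarMeasure :=
    Measure.pi.isAddHaarMeasure fun _ : Fin k => (volume : Measure (Fin n → ℂ))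
  have hnull := sard (volume : Measure (Fin k → Fin n → ℂ)) hV hG
  rw [ae_iff]
  refine measure_mono_null ?_ hnull
  intro C hC
  simp only [mem_ofPred_eq] at hC
  push Not at hC
  obtain ⟨z, hz, hC0, hns⟩ := hC
  refine ⟨(C, z), ⟨⟨mem_univ _, hz⟩, fun hs => hns ?_⟩, ?_⟩
  · have hd : ∀ j, DifferentiableAt ℂ (φ j) z := fun j =>
      ((hφ j).contDiffAt (hU.mem_nhds hz)).differentiableAt (by simp)
    have hGd : ∀ (H : Fin k → Fin n → ℂ) (v : Fin m → ℂ) (i : Fin k) (j : Fin n),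
        fderiv ℂ G (C, z) (H, v) i j = H i j -
          (combo H φ z i + fderiv ℂ (combo C φ) z v i) * (if j = j₀ then 1 else 0) := by
      intro H v i j
      rw [(hasFDerivAt_combo C hd).fderiv]
      let A : Fin n → (Fin k → Fin n → ℂ) × (Fin m → ℂ) →L[ℂ] ℂ := fun l =>
        (ContinuousLinearMap.proj (R := ℂ) (φ := fun _ : Fin n => ℂ) l).comp
          ((ContinuousLinearMap.proj (R := ℂ) (φ := fun _ : Fin k => Fin n → ℂ) i).comp
            (ContinuousLinearMap.fst ℂ (Fin k → Fin n → ℂ) (Fin m → ℂ)))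
      have hA : ∀ l, HasFDerivAt (fun p : (Fin k → Fin n → ℂ) × (Fin m → ℂ) => p.1 i l)
          (A l) (C, z) := fun l => (A l).hasFDerivAt
      have hB : ∀ l, HasFDerivAt (fun p : (Fin k → Fin n → ℂ) × (Fin m → ℂ) => φ l p.2)
          ((fderiv ℂ (φ l) z).comp (ContinuousLinearMap.snd ℂ _ _)) (C, z) :=
        fun l => (hd l).hasFDerivAt.comp (C, z) hasFDerivAt_snd
      have h1 : HasFDerivAt (fun p : (Fin k → Fin n → ℂ) × (Fin m → ℂ) => G p i j) _ (C, z) :=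
        (hA j).fun_sub ((HasFDerivAt.fun_sum fun l _ => (hA l).fun_mul (hB l)).mul_const _)
      have hGdiff : DifferentiableAt ℂ G (C, z) :=
        (hG.contDiffAt (hV.mem_nhds ⟨mem_univ _, hz⟩)).differentiableAt (by simp)
      have h2 : fderiv ℂ G (C, z) (H, v) i j =
          fderiv ℂ (fun p : (Fin k → Fin n → ℂ) × (Fin m → ℂ) => G p i j) (C, z) (H, v) := by
        have h3 := ((ContinuousLinearMap.proj (R := ℂ) (φ := fun _ : Fin n => ℂ) j).comp
          (ContinuousLinearMap.proj (R := ℂ) (φ := fun _ : Fin k => Fin n → ℂ) i)).hasFDerivAt.comp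
            (C, z) hGdiff.hasFDerivAt
        exact (congrArg (fun A => A (H, v)) h3.fderiv).symm
      rw [h2, h1.fderiv]
      simp [sum_apply, combo, rowForm_apply, Finset.sum_add_distrib, A]
      split_ifs <;> simp [mul_comm]
      ring
    -- Solve `dG(H, v) = w ⊗ e_{j₀}`. The other columns force `H = 0` there, so `Hφ(z)` is column
    -- `j₀` of `H` and cancels in that column, leaving `-d(Cφ)(v) = w`.
    intro w
    obtain ⟨⟨H, v⟩, hHv⟩ := hs fun i j => w i * (if j = j₀ then 1 else 0)
    have hHj : ∀ i j, j ≠ j₀ → H i j = 0 := by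
      intro i j hj
      have := congrFun (congrFun hHv i) j
      rw [hGd] at this
      simpa [hj] using this
    have hcombo : ∀ i, combo H φ z i = H i j₀ := by
      intro i
      rw [combo, Finset.sum_eq_single j₀ (fun j _ hj => by rw [hHj i j hj, zero_mul]) (by simp),
        hj₀ z hz, mul_one]
    refine ⟨-v, ?_⟩
    funext i
    have := congrFun (congrFun hHv i) j₀
    rw [hGd, hcombo] at this
    simp only [if_true, mul_one] at this
    rw [map_neg, Pi.neg_apply, ← this]
    ring
  · funext i j
    simp [G, hC0]

/-- A holomorphic submersion is part of a holomorphic coordinate system, in which it gives the last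
coordinates. -/
theorem exists_chart_of_surjective (hkm : k ≤ m) {g : (Fin m → ℂ) → Fin k → ℂ} {z₀ : Fin m → ℂ}
    (hg : ContDiffAt ℂ ω g z₀) (hs : Surjective (fderiv ℂ g z₀)) {U : Set (Fin m → ℂ)}
    (hU : U ∈ 𝓝 z₀) :
    ∃ ψ ∈ contDiffGroupoid ω 𝓘(ℂ, Fin m → ℂ), z₀ ∈ ψ.source ∧ ψ.source ⊆ U ∧
      ∀ z, ∀ i : Fin k, ψ z ⟨m - k + i, by omega⟩ = g z i := by
  let T : (Fin m → ℂ) →ₗ[ℂ] (Fin k → ℂ) := fderiv ℂ g z₀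
  have hT : LinearMap.range T = ⊤ := LinearMap.range_eq_top.2 hs
  have hdim : Module.finrank ℂ (LinearMap.ker T) = m - k := by
    have := T.finrank_range_add_finrank_ker
    rw [hT, finrank_top] at this
    simp at this
    omega
  let κ : LinearMap.ker T ≃ₗ[ℂ] (Fin (m - k) → ℂ) :=
    LinearEquiv.ofFinrankEq _ _ (by rw [hdim]; simp)
  obtain ⟨P, hP⟩ := (LinearMap.ker T).subtype.exists_leftInverse_of_injective
    (Submodule.ker_subtype _)
  -- `ℓ` is injective on the kernel of `dg`, so `(ℓ, g)` has injective differential at `z₀`. The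
  -- components of `g` come last to match the convention for slices.
  let ℓ : (Fin m → ℂ) →L[ℂ] (Fin (m - k) → ℂ) := LinearMap.toContinuousLinearMap (κ.toLinearMap ∘ₗ P)
  have hℓ : ∀ v, fderiv ℂ g z₀ v = 0 → ℓ v = 0 → v = 0 := by
    intro v hv hlv
    have h1 : κ (P v) = 0 := hlv
    have h2 : P v = 0 := by simpa using h1
    have h3 := LinearMap.congr_fun hP ⟨v, hv⟩
    simp only [LinearMap.comp_apply, Submodule.subtype_apply, LinearMap.id_apply] at h3
    rw [h2] at h3
    exact congrArg Subtype.val h3.symm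
  let Ψ : (Fin m → ℂ) → Fin m → ℂ := fun z i =>
    if h : (i : ℕ) < m - k then ℓ z ⟨i, h⟩ else g z ⟨i - (m - k), by omega⟩
  have hΨ : ContDiffAt ℂ ω Ψ z₀ := by
    rw [contDiffAt_pi]
    intro i
    by_cases h : (i : ℕ) < m - k
    · simp only [Ψ, h, dif_pos]
      exact (contDiffAt_pi.1 ℓ.contDiff.contDiffAt) _
    · simp only [Ψ, h, dif_neg, not_false_iff]
      exact (contDiffAt_pi.1 hg) _
  have hΨd : ∀ v i, fderiv ℂ Ψ z₀ v i =
      if h : (i : ℕ) < m - k then ℓ v ⟨i, h⟩ else fderiv ℂ g z₀ v ⟨i - (m - k), by omega⟩ := by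
    intro v i
    have h1 := (hasFDerivAt_pi'.1 (hΨ.differentiableAt (by simp)).hasFDerivAt) i
    change ((ContinuousLinearMap.proj i).comp (fderiv ℂ Ψ z₀)) v = _
    by_cases h : (i : ℕ) < m - k
    · have h2 := (hasFDerivAt_pi'.1 (ℓ.hasFDerivAt (x := z₀))) ⟨i, h⟩
      have h3 : (fun z => Ψ z i) = fun z => ℓ z ⟨i, h⟩ := by
        funext z; simp only [Ψ, h, dif_pos]
      rw [h3] at h1
      rw [h1.unique h2, dif_pos h]
      rfl
    · have h2 := (hasFDerivAt_pi'.1 (hg.differentiableAt (by simp)).hasFDerivAt)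
        ⟨i - (m - k), by omega⟩
      have h3 : (fun z => Ψ z i) = fun z => g z ⟨i - (m - k), by omega⟩ := by
        funext z; simp only [Ψ, h, dif_neg, not_false_iff]
      rw [h3] at h1
      rw [h1.unique h2, dif_neg h]
      rfl
  have hinj : LinearMap.ker ((fderiv ℂ Ψ z₀ : (Fin m → ℂ) →L[ℂ] (Fin m → ℂ)) :
      (Fin m → ℂ) →ₗ[ℂ] (Fin m → ℂ)) = ⊥ := by
    rw [LinearMap.ker_eq_bot']
    intro v hv
    have hv' : ∀ i, fderiv ℂ Ψ z₀ v i = 0 := fun i => congrFun hv i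
    refine hℓ v (funext fun i => ?_) (funext fun i => ?_)
    · have := hv' ⟨m - k + i, by omega⟩
      rw [hΨd, dif_neg (by simp)] at this
      simpa using this
    · have := hv' ⟨i, by omega⟩
      rw [hΨd, dif_pos i.2] at this
      simpa using this
  let A : (Fin m → ℂ) ≃L[ℂ] (Fin m → ℂ) :=
    (LinearEquiv.ofInjectiveEndo _ (LinearMap.ker_eq_bot.1 hinj)).toContinuousLinearEquiv
  have hA : fderiv ℂ Ψ z₀ = A := by
    ext1 v
    rfl
  obtain ⟨ψ, h1, h2, h3, h4, h5⟩ := exists_openPartialHomeomorph_of_fderiv_eq_equiv hΨ A hA hU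
  refine ⟨ψ, ?_, h1, h2, fun z i => ?_⟩
  · rw [contDiffGroupoid, mem_groupoid_of_pregroupoid]
    have h4' : ContDiffOn ℂ ω ψ ψ.source := h4.congr fun z _ => h3 z
    constructor
    · simpa [contDiffPregroupoid, contDiffPregroupoid] using h4'
    · simpa [contDiffPregroupoid, contDiffPregroupoid] using h5
  · rw [h3]
    simp [Ψ]

variable {M : Type*} [TopologicalSpace M] [ChartedSpace (Fin m → ℂ) M]
  [IsManifold 𝓘(ℂ, Fin m → ℂ) ω M]

theorem trans_mem_maximalAtlas {e : OpenPartialHomeomorph M (Fin m → ℂ)}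
    (he : e ∈ IsManifold.maximalAtlas 𝓘(ℂ, Fin m → ℂ) ω M)
    {ψ : OpenPartialHomeomorph (Fin m → ℂ) (Fin m → ℂ)}
    (hψ : ψ ∈ contDiffGroupoid ω 𝓘(ℂ, Fin m → ℂ)) :
    e ≫ₕ ψ ∈ IsManifold.maximalAtlas 𝓘(ℂ, Fin m → ℂ) ω M := by
  intro e' he'
  obtain ⟨h1, h2⟩ := he e' he'
  constructor
  · rw [OpenPartialHomeomorph.trans_symm_eq_symm_trans_symm, OpenPartialHomeomorph.trans_assoc]
    exact (contDiffGroupoid ω 𝓘(ℂ, Fin m → ℂ)).trans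
      ((contDiffGroupoid ω 𝓘(ℂ, Fin m → ℂ)).symm hψ) h1
  · rw [← OpenPartialHomeomorph.trans_assoc]
    exact (contDiffGroupoid ω 𝓘(ℂ, Fin m → ℂ)).trans h2 hψ

/-- Around a regular point, the zero set of `k` holomorphic functions is a slice of dimension
`m - k`. -/
theorem exists_isSliceChart (hkm : k ≤ m) {Y : Set M} {e : OpenPartialHomeomorph M (Fin m → ℂ)}
    (he : e ∈ IsManifold.maximalAtlas 𝓘(ℂ, Fin m → ℂ) ω M) {g : (Fin m → ℂ) → Fin k → ℂ}
    (hY : ∀ y ∈ e.source, y ∈ Y ↔ g (e y) = 0) {x : M} (hx : x ∈ e.source)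
    (hg : ContDiffAt ℂ ω g (e x)) (hs : Surjective (fderiv ℂ g (e x))) :
    ∃ e' : OpenPartialHomeomorph M (Fin m → ℂ), IsSliceChart (m - k) Y e' ∧ x ∈ e'.source := by
  obtain ⟨ψ, hψ, h1, h2, h3⟩ := exists_chart_of_surjective hkm hg hs
    (e.open_target.mem_nhds (e.map_source hx))
  refine ⟨e ≫ₕ ψ, ⟨trans_mem_maximalAtlas he hψ, fun y hy => ?_⟩, ?_⟩
  · rw [OpenPartialHomeomorph.trans_source] at hy
    rw [hY y hy.1, OpenPartialHomeomorph.coe_trans, comp_apply]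
    constructor
    · intro h i hi
      have := h3 (e y) ⟨i - (m - k), by omega⟩
      simp only [Nat.add_sub_cancel' hi, Fin.eta] at this
      rw [this, h]
      rfl
    · intro h
      funext i
      rw [← h3 (e y) i, h _ (by simp)]
      rfl
  · rw [OpenPartialHomeomorph.trans_source]
    exact ⟨hx, h1⟩

end Regular

/-! ### Gaussian integrals over matrices -/

section Gaussian

open Set Filter Topology MeasureTheory ComplexConjugate

/-- The density of the standard complex Gaussian measure on `ℂ`. -/
def gaussDensity (c : ℂ) : ℝ := Real.pi⁻¹ * Real.exp (-‖c‖ ^ 2)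

theorem gaussDensity_pos (c : ℂ) : 0 < gaussDensity c := by
  have := Real.pi_pos
  unfold gaussDensity; positivity

theorem continuous_gaussDensity : Continuous gaussDensity := by
  unfold gaussDensity; fun_prop

theorem integral_norm_pow_mul_gaussDensity (q : ℕ) :
    ∫ c : ℂ, ‖c‖ ^ q * gaussDensity c = Real.Gamma ((q + 2) / 2) := by
  have h := Complex.integral_rpow_mul_exp_neg_rpow (p := 2) (q := q) (by norm_num)
    (by have := Nat.cast_nonneg (α := ℝ) q; linarith)
  have h2 : (fun c : ℂ => ‖c‖ ^ q * gaussDensity c) = fun c =>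
      Real.pi⁻¹ * (‖c‖ ^ (q : ℝ) * Real.exp (-‖c‖ ^ (2 : ℝ))) := by
    funext c
    rw [gaussDensity, Real.rpow_natCast, Real.rpow_two]
    ring
  rw [h2, integral_const_mul, h]
  have := Real.pi_ne_zero
  field_simp

theorem integrable_norm_pow_mul_gaussDensity (q : ℕ) :
    Integrable fun c : ℂ => ‖c‖ ^ q * gaussDensity c := by
  -- A nonintegrable function has integral `0` by convention, so the positive Gamma value already
  -- certifies integrability.
  refine Integrable.of_integral_ne_zero ?_
  rw [integral_norm_pow_mul_gaussDensity]
  exact (Real.Gamma_pos_of_pos (by positivity)).ne'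

theorem integrable_gaussDensity_mul {g : ℂ → ℂ} (hg : Continuous g) {q : ℕ}
    (hgq : ∀ c, ‖g c‖ ≤ ‖c‖ ^ q) : Integrable fun c : ℂ => (gaussDensity c : ℂ) * g c := by
  refine (integrable_norm_pow_mul_gaussDensity q).mono' ?_ ?_
  · exact ((Complex.continuous_ofReal.comp continuous_gaussDensity).mul hg).aestronglyMeasurable
  · refine Eventually.of_forall fun c => ?_
    rw [norm_mul, Complex.norm_real, Real.norm_of_nonneg (gaussDensity_pos c).le, mul_comm]
    exact mul_le_mul_of_nonneg_right (hgq c) (gaussDensity_pos c).le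

theorem integral_gaussDensity : ∫ c : ℂ, (gaussDensity c : ℂ) = 1 := by
  have := integral_norm_pow_mul_gaussDensity 0
  simp only [pow_zero, one_mul, Nat.cast_zero, zero_add] at this
  rw [integral_complex_ofReal, this]
  norm_num

theorem integral_gaussDensity_mul_self_mul_conj :
    ∫ c : ℂ, (gaussDensity c : ℂ) * (c * conj c) = 1 := by
  have := integral_norm_pow_mul_gaussDensity 2
  have h2 : (fun c : ℂ => (gaussDensity c : ℂ) * (c * conj c)) =
      fun c => ((‖c‖ ^ 2 * gaussDensity c : ℝ) : ℂ) := by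
    funext c
    rw [Complex.mul_conj']; push_cast; ring
  rw [h2, integral_complex_ofReal, this]
  norm_num

theorem integral_gaussDensity_mul_odd {g : ℂ → ℂ} (hg : ∀ c, g (-c) = -g c) :
    ∫ c : ℂ, (gaussDensity c : ℂ) * g c = 0 := by
  have h := integral_neg_eq_self (fun c : ℂ => (gaussDensity c : ℂ) * g c) volume
  simp only [hg, gaussDensity, norm_neg, mul_neg, integral_neg] at h ⊢
  exact self_eq_neg.1 h.symm

variable {n k : ℕ}

/-- The density of the standard complex Gaussian measure on `k × n` matrices. -/
def gaussWeight (C : Fin k → Fin n → ℂ) : ℝ := ∏ i, ∏ j, gaussDensity (C i j)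

theorem gaussWeight_pos (C : Fin k → Fin n → ℂ) : 0 < gaussWeight C :=
  Finset.prod_pos fun _ _ => Finset.prod_pos fun _ _ => gaussDensity_pos _

theorem continuous_gaussWeight : Continuous (gaussWeight (k := k) (n := n)) :=
  continuous_finsetProd _ fun i _ => continuous_finsetProd _ fun j _ =>
    continuous_gaussDensity.comp (by fun_prop)

theorem gaussWeight_eq_exp (C : Fin k → Fin n → ℂ) :
    gaussWeight C = (Real.pi ^ (k * n))⁻¹ * Real.exp (-∑ i, ∑ j, ‖C i j‖ ^ 2) := by
  simp only [gaussWeight, gaussDensity, Finset.prod_mul_distrib, Finset.prod_const,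
    Finset.card_univ, Fintype.card_fin, ← Real.exp_sum, Finset.sum_neg_distrib]
  rw [← pow_mul, inv_pow, mul_comm n k]

/-- The integrand is a product over the entries, which are independent, centred and of variance `1`.
If `J i ≠ J' i`, entry `(i, J i)` occurs without its conjugate and contributes a zero mean. -/
theorem integrable_and_integral_gaussWeight_mul_monomial (J J' : Fin k → Fin n) :
    Integrable (fun C : Fin k → Fin n → ℂ =>
      (gaussWeight C : ℂ) * ∏ i, (C i (J i) * conj (C i (J' i)))) ∧
    ∫ C : Fin k → Fin n → ℂ, (gaussWeight C : ℂ) * ∏ i, (C i (J i) * conj (C i (J' i))) =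
      if J = J' then 1 else 0 := by
  let g : Fin k → Fin n → ℂ → ℂ := fun i j c => (gaussDensity c : ℂ) *
    ((if j = J i then c else 1) * (if j = J' i then conj c else 1))
  have hg : (fun C : Fin k → Fin n → ℂ =>
      (gaussWeight C : ℂ) * ∏ i, (C i (J i) * conj (C i (J' i)))) =
      fun C => ∏ i, ∏ j, g i j (C i j) := by
    funext C
    rw [gaussWeight, Complex.ofReal_prod, ← Finset.prod_mul_distrib]
    refine Finset.prod_congr rfl fun i _ => ?_
    simp only [g]
    rw [Complex.ofReal_prod, Finset.prod_mul_distrib, Finset.prod_mul_distrib, Finset.prod_ite_eq',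
      Finset.prod_ite_eq']
    simp
  have hgi : ∀ i j, Integrable (g i j) := by
    intro i j
    by_cases h1 : j = J i <;> by_cases h2 : j = J' i
    · simp only [g, if_pos h1, if_pos h2]
      exact integrable_gaussDensity_mul (q := 2) (by fun_prop) fun c => by simp [sq]
    · simp only [g, if_pos h1, if_neg h2]
      exact integrable_gaussDensity_mul (q := 1) (by fun_prop) fun c => by simp
    · simp only [g, if_neg h1, if_pos h2]
      exact integrable_gaussDensity_mul (q := 1) (by fun_prop) fun c => by simp
    · simp only [g, if_neg h1, if_neg h2]
      exact integrable_gaussDensity_mul (q := 0) (by fun_prop) fun c => by simp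
  have hgint : ∀ i j, ∫ c, g i j c = if (j = J i ↔ j = J' i) then 1 else 0 := by
    intro i j
    by_cases h1 : j = J i <;> by_cases h2 : j = J' i
    · rw [if_pos (by tauto)]
      simp only [g, if_pos h1, if_pos h2]
      exact integral_gaussDensity_mul_self_mul_conj
    · rw [if_neg (by tauto)]
      simp only [g, if_pos h1, if_neg h2]
      exact integral_gaussDensity_mul_odd fun c => by simp
    · rw [if_neg (by tauto)]
      simp only [g, if_neg h1, if_pos h2]
      exact integral_gaussDensity_mul_odd fun c => by simp
    · rw [if_pos (by tauto)]
      simp only [g, if_neg h1, if_neg h2, mul_one]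
      exact integral_gaussDensity
  rw [hg]
  constructor
  · exact Integrable.fintype_prod (f := fun i (c : Fin n → ℂ) => ∏ j, g i j (c j)) fun i =>
      Integrable.fintype_prod (f := fun j => g i j) fun j => hgi i j
  · rw [integral_fintype_prod_volume_eq_prod (fun i (c : Fin n → ℂ) => ∏ j, g i j (c j))]
    simp only [integral_fintype_prod_volume_eq_prod (fun j => g _ j), hgint]
    split_ifs with h
    · subst h; simp
    · obtain ⟨i, hi⟩ : ∃ i, J i ≠ J' i := by
        by_contra! h'; exact h (funext h')
      refine Finset.prod_eq_zero (Finset.mem_univ i)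
        (Finset.prod_eq_zero (Finset.mem_univ (J i)) ?_)
      simp [hi]

theorem integral_gaussWeight : ∫ C : Fin k → Fin n → ℂ, gaussWeight C = 1 := by
  have h : (fun C : Fin k → Fin n → ℂ => gaussWeight C) = fun C => ∏ i, ∏ j, gaussDensity (C i j) := rfl
  have h1 : ∫ c : ℂ, gaussDensity c = 1 := by
    have := integral_gaussDensity
    rw [integral_complex_ofReal] at this
    exact_mod_cast this
  rw [h, integral_fintype_prod_volume_eq_prod (fun _ (c : Fin n → ℂ) => ∏ j, gaussDensity (c j))]
  simp only [integral_fintype_prod_volume_eq_prod (fun _ : Fin n => gaussDensity), h1]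
  simp

theorem integrable_gaussWeight : Integrable (gaussWeight (k := k) (n := n)) :=
  Integrable.of_integral_ne_zero (by rw [integral_gaussWeight]; exact one_ne_zero)

variable {m : ℕ}

/-- The squared norm of the determinant of the forms `∑_j C_{ij} A_j` and `α_l`. -/
def comboDetSq (A : Fin n → (Fin m → ℂ) →L[ℂ] ℂ) (α : Fin (m - k) → (Fin m → ℂ) →L[ℂ] ℂ)
    (C : Fin k → Fin n → ℂ) : ℝ :=
  ‖(formMatrix (joinFam (rowForm C A) α)).det‖ ^ 2

theorem comboDetSq_nonneg (A : Fin n → (Fin m → ℂ) →L[ℂ] ℂ)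
    (α : Fin (m - k) → (Fin m → ℂ) →L[ℂ] ℂ) (C : Fin k → Fin n → ℂ) : 0 ≤ comboDetSq A α C :=
  sq_nonneg _

/-- The determinant of linear forms as a multilinear map. -/
def formDet (m : ℕ) : MultilinearMap ℂ (fun _ : Fin m => (Fin m → ℂ) →L[ℂ] ℂ) ℂ :=
  (Matrix.detRowAlternating (n := Fin m) (R := ℂ)).toMultilinearMap.compLinearMap fun _ =>
    { toFun := fun γ l => γ (Pi.single l 1)
      map_add' := fun _ _ => rfl
      map_smul' := fun _ _ => rfl }

theorem formDet_apply (γ : Fin m → (Fin m → ℂ) →L[ℂ] ℂ) : formDet m γ = (formMatrix γ).det := by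
  rw [← Matrix.det_transpose]
  rfl

/-- Multilinearity of the determinant in its first `k` arguments; `currySum` freezes the remaining
ones. -/
theorem det_joinFam_rowForm (hk : k ≤ m) (A : Fin n → (Fin m → ℂ) →L[ℂ] ℂ)
    (α : Fin (m - k) → (Fin m → ℂ) →L[ℂ] ℂ) (C : Fin k → Fin n → ℂ) :
    (formMatrix (joinFam (rowForm C A) α)).det =
      ∑ J : Fin k → Fin n, (∏ i, C i (J i)) *
        (formMatrix (joinFam (fun i => A (J i)) α)).det := by
  obtain ⟨d, rfl⟩ := Nat.exists_eq_add_of_le hk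
  have hα : ∀ l : Fin d, (l : ℕ) < k + d - k := fun l => by omega
  have hj : ∀ β : Fin k → ((Fin (k + d) → ℂ) →L[ℂ] ℂ), joinFam β α =
      fun i => (Sum.rec β fun l : Fin d => α ⟨l, hα l⟩ : Fin k ⊕ Fin d → _)
        (finSumFinEquiv.symm i) := by
    intro β
    funext i
    refine Fin.addCases (fun i => ?_) (fun i => ?_) i
    · simp [joinFam]
    · simp [joinFam]
  let T := ((formDet (k + d)).domDomCongr (finSumFinEquiv (m := k) (n := d)).symm).currySum
  have hT : ∀ β : Fin k → ((Fin (k + d) → ℂ) →L[ℂ] ℂ),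
      T β (fun l => α ⟨l, hα l⟩) = (formMatrix (joinFam β α)).det := by
    intro β
    rw [← formDet_apply, hj]
    rfl
  rw [← hT]
  have h1 : T (rowForm C A) = ∑ J : Fin k → Fin n, (∏ i, C i (J i)) • T fun i => A (J i) := by
    have : rowForm C A = fun i => ∑ j, C i j • A j := rfl
    rw [this, MultilinearMap.map_sum]
    refine Finset.sum_congr rfl fun J _ => ?_
    rw [MultilinearMap.map_smul_univ]
  rw [h1, sum_apply]
  refine Finset.sum_congr rfl fun J _ => ?_
  rw [← hT]
  rfl

theorem comboDetSq_eq_sum (hk : k ≤ m) (A : Fin n → (Fin m → ℂ) →L[ℂ] ℂ)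
    (α : Fin (m - k) → (Fin m → ℂ) →L[ℂ] ℂ) (C : Fin k → Fin n → ℂ) :
    (comboDetSq A α C : ℂ) = ∑ J : Fin k → Fin n, ∑ J' : Fin k → Fin n,
      ((formMatrix (joinFam (fun i => A (J i)) α)).det *
        conj (formMatrix (joinFam (fun i => A (J' i)) α)).det) *
      ∏ i, (C i (J i) * conj (C i (J' i))) := by
  rw [comboDetSq, Complex.ofReal_pow, ← Complex.mul_conj', det_joinFam_rowForm hk, map_sum,
    Finset.sum_mul_sum]
  refine Finset.sum_congr rfl fun J _ => Finset.sum_congr rfl fun J' _ => ?_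
  rw [Finset.prod_mul_distrib, map_mul, map_prod]
  ring

/-- In the double sum for the squared determinant only the terms with `J = J'` have nonzero mean. -/
theorem integrable_and_integral_gaussWeight_mul_comboDetSq (hk : k ≤ m)
    (A : Fin n → (Fin m → ℂ) →L[ℂ] ℂ) (α : Fin (m - k) → (Fin m → ℂ) →L[ℂ] ℂ) :
    Integrable (fun C : Fin k → Fin n → ℂ => gaussWeight C * comboDetSq A α C) ∧
    ∫ C : Fin k → Fin n → ℂ, gaussWeight C * comboDetSq A α C =
      ∑ J : Fin k → Fin n, ‖(formMatrix (joinFam (fun i => A (J i)) α)).det‖ ^ 2 := by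
  let d : (Fin k → Fin n) → ℂ := fun J => (formMatrix (joinFam (fun i => A (J i)) α)).det
  have h1 : (fun C : Fin k → Fin n → ℂ => ((gaussWeight C * comboDetSq A α C : ℝ) : ℂ)) =
      fun C => ∑ J : Fin k → Fin n, ∑ J' : Fin k → Fin n, (d J * conj (d J')) *
        ((gaussWeight C : ℂ) * ∏ i, (C i (J i) * conj (C i (J' i)))) := by
    funext C
    rw [Complex.ofReal_mul, comboDetSq_eq_sum hk, Finset.mul_sum]
    refine Finset.sum_congr rfl fun J _ => ?_
    rw [Finset.mul_sum]
    refine Finset.sum_congr rfl fun J' _ => ?_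
    ring
  have hi : ∀ J J' : Fin k → Fin n, Integrable fun C : Fin k → Fin n → ℂ => (d J * conj (d J')) *
      ((gaussWeight C : ℂ) * ∏ i, (C i (J i) * conj (C i (J' i)))) := fun J J' =>
    (integrable_and_integral_gaussWeight_mul_monomial J J').1.const_mul _
  have hInt : Integrable (fun C : Fin k → Fin n → ℂ =>
      ((gaussWeight C * comboDetSq A α C : ℝ) : ℂ)) := by
    rw [h1]
    exact integrable_finsetSum _ fun J _ => integrable_finsetSum _ fun J' _ => hi J J'
  refine ⟨hInt.re, ?_⟩
  have h2 : ∫ C : Fin k → Fin n → ℂ, ((gaussWeight C * comboDetSq A α C : ℝ) : ℂ) =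
      ((∑ J : Fin k → Fin n, ‖d J‖ ^ 2 : ℝ) : ℂ) := by
    rw [h1, integral_finsetSum _ fun J _ => integrable_finsetSum _ fun J' _ => hi J J']
    push_cast
    refine Finset.sum_congr rfl fun J _ => ?_
    rw [integral_finsetSum _ fun J' _ => hi J J']
    simp only [integral_const_mul, (integrable_and_integral_gaussWeight_mul_monomial _ _).2]
    simp [Complex.mul_conj']
  rw [integral_complex_ofReal] at h2
  exact_mod_cast h2

end Gaussian

/-! ### Conditioning a Gaussian matrix on a linear equation -/

section Conditioning

open Set Filter Topology MeasureTheory ComplexConjugate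

variable {m n k : ℕ}

theorem continuousOn_comboDetSq {X : Type*} [TopologicalSpace X] {s : Set X}
    {D : X → Fin n → (Fin m → ℂ) →L[ℂ] ℂ} {C : X → Fin k → Fin n → ℂ} (hD : ContinuousOn D s)
    (hC : ContinuousOn C s) (α : Fin (m - k) → (Fin m → ℂ) →L[ℂ] ℂ) :
    ContinuousOn (fun x => comboDetSq (D x) α (C x)) s := by
  have h : ContinuousOn (fun x => formMatrix (joinFam (rowForm (C x) (D x)) α)) s := by
    refine continuousOn_pi.2 fun l => continuousOn_pi.2 fun i => ?_
    simp only [formMatrix, Matrix.of_apply, joinFam]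
    by_cases hi : (i : ℕ) < k
    · simp only [hi, dif_pos, rowForm_apply]
      refine continuousOn_finsetSum _ fun j _ => ContinuousOn.mul ?_ ?_
      · exact continuousOn_pi.1 (continuousOn_pi.1 hC _) _
      · exact (continuousOn_pi.1 hD j).clm_apply continuousOn_const
    · simp only [hi, dif_neg, not_false_iff]
      exact continuousOn_const
  exact ((continuous_id.matrix_det.comp_continuousOn h).norm).pow 2

theorem continuous_comboDetSq (A : Fin n → (Fin m → ℂ) →L[ℂ] ℂ)
    (α : Fin (m - k) → (Fin m → ℂ) →L[ℂ] ℂ) : Continuous (comboDetSq A α) :=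
  continuousOn_univ.1 (continuousOn_comboDetSq continuousOn_const continuousOn_id α)

/-- Subtract `τ` from the column `j₀` of `C`. -/
def shiftCol (j₀ : Fin n) (C : Fin k → Fin n → ℂ) (τ : Fin k → ℂ) : Fin k → Fin n → ℂ :=
  fun i j => C i j - τ i * (if j = j₀ then 1 else 0)

/-- The matrix of the linear map `x ↦ x - (x ⬝ φ) (e_{j₀} - φ̄ / |φ|)`. -/
def tiltMatrix (j₀ : Fin n) (φ : Fin n → ℂ) : Matrix (Fin n) (Fin n) ℂ :=
  1 + Matrix.replicateCol Unit (fun j => conj (φ j) / ((√(∑ l, ‖φ l‖ ^ 2) : ℝ) : ℂ) -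
    (if j = j₀ then 1 else 0)) * Matrix.replicateRow Unit φ

theorem tiltMatrix_mulVec (j₀ : Fin n) (φ : Fin n → ℂ) (x : Fin n → ℂ) (j : Fin n) :
    (tiltMatrix j₀ φ).mulVec x j = x j + (∑ l, x l * φ l) *
      (conj (φ j) / ((√(∑ l, ‖φ l‖ ^ 2) : ℝ) : ℂ) - (if j = j₀ then 1 else 0)) := by
  rw [tiltMatrix, Matrix.add_mulVec, Matrix.one_mulVec, Pi.add_apply, ← Matrix.mulVec_mulVec]
  congr 1
  simp [Matrix.mulVec, dotProduct]
  rw [mul_comm]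
  congr 1
  exact Finset.sum_congr rfl fun l _ => mul_comm _ _

variable {φ : Fin n → ℂ} {j₀ : Fin n}

theorem sum_norm_sq_pos (hφ : φ j₀ = 1) : 0 < ∑ l, ‖φ l‖ ^ 2 :=
  Finset.sum_pos' (fun _ _ => by positivity) ⟨j₀, Finset.mem_univ _, by simp [hφ]⟩

/-- The matrix is a rank-one perturbation of the identity, and `1 + φ ⬝ (φ̄/|φ| - e_{j₀}) = |φ|`
since `φ_{j₀} = 1`. -/
theorem det_tiltMatrix (hφ : φ j₀ = 1) :
    (tiltMatrix j₀ φ).det = ((√(∑ l, ‖φ l‖ ^ 2) : ℝ) : ℂ) := by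
  have hN := sum_norm_sq_pos hφ
  rw [tiltMatrix, Matrix.det_one_add_replicateCol_mul_replicateRow]
  have h1 : φ ⬝ᵥ (fun j => conj (φ j) / ((√(∑ l, ‖φ l‖ ^ 2) : ℝ) : ℂ) -
      (if j = j₀ then 1 else 0)) =
      ((∑ l, ‖φ l‖ ^ 2 : ℝ) : ℂ) / ((√(∑ l, ‖φ l‖ ^ 2) : ℝ) : ℂ) - 1 := by
    simp only [dotProduct, mul_sub, Finset.sum_sub_distrib, mul_div_assoc', ← Finset.sum_div,
      Complex.mul_conj']
    simp [hφ]
  rw [h1, ← Complex.ofReal_div, Real.div_sqrt]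
  ring

/-- The linear map on matrices that acts on rows as `x ↦ x - (x ⬝ φ) (e_{j₀} - φ̄ / |φ|)`. -/
def tilt (k : ℕ) (j₀ : Fin n) (φ : Fin n → ℂ) :
    (Fin k → Fin n → ℂ) →ₗ[ℂ] (Fin k → Fin n → ℂ) :=
  LinearMap.pi fun i => (tiltMatrix j₀ φ).mulVecLin.comp (LinearMap.proj i)

theorem tilt_apply (C : Fin k → Fin n → ℂ) (i : Fin k) (j : Fin n) :
    tilt k j₀ φ C i j = C i j + (∑ l, C i l * φ l) *
      (conj (φ j) / ((√(∑ l, ‖φ l‖ ^ 2) : ℝ) : ℂ) - (if j = j₀ then 1 else 0)) :=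
  tiltMatrix_mulVec j₀ φ (C i) j

theorem det_tilt_real (hφ : φ j₀ = 1) :
    LinearMap.det ((tilt k j₀ φ).restrictScalars ℝ) = (∑ l, ‖φ l‖ ^ 2) ^ k := by
  rw [LinearMap.det_restrictScalars, Algebra.norm_complex_eq, tilt, LinearMap.det_pi]
  simp only [← Matrix.toLin'_apply', LinearMap.det_toLin', det_tiltMatrix hφ, Finset.prod_const,
    Finset.card_univ, Fintype.card_fin]
  change Complex.normSq _ = _
  rw [map_pow, Complex.normSq_ofReal, Real.mul_self_sqrt (sum_norm_sq_pos hφ).le]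

/-- Write a row as `c₀ + τ e_{j₀}` with `c₀ ⬝ φ = 0`. Tilting replaces `τ e_{j₀}` by `τ φ̄/|φ|`,
which has length `|τ|` and is orthogonal to `c₀`. By Pythagoras the two exponents agree; the `k`
extra densities contribute `π^{-k}`. -/
theorem gaussWeight_tilt (hφ : φ j₀ = 1) (C : Fin k → Fin n → ℂ) :
    gaussWeight (shiftCol j₀ C fun i => ∑ l, C i l * φ l) *
      ∏ i, gaussDensity (∑ l, C i l * φ l) =
    (Real.pi ^ k)⁻¹ * gaussWeight (tilt k j₀ φ C) := by
  have hN := sum_norm_sq_pos hφ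
  have key : ∀ i, ∑ j, ‖tilt k j₀ φ C i j‖ ^ 2 =
      ∑ j, ‖shiftCol j₀ C (fun i => ∑ l, C i l * φ l) i j‖ ^ 2 + ‖∑ l, C i l * φ l‖ ^ 2 := by
    intro i
    set τ := ∑ l, C i l * φ l with hτ
    set N := ∑ l, ‖φ l‖ ^ 2
    have hs : ((√N : ℝ) : ℂ) ^ 2 = (N : ℂ) := by
      rw [← Complex.ofReal_pow, Real.sq_sqrt hN.le]
    have hs0 : ((√N : ℝ) : ℂ) ≠ 0 := by exact_mod_cast (Real.sqrt_pos.2 hN).ne'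
    let c0 : Fin n → ℂ := fun j => C i j - τ * (if j = j₀ then 1 else 0)
    have h1 : ∀ j, tilt k j₀ φ C i j = c0 j + τ * (conj (φ j) / ((√N : ℝ) : ℂ)) := by
      intro j; rw [tilt_apply]; simp only [c0]; ring
    have h0 : ∑ j, c0 j * φ j = 0 := by
      simp only [c0, sub_mul, Finset.sum_sub_distrib]
      rw [← hτ]
      simp [hφ]
    have h0' : ∑ j, conj (c0 j) * conj (φ j) = 0 := by
      have := congrArg conj h0
      simpa using this
    have hc : ((∑ j, ‖tilt k j₀ φ C i j‖ ^ 2 : ℝ) : ℂ) =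
        ((∑ j, ‖c0 j‖ ^ 2 + ‖τ‖ ^ 2 : ℝ) : ℂ) := by
      push_cast
      simp only [h1, ← Complex.mul_conj', map_add, map_mul, map_div₀, Complex.conj_conj,
        Complex.conj_ofReal]
      have e1 : ∀ j, (c0 j + τ * (conj (φ j) / ((√N : ℝ) : ℂ))) *
          (conj (c0 j) + conj τ * (φ j / ((√N : ℝ) : ℂ))) =
          c0 j * conj (c0 j) + (c0 j * φ j) * (conj τ / ((√N : ℝ) : ℂ)) +
          (conj (c0 j) * conj (φ j)) * (τ / ((√N : ℝ) : ℂ)) +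
          (φ j * conj (φ j)) * (τ * conj τ / (N : ℂ)) := by
        intro j
        rw [← hs]
        field_simp
        ring
      rw [Finset.sum_congr rfl fun j _ => e1 j, Finset.sum_add_distrib, Finset.sum_add_distrib,
        Finset.sum_add_distrib, ← Finset.sum_mul, ← Finset.sum_mul, ← Finset.sum_mul, h0, h0']
      have e2 : (∑ j, φ j * conj (φ j)) = (N : ℂ) := by
        simp [N, Complex.mul_conj']
      have hN0 : (N : ℂ) ≠ 0 := by exact_mod_cast hN.ne'
      rw [e2]
      field_simp
      ring
    exact_mod_cast hc
  simp only [gaussWeight_eq_exp, gaussDensity, Finset.prod_mul_distrib, Finset.prod_const,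
    Finset.card_univ, Fintype.card_fin, ← Real.exp_sum, key, Finset.sum_add_distrib, neg_add,
    Real.exp_add, Finset.sum_neg_distrib]
  rw [inv_pow]
  ring

/-- The vector `φ̄` pairs to zero with the projected forms. Since `D j₀ = 0`, the `e_{j₀}`-part of
the tilt puts back exactly the term that the projection removes from `C D`, so only the
normalization `1/|φ|` is left. -/
theorem rowForm_tilt (hφ : φ j₀ = 1) {D : Fin n → (Fin m → ℂ) →L[ℂ] ℂ} (hD : D j₀ = 0)
    (C : Fin k → Fin n → ℂ) (i : Fin k) :
    rowForm (tilt k j₀ φ C) (projForm φ D) i =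
      (((√(∑ l, ‖φ l‖ ^ 2) : ℝ) : ℂ)⁻¹) • rowForm C D i := by
  have hN := sum_norm_sq_pos hφ
  ext1 v
  simp only [rowForm_apply, tilt_apply, projForm_apply, smul_apply, smul_eq_mul]
  have e2 : (∑ j, conj (φ j) * φ j) = ((∑ l, ‖φ l‖ ^ 2 : ℝ) : ℂ) := by
    simp [Complex.conj_mul']
  set N := ∑ l, ‖φ l‖ ^ 2
  set s : ℂ := ((√N : ℝ) : ℂ)
  have hs0 : s ≠ 0 := by simp only [s]; exact_mod_cast (Real.sqrt_pos.2 hN).ne'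
  have hN0 : (N : ℂ) ≠ 0 := by exact_mod_cast hN.ne'
  set a := ∑ l, conj (φ l) * D l v with ha
  set τ := ∑ l, C i l * φ l with hτ
  have e1 : ∀ j, (C i j + τ * (conj (φ j) / s - (if j = j₀ then 1 else 0))) *
      (s⁻¹ * (D j v - φ j / (N : ℂ) * a)) =
      s⁻¹ * (C i j * D j v) - (C i j * φ j) * (s⁻¹ * a / N) + (conj (φ j) * D j v) * (τ / s * s⁻¹) -
      (conj (φ j) * φ j) * (τ / s * s⁻¹ * a / N) -
      (if j = j₀ then τ * (s⁻¹ * (D j v - φ j / (N : ℂ) * a)) else 0) := by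
    intro j
    split_ifs <;> ring
  rw [Finset.sum_congr rfl fun j _ => e1 j]
  simp only [Finset.sum_add_distrib, Finset.sum_sub_distrib, ← Finset.sum_mul, ← Finset.mul_sum]
  rw [← ha, ← hτ, e2]
  simp [hφ, hD]
  field_simp
  ring

theorem comboDetSq_tilt (hkm : k ≤ m) (hφ : φ j₀ = 1) {D : Fin n → (Fin m → ℂ) →L[ℂ] ℂ}
    (hD : D j₀ = 0) (α : Fin (m - k) → (Fin m → ℂ) →L[ℂ] ℂ) (C : Fin k → Fin n → ℂ) :
    comboDetSq D α C = (∑ l, ‖φ l‖ ^ 2) ^ k * comboDetSq (projForm φ D) α (tilt k j₀ φ C) := by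
  have hN := sum_norm_sq_pos hφ
  let s : ℂ := (((√(∑ l, ‖φ l‖ ^ 2) : ℝ) : ℂ)⁻¹)
  have h1 : formDet m (joinFam (rowForm (tilt k j₀ φ C) (projForm φ D)) α) =
      s ^ k * formDet m (joinFam (rowForm C D) α) := by
    have h2 : joinFam (rowForm (tilt k j₀ φ C) (projForm φ D)) α =
        fun i : Fin m => (if (i : ℕ) < k then s else 1) • joinFam (rowForm C D) α i := by
      funext i
      by_cases hi : (i : ℕ) < k
      · simp only [joinFam, hi, dif_pos, if_true, rowForm_tilt hφ hD, s]
      · simp only [joinFam, hi, dif_neg, not_false_iff, if_false, one_smul]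
    rw [h2, MultilinearMap.map_smul_univ, smul_eq_mul]
    congr 1
    rw [Finset.prod_ite, Finset.prod_const, Finset.prod_const_one, mul_one]
    congr 1
    have : (Finset.univ.filter fun i : Fin m => (i : ℕ) < k).card = k := by
      rw [Fin.card_filter_val_lt]; omega
    exact this
  rw [comboDetSq, comboDetSq, ← formDet_apply, ← formDet_apply, h1, norm_mul, mul_pow, norm_pow]
  simp only [s]
  rw [norm_inv, Complex.norm_real, Real.norm_of_nonneg (Real.sqrt_nonneg _), ← pow_mul,
    mul_comm k 2, pow_mul, inv_pow, Real.sq_sqrt hN.le, ← mul_assoc, ← mul_pow,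
    mul_inv_cancel₀ hN.ne', one_pow, one_mul]

/-- The inner integral of Kac–Rice, at fixed `z`. The real Jacobian `|φ|^(2k)` of the tilt cancels
the factor from `comboDetSq_tilt`, and a plain Gaussian second moment remains. -/
theorem integrable_and_integral_shiftCol (hkm : k ≤ m) (hφ : φ j₀ = 1)
    {D : Fin n → (Fin m → ℂ) →L[ℂ] ℂ} (hD : D j₀ = 0) (α : Fin (m - k) → (Fin m → ℂ) →L[ℂ] ℂ) :
    Integrable (fun C : Fin k → Fin n → ℂ =>
      gaussWeight (shiftCol j₀ C fun i => ∑ l, C i l * φ l) *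
        (∏ i, gaussDensity (∑ l, C i l * φ l)) * comboDetSq D α C) ∧
    ∫ C : Fin k → Fin n → ℂ, gaussWeight (shiftCol j₀ C fun i => ∑ l, C i l * φ l) *
        (∏ i, gaussDensity (∑ l, C i l * φ l)) * comboDetSq D α C =
      (Real.pi ^ k)⁻¹ * ∑ J : Fin k → Fin n,
        ‖(formMatrix (joinFam (fun i => projForm φ D (J i)) α)).det‖ ^ 2 := by
  have hN := sum_norm_sq_pos hφ
  have hH : (volume : Measure (Fin k → Fin n → ℂ)).IsAddHaarMeasure :=
    Measure.pi.isAddHaarMeasure fun _ : Fin k => (volume : Measure (Fin n → ℂ))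
  let T := (tilt k j₀ φ).restrictScalars ℝ
  have hdet : LinearMap.det T = (∑ l, ‖φ l‖ ^ 2) ^ k := det_tilt_real hφ
  have hTc : Continuous T := T.continuous_of_finiteDimensional
  have hmap : (volume : Measure (Fin k → Fin n → ℂ)).map T =
      ENNReal.ofReal |(LinearMap.det T)⁻¹| • volume :=
    Measure.map_linearMap_addHaar_eq_smul_addHaar volume (by rw [hdet]; positivity)
  let g : (Fin k → Fin n → ℂ) → ℝ := fun C => gaussWeight C * comboDetSq (projForm φ D) α C
  have hgc : Continuous g := continuous_gaussWeight.mul (continuous_comboDetSq _ _)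
  obtain ⟨hgi, hgint⟩ := integrable_and_integral_gaussWeight_mul_comboDetSq hkm (projForm φ D) α
  have hfun : (fun C : Fin k → Fin n → ℂ =>
      gaussWeight (shiftCol j₀ C fun i => ∑ l, C i l * φ l) *
        (∏ i, gaussDensity (∑ l, C i l * φ l)) * comboDetSq D α C) =
      fun C => ((Real.pi ^ k)⁻¹ * (∑ l, ‖φ l‖ ^ 2) ^ k) * g (T C) := by
    funext C
    rw [gaussWeight_tilt hφ, comboDetSq_tilt hkm hφ hD]
    change _ = _ * (gaussWeight (tilt k j₀ φ C) * comboDetSq (projForm φ D) α (tilt k j₀ φ C))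
    ring
  have hi : Integrable (fun C => g (T C)) := by
    have : Integrable g ((volume : Measure (Fin k → Fin n → ℂ)).map T) := by
      rw [hmap]; exact hgi.smul_measure ENNReal.ofReal_ne_top
    exact (integrable_map_measure hgc.aestronglyMeasurable hTc.aemeasurable).1 this
  rw [hfun]
  refine ⟨hi.const_mul _, ?_⟩
  rw [integral_const_mul, ← integral_map (f := g) hTc.aemeasurable hgc.aestronglyMeasurable, hmap,
    integral_smul_measure, hgint, hdet, abs_of_pos (by positivity),
    ENNReal.toReal_ofReal (by positivity), smul_eq_mul]
  field_simp

end Conditioning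

/-! ### The expected zero current in local coordinates -/

section LocalExpectation

open Set Filter Topology MeasureTheory ComplexConjugate

theorem det_fst_prod {K E F : Type*} [Field K] [AddCommGroup E] [Module K E]
    [FiniteDimensional K E] [AddCommGroup F] [Module K F] [FiniteDimensional K F]
    (P : E →ₗ[K] F) (Q : F →ₗ[K] F) :
    LinearMap.det ((LinearMap.fst K E F).prod (P ∘ₗ LinearMap.fst K E F + Q ∘ₗ LinearMap.snd K E F)) =
      LinearMap.det Q := by
  classical
  let b := Module.finBasis K E
  let b' := Module.finBasis K F
  rw [← LinearMap.det_toMatrix (b.prod b'), ← LinearMap.det_toMatrix b']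
  have : LinearMap.toMatrix (b.prod b') (b.prod b') ((LinearMap.fst K E F).prod
      (P ∘ₗ LinearMap.fst K E F + Q ∘ₗ LinearMap.snd K E F)) =
      Matrix.fromBlocks 1 0 (LinearMap.toMatrix b b' P) (LinearMap.toMatrix b' b' Q) := by
    ext (i | i) (j | j) <;>
      simp [LinearMap.toMatrix_apply, Matrix.one_apply, Finsupp.single_apply, eq_comm]
  rw [this, Matrix.det_fromBlocks_zero₁₂, Matrix.det_one, one_mul]

variable {m n k : ℕ}

theorem joinFam_inj (hkm : k ≤ m) {X : Type*} {β β' : Fin k → X} {γ γ' : Fin (m - k) → X} :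
    joinFam β γ = joinFam (m := m) β' γ' ↔ β = β' ∧ γ = γ' := by
  refine ⟨fun h => ⟨funext fun i => ?_, funext fun i => ?_⟩, fun h => by rw [h.1, h.2]⟩
  · have := congrFun h ⟨i, by omega⟩
    simpa [joinFam] using this
  · have := congrFun h ⟨k + i, by omega⟩
    simpa [joinFam] using this

theorem measurePreserving_joinFam (hkm : k ≤ m) :
    MeasurePreserving (fun p : (Fin k → ℂ) × (Fin (m - k) → ℂ) => joinFam p.1 p.2)
      (volume.prod volume) (volume : Measure (Fin m → ℂ)) := by
  let σ : Fin k ⊕ Fin (m - k) ≃ Fin m := finSumFinEquiv.trans (finCongr (by omega))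
  have h1 := volume_measurePreserving_sumPiEquivProdPi_symm (fun _ : Fin k ⊕ Fin (m - k) => ℂ)
  have h2 := volume_measurePreserving_piCongrLeft (fun _ : Fin m => ℂ) σ
  have h3 := h2.comp h1
  have h4 : (fun p : (Fin k → ℂ) × (Fin (m - k) → ℂ) => joinFam p.1 p.2) =
      (MeasurableEquiv.piCongrLeft (fun _ : Fin m => ℂ) σ) ∘
        (MeasurableEquiv.sumPiEquivProdPi fun _ : Fin k ⊕ Fin (m - k) => ℂ).symm := by
    funext p i
    obtain ⟨j, rfl⟩ := σ.surjective i
    simp only [Function.comp_apply, MeasurableEquiv.coe_piCongrLeft, Equiv.piCongrLeft_apply_apply]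
    rcases j with j | j
    · have : ((σ (Sum.inl j) : Fin m) : ℕ) = j := by simp [σ]
      simp only [joinFam, this, j.2, dif_pos, Fin.eta]
      rfl
    · have : ((σ (Sum.inr j) : Fin m) : ℕ) = k + j := by simp [σ]
      simp only [joinFam, this, not_lt.2 (Nat.le_add_right k j), dif_neg, not_false_iff,
        Nat.add_sub_cancel_left, Fin.eta]
      rfl
  rw [h4]
  exact h3

/-- The map `(C, z) ↦ (C, C φ(z), α(z))`. -/
def incidence (φ : Fin n → (Fin m → ℂ) → ℂ) (α : Fin (m - k) → (Fin m → ℂ) →L[ℂ] ℂ)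
    (p : (Fin k → Fin n → ℂ) × (Fin m → ℂ)) : (Fin k → Fin n → ℂ) × (Fin m → ℂ) :=
  (p.1, joinFam (combo p.1 φ p.2) fun l => α l p.2)

variable {φ : Fin n → (Fin m → ℂ) → ℂ} {α : Fin (m - k) → (Fin m → ℂ) →L[ℂ] ℂ}
  {U : Set (Fin m → ℂ)}

theorem contDiffOn_combo (hφ : ∀ j, ContDiffOn ℂ ω (φ j) U) (i : Fin k) :
    ContDiffOn ℂ ω (fun p : (Fin k → Fin n → ℂ) × (Fin m → ℂ) => combo p.1 φ p.2 i)
      (univ ×ˢ U) :=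
  ContDiffOn.sum fun l _ => ContDiffOn.mul (by fun_prop)
    ((hφ l).comp contDiffOn_snd fun _ hp => hp.2)

theorem contDiffOn_incidence (hφ : ∀ j, ContDiffOn ℂ ω (φ j) U) :
    ContDiffOn ℂ ω (incidence (k := k) φ α) (univ ×ˢ U) := by
  refine contDiffOn_fst.prodMk (contDiffOn_pi.2 fun i => ?_)
  by_cases hi : (i : ℕ) < k
  · simp only [joinFam, hi, dif_pos]
    exact contDiffOn_combo hφ _
  · simp only [joinFam, hi, dif_neg, not_false_iff]
    exact (α _).contDiff.comp_contDiffOn contDiffOn_snd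

/-- `C ↦ C x` on matrices. -/
def mulVecForm (x : Fin n → ℂ) (i : Fin k) : (Fin k → Fin n → ℂ) →L[ℂ] ℂ :=
  ∑ j, x j • (ContinuousLinearMap.proj (R := ℂ) (φ := fun _ : Fin n => ℂ) j).comp
    (ContinuousLinearMap.proj (R := ℂ) (φ := fun _ : Fin k => Fin n → ℂ) i)

theorem mulVecForm_apply (x : Fin n → ℂ) (i : Fin k) (C : Fin k → Fin n → ℂ) :
    mulVecForm x i C = ∑ j, C i j * x j := by
  simp [mulVecForm, sum_apply, mul_comm]

theorem hasFDerivAt_incidence {C : Fin k → Fin n → ℂ} {z : Fin m → ℂ}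
    (hφ : ∀ j, DifferentiableAt ℂ (φ j) z) :
    HasFDerivAt (incidence (k := k) φ α)
      ((ContinuousLinearMap.fst ℂ (Fin k → Fin n → ℂ) (Fin m → ℂ)).prod
        ((ContinuousLinearMap.pi (joinFam (mulVecForm fun j => φ j z) fun _ => 0)).comp
            (ContinuousLinearMap.fst ℂ _ _) +
          (ContinuousLinearMap.pi (joinFam (rowForm C fun j => fderiv ℂ (φ j) z) α)).comp
            (ContinuousLinearMap.snd ℂ _ _))) (C, z) := by
  refine hasFDerivAt_fst.prodMk (hasFDerivAt_pi'.2 fun i => ?_)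
  by_cases hi : (i : ℕ) < k
  · simp only [joinFam, hi, dif_pos]
    let A : Fin n → (Fin k → Fin n → ℂ) × (Fin m → ℂ) →L[ℂ] ℂ := fun l =>
      (ContinuousLinearMap.proj (R := ℂ) (φ := fun _ : Fin n => ℂ) l).comp
        ((ContinuousLinearMap.proj (R := ℂ) (φ := fun _ : Fin k => Fin n → ℂ) ⟨i, hi⟩).comp
          (ContinuousLinearMap.fst ℂ (Fin k → Fin n → ℂ) (Fin m → ℂ)))
    have hA : ∀ l, HasFDerivAt (fun p : (Fin k → Fin n → ℂ) × (Fin m → ℂ) => p.1 ⟨i, hi⟩ l)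
        (A l) (C, z) := fun l => (A l).hasFDerivAt
    have hB : ∀ l, HasFDerivAt (fun p : (Fin k → Fin n → ℂ) × (Fin m → ℂ) => φ l p.2)
        ((fderiv ℂ (φ l) z).comp (ContinuousLinearMap.snd ℂ _ _)) (C, z) :=
      fun l => (hφ l).hasFDerivAt.comp (C, z) hasFDerivAt_snd
    refine (HasFDerivAt.fun_sum fun l _ => (hA l).fun_mul (hB l)).congr_fderiv ?_
    refine ContinuousLinearMap.ext fun ⟨H, v⟩ => ?_
    simp [sum_apply, A, joinFam, hi, mulVecForm_apply, rowForm_apply, Finset.sum_add_distrib]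
    rw [add_comm]
    congr 1
    exact Finset.sum_congr rfl fun l _ => mul_comm _ _
  · simp only [joinFam, hi, dif_neg, not_false_iff]
    refine ((α ⟨i - k, by omega⟩).hasFDerivAt.comp (C, z) hasFDerivAt_snd).congr_fderiv ?_
    refine ContinuousLinearMap.ext fun ⟨H, v⟩ => ?_
    simp [joinFam, hi]

/-- The differential is block triangular with the identity in the `C`-block, so only the derivative
in `z` contributes. -/
theorem abs_det_fderiv_incidence {C : Fin k → Fin n → ℂ} {z : Fin m → ℂ}
    (hφ : ∀ j, DifferentiableAt ℂ (φ j) z) :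
    |((fderiv ℂ (incidence (k := k) φ α) (C, z)).restrictScalars ℝ).det| =
      comboDetSq (fun j => fderiv ℂ (φ j) z) α C := by
  rw [(hasFDerivAt_incidence hφ).fderiv, comboDetSq, ← abs_det_restrictScalars_pi]
  congr 1
  let P : (Fin k → Fin n → ℂ) →L[ℂ] (Fin m → ℂ) :=
    ContinuousLinearMap.pi (joinFam (mulVecForm fun j => φ j z) fun _ => 0)
  let Q : (Fin m → ℂ) →L[ℂ] (Fin m → ℂ) :=
    ContinuousLinearMap.pi (joinFam (rowForm C fun j => fderiv ℂ (φ j) z) α)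
  exact det_fst_prod (P.toLinearMap.restrictScalars ℝ) (Q.toLinearMap.restrictScalars ℝ)

/-- The sum of `ρ` over the common zeros of the `∑_j C_{ij} φ_j` with `α = t`. -/
def fibreSum (φ : Fin n → (Fin m → ℂ) → ℂ) (α : Fin (m - k) → (Fin m → ℂ) →L[ℂ] ℂ)
    (U : Set (Fin m → ℂ)) (ρ : (Fin m → ℂ) → ℂ) (C : Fin k → Fin n → ℂ) (t : Fin (m - k) → ℂ) : ℂ :=
  ∑' z : {z // (z ∈ U ∧ combo C φ z = 0) ∧ (fun l => α l z) = t}, ρ z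

/-- The density of the expected zero current against the form `volForm α`. -/
def zeroDensity (k : ℕ) (φ : Fin n → (Fin m → ℂ) → ℂ) (α : Fin (m - k) → (Fin m → ℂ) →L[ℂ] ℂ)
    (z : Fin m → ℂ) : ℝ :=
  (Real.pi ^ k)⁻¹ * ∑ J : Fin k → Fin n, ‖(formMatrix (joinFam (fun i =>
    projForm (fun j => φ j z) (fun j => fderiv ℂ (φ j) z) (J i)) α)).det‖ ^ 2

theorem zeroDensity_nonneg (z : Fin m → ℂ) : 0 ≤ zeroDensity k φ α z := by
  have := Real.pi_pos
  unfold zeroDensity; positivity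

theorem continuousOn_zeroDensity (hU : IsOpen U) (hφ : ∀ j, ContDiffOn ℂ ω (φ j) U) {j₀ : Fin n}
    (hj₀ : ∀ z ∈ U, φ j₀ z = 1) : ContinuousOn (zeroDensity k φ α) U := by
  have hN : ContinuousOn (fun z => ∑ l, ‖φ l z‖ ^ 2) U :=
    continuousOn_finsetSum _ fun l _ => ((hφ l).continuousOn.norm).pow 2
  have hNp : ∀ z ∈ U, 0 < ∑ l, ‖φ l z‖ ^ 2 := fun z hz =>
    sum_norm_sq_pos (φ := fun j => φ j z) (hj₀ z hz)
  have hA : ContinuousOn (fun z => projForm (fun j => φ j z) fun j => fderiv ℂ (φ j) z) U := by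
    refine continuousOn_pi.2 fun j => ?_
    have hD : ∀ l, ContinuousOn (fderiv ℂ (φ l)) U := fun l =>
      (hφ l).continuousOn_fderiv_of_isOpen hU (by simp)
    have h1 : ContinuousOn (fun z => ((√(∑ l, ‖φ l z‖ ^ 2) : ℝ) : ℂ)⁻¹) U :=
      ContinuousOn.inv₀ (Complex.continuous_ofReal.comp_continuousOn
        (Real.continuous_sqrt.comp_continuousOn hN)) fun z hz => by
          exact_mod_cast (Real.sqrt_pos.2 (hNp z hz)).ne'
    have h2 : ContinuousOn (fun z => φ j z / ((∑ l, ‖φ l z‖ ^ 2 : ℝ) : ℂ)) U :=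
      ContinuousOn.div (hφ j).continuousOn (Complex.continuous_ofReal.comp_continuousOn hN)
        fun z hz => by exact_mod_cast (hNp z hz).ne'
    have h3 : ContinuousOn (fun z => ∑ l, conj (φ l z) • fderiv ℂ (φ l) z) U :=
      continuousOn_finsetSum _ fun l _ =>
        (Complex.continuous_conj.comp_continuousOn (hφ l).continuousOn).smul (hD l)
    exact h1.smul ((hD j).sub (h2.smul h3))
  refine continuousOn_const.mul (continuousOn_finsetSum _ fun J _ => ?_)
  -- Each summand is a `comboDetSq` for the 0/1 matrix whose rows select the indices `J i`.
  have h := continuousOn_comboDetSq (k := k) hA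
    (continuousOn_const (c := fun i j => if j = J i then (1 : ℂ) else 0)) α
  refine h.congr fun z hz => ?_
  have h2 : ∀ A : Fin n → (Fin m → ℂ) →L[ℂ] ℂ,
      rowForm (fun i j => if j = J i then (1 : ℂ) else 0) A = fun i => A (J i) := by
    intro A
    funext i
    ext1 v
    simp [rowForm_apply]
  simp only [comboDetSq, h2]

/-- The weight on the incidence space used to compute the expectation. -/
def incidenceWeight (φ : Fin n → (Fin m → ℂ) → ℂ) (j₀ : Fin n)
    (p : (Fin k → Fin n → ℂ) × (Fin m → ℂ)) : ℝ :=
  gaussWeight (shiftCol j₀ p.1 (combo p.1 φ p.2)) * ∏ i, gaussDensity (combo p.1 φ p.2 i)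

/-- The source side of the area formula for `incidence`, evaluated by integrating over `C` first:
the weight was chosen so that this inner integral is `zeroDensity`. -/
theorem integrable_incidence (hkm : k ≤ m) (hU : IsOpen U) (hφ : ∀ j, ContDiffOn ℂ ω (φ j) U)
    {j₀ : Fin n} (hj₀ : ∀ z ∈ U, φ j₀ z = 1) {ρ : (Fin m → ℂ) → ℂ} (hρ : ContinuousOn ρ U)
    {K : Set (Fin m → ℂ)} (hK : IsCompact K) (hKU : K ⊆ U) (hρK : ∀ z ∈ U, z ∉ K → ρ z = 0) :
    IntegrableOn (fun p : (Fin k → Fin n → ℂ) × (Fin m → ℂ) =>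
      |((fderiv ℂ (incidence (k := k) φ α) p).restrictScalars ℝ).det| •
        ((incidenceWeight φ j₀ p : ℂ) * ρ p.2)) (univ ×ˢ U) (volume.prod volume) ∧
    ∫ p in (univ : Set (Fin k → Fin n → ℂ)) ×ˢ U,
      |((fderiv ℂ (incidence (k := k) φ α) p).restrictScalars ℝ).det| •
        ((incidenceWeight φ j₀ p : ℂ) * ρ p.2) ∂(volume.prod volume) =
      ∫ z in U, (zeroDensity k φ α z : ℂ) * ρ z := by
  have hd : ∀ z ∈ U, ∀ j, DifferentiableAt ℂ (φ j) z := fun z hz j =>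
    ((hφ j).contDiffAt (hU.mem_nhds hz)).differentiableAt (by simp)
  have hs : MeasurableSet ((univ : Set (Fin k → Fin n → ℂ)) ×ˢ U) :=
    MeasurableSet.univ.prod hU.measurableSet
  have hD0 : ∀ z ∈ U, fderiv ℂ (φ j₀) z = 0 := by
    intro z hz
    have : φ j₀ =ᶠ[𝓝 z] fun _ => 1 := by
      filter_upwards [hU.mem_nhds hz] with w hw using hj₀ w hw
    rw [this.fderiv_eq]
    simp
  let v : (Fin k → Fin n → ℂ) × (Fin m → ℂ) → ℂ := fun p =>
    ((incidenceWeight φ j₀ p * comboDetSq (fun j => fderiv ℂ (φ j) p.2) α p.1 : ℝ) : ℂ) * ρ p.2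
  have hv : EqOn (fun p : (Fin k → Fin n → ℂ) × (Fin m → ℂ) =>
      |((fderiv ℂ (incidence (k := k) φ α) p).restrictScalars ℝ).det| •
        ((incidenceWeight φ j₀ p : ℂ) * ρ p.2)) v (univ ×ˢ U) := by
    rintro ⟨C, z⟩ ⟨-, hz⟩
    simp only [v]
    rw [abs_det_fderiv_incidence (hd z hz), Complex.real_smul]
    push_cast
    ring
  rw [integrableOn_congr_fun hv hs, setIntegral_congr_fun hs hv]
  have hprod : ((volume : Measure (Fin k → Fin n → ℂ)).prod
      (volume : Measure (Fin m → ℂ))).restrict (univ ×ˢ U) =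
      volume.prod (volume.restrict U) := by
    rw [← Measure.prod_restrict, Measure.restrict_univ]
  have hslice : ∀ z ∈ U, Integrable (fun C : Fin k → Fin n → ℂ =>
        incidenceWeight φ j₀ (C, z) * comboDetSq (fun j => fderiv ℂ (φ j) z) α C) ∧
      ∫ C : Fin k → Fin n → ℂ,
        incidenceWeight φ j₀ (C, z) * comboDetSq (fun j => fderiv ℂ (φ j) z) α C =
        zeroDensity k φ α z := fun z hz =>
    integrable_and_integral_shiftCol hkm (φ := fun j => φ j z) (hj₀ z hz) (hD0 z hz) α
  have hmeas : AEStronglyMeasurable v (volume.prod (volume.restrict U)) := by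
    rw [← hprod]
    refine ContinuousOn.aestronglyMeasurable ?_ hs
    have hcombo : ∀ i, ContinuousOn (fun p : (Fin k → Fin n → ℂ) × (Fin m → ℂ) =>
      combo p.1 φ p.2 i) (univ ×ˢ U) := fun i => (contDiffOn_combo hφ i).continuousOn
    refine ContinuousOn.mul (Complex.continuous_ofReal.comp_continuousOn
      (ContinuousOn.mul (ContinuousOn.mul ?_ ?_) ?_)) (hρ.comp continuousOn_snd fun p hp => hp.2)
    · refine continuous_gaussWeight.comp_continuousOn
        (continuousOn_pi.2 fun i => continuousOn_pi.2 fun j => ?_)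
      exact ContinuousOn.sub (by fun_prop) ((hcombo i).mul continuousOn_const)
    · exact continuousOn_finsetProd _ fun i _ => continuous_gaussDensity.comp_continuousOn (hcombo i)
    · refine continuousOn_comboDetSq (continuousOn_pi.2 fun j => ?_) continuousOn_fst α
      exact ((hφ j).continuousOn_fderiv_of_isOpen hU (by simp)).comp continuousOn_snd
        fun p hp => hp.2
  have hκ : IntegrableOn (fun z => (zeroDensity k φ α z : ℂ) * ρ z) U := by
    have hc : ContinuousOn (fun z => (zeroDensity k φ α z : ℂ) * ρ z) K :=
      ((Complex.continuous_ofReal.comp_continuousOn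
        (continuousOn_zeroDensity hU hφ hj₀)).mul hρ).mono hKU
    refine (hc.integrableOn_compact hK).of_forall_sdiff_eq_zero hU.measurableSet fun z hz => ?_
    rw [hρK z hz.1 hz.2, mul_zero]
  have hInt : Integrable v (volume.prod (volume.restrict U)) := by
    -- The weight is nonnegative, so the `C`-integral of the norm is again `zeroDensity` times
    -- `‖ρ‖`, which is continuous on `K` and zero on `U` outside it.
    rw [integrable_prod_iff' hmeas]
    refine ⟨(ae_restrict_iff' hU.measurableSet).2 (Eventually.of_forall fun z hz =>
      (Complex.ofRealCLM.integrable_comp (hslice z hz).1).mul_const (ρ z)), ?_⟩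
    refine hκ.norm.congr ((ae_restrict_iff' hU.measurableSet).2 (Eventually.of_forall
      fun z hz => ?_))
    have h1 : ∀ C : Fin k → Fin n → ℂ, ‖v (C, z)‖ =
        incidenceWeight φ j₀ (C, z) * comboDetSq (fun j => fderiv ℂ (φ j) z) α C * ‖ρ z‖ := by
      intro C
      simp only [v]
      rw [norm_mul, Complex.norm_real, Real.norm_of_nonneg]
      refine mul_nonneg (mul_nonneg (gaussWeight_pos _).le
        (Finset.prod_nonneg fun i _ => (gaussDensity_pos _).le)) (comboDetSq_nonneg _ _ _)
    simp only [h1]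
    rw [integral_mul_const, (hslice z hz).2, norm_mul, Complex.norm_real,
      Real.norm_of_nonneg (zeroDensity_nonneg z)]
  rw [IntegrableOn, hprod]
  refine ⟨hInt, ?_⟩
  rw [integral_prod_symm _ hInt]
  refine setIntegral_congr_fun hU.measurableSet fun z hz => ?_
  simp only [v]
  rw [integral_mul_const, integral_complex_ofReal, (hslice z hz).2]

theorem combo_shiftCol {j₀ : Fin n} {z : Fin m → ℂ} (hz : φ j₀ z = 1) (C : Fin k → Fin n → ℂ)
    (τ : Fin k → ℂ) : combo (shiftCol j₀ C τ) φ z = combo C φ z - τ := by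
  funext i
  simp only [combo, shiftCol, sub_mul, Finset.sum_sub_distrib, Pi.sub_apply]
  simp [hz]

/-- Gaussian average of sums over zeros. -/
theorem integrable_and_integral_fibreSum (hkm : k ≤ m) (hU : IsOpen U)
    (hφ : ∀ j, ContDiffOn ℂ ω (φ j) U) {j₀ : Fin n} (hj₀ : ∀ z ∈ U, φ j₀ z = 1)
    {ρ : (Fin m → ℂ) → ℂ} (hρ : ContinuousOn ρ U)
    {K : Set (Fin m → ℂ)} (hK : IsCompact K) (hKU : K ⊆ U) (hρK : ∀ z ∈ U, z ∉ K → ρ z = 0) :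
    Integrable (fun p : (Fin (m - k) → ℂ) × (Fin k → Fin n → ℂ) =>
      (gaussWeight p.2 : ℂ) * fibreSum φ α U ρ p.2 p.1) (volume.prod volume) ∧
    ∫ p : (Fin (m - k) → ℂ) × (Fin k → Fin n → ℂ),
      (gaussWeight p.2 : ℂ) * fibreSum φ α U ρ p.2 p.1 ∂(volume.prod volume) =
      ∫ z in U, (zeroDensity k φ α z : ℂ) * ρ z := by
  have hH : (volume : Measure (Fin k → Fin n → ℂ)).IsAddHaarMeasure :=
    Measure.pi.isAddHaarMeasure fun _ : Fin k => (volume : Measure (Fin n → ℂ))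
  have hH2 : ((volume : Measure (Fin k → Fin n → ℂ)).prod
      (volume : Measure (Fin m → ℂ))).IsAddHaarMeasure :=
    Measure.prod.instIsAddHaarMeasure _ _
  let s : Set ((Fin k → Fin n → ℂ) × (Fin m → ℂ)) := univ ×ˢ U
  have hso : IsOpen s := isOpen_univ.prod hU
  obtain ⟨hInt, hval⟩ := integrable_incidence (α := α) hkm hU hφ hj₀ hρ hK hKU hρK
  obtain ⟨-, hI, hE⟩ := area_formula (volume.prod volume) hso.measurableSet
    (f := incidence (k := k) φ α)
    (f' := fun p => (fderiv ℂ (incidence (k := k) φ α) p).restrictScalars ℝ)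
    (u := fun p => (incidenceWeight φ j₀ p : ℂ) * ρ p.2)
    (fun p hp => ((((contDiffOn_incidence hφ).contDiffAt (hso.mem_nhds hp)).differentiableAt
      (by simp)).hasFDerivAt.restrictScalars ℝ).hasFDerivWithinAt)
    ((ContinuousLinearMap.restrictScalarsL ℂ _ _ ℝ ℝ).continuous.comp_continuousOn
      ((contDiffOn_incidence hφ).continuousOn_fderiv_of_isOpen hso (by simp)))
    hInt
  rw [hval] at hE
  -- The shear adding `τ` to column `j₀`: zeros of `Cφ` become solutions of `Bφ = τ` for the sheared
  -- matrix `B`. It preserves volume since it is a translation for each fixed `τ`.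
  let Θ : ((Fin k → ℂ) × (Fin (m - k) → ℂ)) × (Fin k → Fin n → ℂ) →
      (Fin m → ℂ) × (Fin k → Fin n → ℂ) := fun q =>
    (joinFam q.1.1 q.1.2, q.2 + fun i j => q.1.1 i * (if j = j₀ then 1 else 0))
  have hΘ : MeasurePreserving Θ ((volume.prod volume).prod volume) (volume.prod volume) := by
    refine (measurePreserving_joinFam hkm).skew_product
      (g := fun a C => C + fun i j => a.1 i * (if j = j₀ then 1 else 0)) ?_
      (Eventually.of_forall fun a => map_add_right_eq_self _ _)
    refine Continuous.measurable ?_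
    fun_prop
  -- After the shear the fibre sum is a function of `τ` alone times the wanted function of `(t, C)`.
  have hsum : ∀ (τ : Fin k → ℂ) (t : Fin (m - k) → ℂ) (C : Fin k → Fin n → ℂ),
      ∑' x : {x // x ∈ s ∧ incidence φ α x = Prod.swap (Θ ((τ, t), C))},
        (incidenceWeight φ j₀ (x : (Fin k → Fin n → ℂ) × (Fin m → ℂ)) : ℂ) * ρ x.1.2 =
      ((∏ i, gaussDensity (τ i) : ℝ) : ℂ) * ((gaussWeight C : ℂ) * fibreSum φ α U ρ C t) := by
    intro τ t C
    let B : Fin k → Fin n → ℂ := C + fun i j => τ i * (if j = j₀ then 1 else 0)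
    have hB : shiftCol j₀ B τ = C := by
      funext i j; simp [shiftCol, B]
    have hcombo : ∀ z ∈ U, combo C φ z = 0 ↔ combo B φ z = τ := by
      intro z hz
      rw [← hB, combo_shiftCol (hj₀ z hz), sub_eq_zero]
    have hmem : ∀ z ∈ U, incidence φ α (B, z) = Prod.swap (Θ ((τ, t), C)) ↔
        combo C φ z = 0 ∧ (fun l => α l z) = t := by
      intro z hz
      rw [hcombo z hz, ← joinFam_inj hkm]
      simp [incidence, Θ, B]
    let e : {z // (z ∈ U ∧ combo C φ z = 0) ∧ (fun l => α l z) = t} ≃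
        {x // x ∈ s ∧ incidence φ α x = Prod.swap (Θ ((τ, t), C))} :=
      { toFun := fun z => ⟨(B, z), ⟨mem_univ _, z.2.1.1⟩, (hmem z z.2.1.1).2 ⟨z.2.1.2, z.2.2⟩⟩
        invFun := fun x => ⟨x.1.2, by
          have h0 : x.1.1 = B := congrArg Prod.fst x.2.2
          have h1 : x.1 = (B, x.1.2) := Prod.ext h0 rfl
          have h2 := x.2.2
          rw [h1, hmem _ x.2.1.2] at h2
          exact ⟨⟨x.2.1.2, h2.1⟩, h2.2⟩⟩
        left_inv := fun z => rfl
        right_inv := fun x => by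
          have h0 : x.1.1 = B := congrArg Prod.fst x.2.2
          exact Subtype.ext (Prod.ext h0.symm rfl) }
    rw [← e.tsum_eq, fibreSum, ← tsum_mul_left, ← tsum_mul_left]
    refine tsum_congr fun z => ?_
    change (incidenceWeight φ j₀ (B, z) : ℂ) * ρ z = _
    rw [incidenceWeight, (hcombo z z.2.1.1).1 z.2.1.2, hB]
    push_cast
    ring
  have hmp : MeasurePreserving (fun q : (Fin k → ℂ) × ((Fin (m - k) → ℂ) × (Fin k → Fin n → ℂ)) =>
      Prod.swap (Θ ((q.1, q.2.1), q.2.2))) (volume.prod (volume.prod volume))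
      (volume.prod volume) :=
    Measure.measurePreserving_swap.comp (hΘ.comp
      (measurePreserving_prodAssoc volume volume volume).symm)
  have hθ : ∫ τ : Fin k → ℂ, ((∏ i, gaussDensity (τ i) : ℝ) : ℂ) = 1 := by
    simp only [Complex.ofReal_prod]
    rw [integral_fintype_prod_volume_eq_prod (fun _ : Fin k => fun c => (gaussDensity c : ℂ))]
    simp [integral_gaussDensity]
  have hI' := (hmp.integrable_comp hI.aestronglyMeasurable).2 hI
  rw [← hmp.map_eq, integral_map hmp.aemeasurable (by rw [hmp.map_eq]; exact hI.1)] at hE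
  simp only [Function.comp_def, hsum] at hI' hE
  constructor
  · obtain ⟨τ, hτ⟩ := hI'.prod_right_ae.exists
    have h0 : ((∏ i, gaussDensity (τ i) : ℝ) : ℂ) ≠ 0 := by
      exact_mod_cast (Finset.prod_pos fun i _ => gaussDensity_pos (τ i)).ne'
    exact (integrable_const_mul_iff (isUnit_iff_ne_zero.2 h0) _).1 hτ
  · rw [← hE, integral_prod_mul (fun τ : Fin k → ℂ => ((∏ i, gaussDensity (τ i) : ℝ) : ℂ))
      (fun p : (Fin (m - k) → ℂ) × (Fin k → Fin n → ℂ) =>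
        (gaussWeight p.2 : ℂ) * fibreSum φ α U ρ p.2 p.1), hθ, one_mul]

end LocalExpectation

/-! ### Gaussian random sections -/

section Transfer

open Set Filter Topology MeasureTheory

variable {n k : ℕ}

theorem prod_gaussDensity (c : Fin n → ℂ) :
    ∏ j, gaussDensity (c j) = (Real.pi ^ n)⁻¹ * Real.exp (-∑ j, ‖c j‖ ^ 2) := by
  simp only [gaussDensity, Finset.prod_mul_distrib, Finset.prod_const, Finset.card_univ,
    Fintype.card_fin, ← Real.exp_sum, Finset.sum_neg_distrib, inv_pow]

theorem stdGaussian_eq : stdGaussian n =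
    volume.withDensity fun c => ENNReal.ofReal (∏ j, gaussDensity (c j)) := by
  simp only [stdGaussian, prod_gaussDensity]

theorem integrable_prod_gaussDensity :
    Integrable fun c : Fin n → ℂ => ∏ j, gaussDensity (c j) := by
  have := integrable_norm_pow_mul_gaussDensity 0
  simp only [pow_zero, one_mul] at this
  exact Integrable.fintype_prod (f := fun _ : Fin n => gaussDensity) fun _ => this

theorem stdGaussian_apply {s : Set (Fin n → ℂ)} (hs : MeasurableSet s) :
    stdGaussian n s = ENNReal.ofReal (∫ c, s.indicator (fun c => ∏ j, gaussDensity (c j)) c) := by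
  rw [stdGaussian_eq, withDensity_apply _ hs, integral_indicator hs,
    ofReal_integral_eq_lintegral_ofReal integrable_prod_gaussDensity.integrableOn]
  exact Eventually.of_forall fun c => Finset.prod_nonneg fun j _ => (gaussDensity_pos _).le

instance : IsFiniteMeasure (stdGaussian n) :=
  ⟨by rw [stdGaussian_apply MeasurableSet.univ]; exact ENNReal.ofReal_lt_top⟩

theorem pi_stdGaussian : Measure.pi (fun _ : Fin k => stdGaussian n) =
    volume.withDensity fun C => ENNReal.ofReal (gaussWeight C) := by
  refine Measure.pi_eq fun s hs => ?_
  have hm : MeasurableSet (univ.pi s) := MeasurableSet.univ_pi hs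
  have h0 : ∀ i, 0 ≤ ∫ c, (s i).indicator (fun c : Fin n → ℂ => ∏ j, gaussDensity (c j)) c :=
    fun i => integral_nonneg fun c => indicator_nonneg
      (fun c _ => Finset.prod_nonneg fun j _ => (gaussDensity_pos _).le) c
  rw [withDensity_apply _ hm, ← ofReal_integral_eq_lintegral_ofReal
    integrable_gaussWeight.integrableOn (Eventually.of_forall fun C => (gaussWeight_pos C).le)]
  simp only [stdGaussian_apply (hs _)]
  rw [← ENNReal.ofReal_prod_of_nonneg fun i _ => h0 i]
  congr 1
  rw [← integral_indicator hm, ← integral_fintype_prod_volume_eq_prod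
    (fun i => (s i).indicator (fun c : Fin n → ℂ => ∏ j, gaussDensity (c j)))]
  refine integral_congr_ae (Eventually.of_forall fun C => ?_)
  by_cases hC : C ∈ univ.pi s
  · simp only [indicator_of_mem hC, gaussWeight]
    refine Finset.prod_congr rfl fun i _ => ?_
    rw [indicator_of_mem (hC i (mem_univ i))]
  · simp only [indicator_of_notMem hC]
    obtain ⟨i, hi⟩ : ∃ i, C i ∉ s i := by simpa [mem_univ_pi] using hC
    rw [eq_comm]
    refine Finset.prod_eq_zero (Finset.mem_univ i) ?_
    rw [indicator_of_notMem hi]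

variable {m : ℕ} {M : Type*} [TopologicalSpace M] [ChartedSpace (Fin m → ℂ) M]
  {L : M → Type*} [∀ x, AddCommGroup (L x)] [∀ x, Module ℂ (L x)]
  [∀ x, TopologicalSpace (L x)] [TopologicalSpace (Bundle.TotalSpace ℂ L)]
  [FiberBundle ℂ L] [VectorBundle ℂ ℂ L]
  {S : Submodule ℂ (HolSection m L)}

theorem measurable_linearMap (l : S →ₗ[ℂ] ℂ) : Measurable l :=
  (comap_measurable l).mono
    (le_iSup (fun l : S →ₗ[ℂ] ℂ => MeasurableSpace.comap l inferInstance) l) le_rfl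

/-- The coordinates of a section in a basis. -/
def sectionEquiv (b : Module.Basis (Fin n) ℂ S) : (Fin n → ℂ) ≃ᵐ S where
  toFun c := ∑ j, c j • b j
  invFun s j := b.repr s j
  left_inv c := by
    funext j
    simp [Finsupp.single_apply]
  right_inv s := b.sum_repr s
  -- The σ-algebra on `S` is generated by linear functionals, so it is enough that each functional
  -- of `∑ c_j S_j` is measurable in `c`.
  measurable_toFun := by
    refine measurable_iff_le_map.2 (iSup_le fun l => ?_)
    rw [← measurable_iff_le_map, measurable_comap_iff]
    have : (l ∘ fun c : Fin n → ℂ => ∑ j, c j • b j) = fun c => ∑ j, c j * l (b j) := by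
      funext c; simp
    change Measurable (l ∘ fun c : Fin n → ℂ => ∑ j, c j • b j)
    rw [this]
    fun_prop
  measurable_invFun := measurable_pi_iff.2 fun j => measurable_linearMap (b.coord j)

/-- The sections with given matrix of coordinates. -/
def sectionsEquiv (k : ℕ) (b : Module.Basis (Fin n) ℂ S) : (Fin k → Fin n → ℂ) ≃ᵐ (Fin k → S) :=
  MeasurableEquiv.piCongrRight fun _ => sectionEquiv b

theorem sectionsEquiv_apply (b : Module.Basis (Fin n) ℂ S) (C : Fin k → Fin n → ℂ) (i : Fin k) :
    sectionsEquiv k b C i = ∑ j, C i j • b j := rfl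

theorem pi_gaussian (b : Module.Basis (Fin n) ℂ S) :
    Measure.pi (fun _ : Fin k => gaussian b) =
      (volume.withDensity fun C => ENNReal.ofReal (gaussWeight C)).map (sectionsEquiv k b) := by
  have h1 : gaussian b = (stdGaussian n).map (sectionEquiv b) := rfl
  have : SigmaFinite ((stdGaussian n).map (sectionEquiv b)) := inferInstance
  rw [h1, ← pi_stdGaussian, ← Measure.pi_map_pi fun i => (sectionEquiv b).measurable.aemeasurable]
  rfl

theorem ae_pi_gaussian_of_ae (b : Module.Basis (Fin n) ℂ S) {P : (Fin k → S) → Prop}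
    (h : ∀ᵐ C : Fin k → Fin n → ℂ, P (sectionsEquiv k b C)) :
    ∀ᵐ s ∂(Measure.pi fun _ : Fin k => gaussian b), P s := by
  rw [pi_gaussian, (sectionsEquiv k b).measurableEmbedding.ae_map_iff]
  exact (withDensity_absolutelyContinuous _ _).ae_le h

theorem integrable_and_integral_pi_gaussian (b : Module.Basis (Fin n) ℂ S)
    {X : (Fin k → S) → ℂ} (hX : Integrable fun C : Fin k → Fin n → ℂ =>
      (gaussWeight C : ℂ) * X (sectionsEquiv k b C)) :
    Integrable X (Measure.pi fun _ : Fin k => gaussian b) ∧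
    ∫ s, X s ∂(Measure.pi fun _ : Fin k => gaussian b) =
      ∫ C : Fin k → Fin n → ℂ, (gaussWeight C : ℂ) * X (sectionsEquiv k b C) := by
  have hm : Measurable fun C : Fin k → Fin n → ℂ => ENNReal.ofReal (gaussWeight C) :=
    ENNReal.measurable_ofReal.comp continuous_gaussWeight.measurable
  have hlt : ∀ᵐ C : Fin k → Fin n → ℂ, ENNReal.ofReal (gaussWeight C) < ⊤ :=
    Eventually.of_forall fun _ => ENNReal.ofReal_lt_top
  have h1 : ∀ C : Fin k → Fin n → ℂ, (ENNReal.ofReal (gaussWeight C)).toReal •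
      X (sectionsEquiv k b C) = (gaussWeight C : ℂ) * X (sectionsEquiv k b C) := fun C => by
    rw [ENNReal.toReal_ofReal (gaussWeight_pos C).le, Complex.real_smul]
  rw [pi_gaussian]
  constructor
  · rw [integrable_map_equiv, integrable_withDensity_iff_integrable_smul' hm hlt]
    simpa only [Function.comp_apply, h1] using hX
  · rw [integral_map_equiv, integral_withDensity_eq_integral_toReal_smul hm hlt]
    simp only [h1]

end Transfer

/-! ### Top degree forms -/

section TopForms

open Set Filter Topology

variable {m : ℕ}

theorem wedge_comp {p q : ℕ} (a : AltForm m p) (b : AltForm m q)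
    (T : (Fin m → ℂ) →L[ℝ] (Fin m → ℂ)) :
    wedge (a.compContinuousLinearMap T) (b.compContinuousLinearMap T) =
      (wedge a b).compContinuousLinearMap T := by
  ext v
  rw [ContinuousAlternatingMap.compContinuousLinearMap_apply, wedge_apply, wedge_apply]
  rfl

theorem wedgePow_comp (a : AltForm m 2) (T : (Fin m → ℂ) →L[ℝ] (Fin m → ℂ)) (k : ℕ) :
    wedgePow (a.compContinuousLinearMap T) k = (wedgePow a k).compContinuousLinearMap T := by
  induction k with
  | zero => rfl
  | succ k ih => rw [wedgePow, ih, wedge_comp]; rfl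

theorem powWedge_comp {k : ℕ} (hk : k ≤ m) (a : AltForm m 2) (b : AltForm m (2 * (m - k)))
    (T : (Fin m → ℂ) →L[ℝ] (Fin m → ℂ)) :
    powWedge hk (a.compContinuousLinearMap T) (b.compContinuousLinearMap T) =
      (powWedge hk a b).compContinuousLinearMap T := by
  ext v
  rw [powWedge_apply, wedgePow_comp, wedge_comp]
  rfl

/-- The real basis `e₁, i e₁, …, e_m, i e_m` of `ℂ^m`. -/
def stdBasis (m : ℕ) : Module.Basis (Fin (2 * m)) ℝ (Fin m → ℂ) :=
  (Pi.basis fun _ : Fin m => Complex.basisOneI).reindex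
    ((Equiv.sigmaEquivProd (Fin m) (Fin 2)).trans (pairIndex m))

theorem stdBasis_apply (j : Fin (2 * m)) : stdBasis m j = stdFrame m j := by
  obtain ⟨⟨l, a⟩, rfl⟩ := (pairIndex m).surjective j
  rw [stdBasis, Module.Basis.reindex_apply]
  have h1 := pairIndex_div l a
  have h2 := pairIndex_mod l a
  simp only [Equiv.symm_trans_apply, Equiv.symm_apply_apply]
  rw [stdFrame]
  simp only [h1, h2]
  change Pi.basis (fun _ : Fin m => Complex.basisOneI) ⟨l, a⟩ = _
  rw [Pi.basis_apply]
  congr 1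
  fin_cases a <;> simp

/-- The coordinate forms of `ℂ^m`. -/
def coordForm (i : Fin m) : (Fin m → ℂ) →L[ℂ] ℂ := ContinuousLinearMap.proj i

theorem volForm_coordForm_stdFrame : volForm (coordForm (m := m)) (stdFrame m) = 1 := by
  have := volForm_stdFrame (coordForm (m := m)) (ContinuousLinearMap.id ℂ (Fin m → ℂ))
  have h1 : formMatrix (fun j => (coordForm (m := m) j).comp (ContinuousLinearMap.id ℂ (Fin m → ℂ)))
      = 1 := by
    ext i j
    simp [formMatrix, coordForm, Matrix.one_apply, Pi.single_apply, eq_comm]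
  rw [h1] at this
  simpa using this

/-- Top-degree forms are a line: an alternating form is determined by its values on injective tuples
of basis vectors, which here are permutations of the standard frame. -/
theorem eq_smul_volForm_coordForm (T : AltForm m (2 * m)) :
    T = T (stdFrame m) • volForm (coordForm (m := m)) := by
  have h : T.toAlternatingMap = (T (stdFrame m) • volForm (coordForm (m := m))).toAlternatingMap := by
    refine Module.Basis.ext_alternating (stdBasis m) fun v hv => ?_
    let σ : Equiv.Perm (Fin (2 * m)) := Equiv.ofBijective v (Finite.injective_iff_bijective.1 hv)
    have h1 : ∀ R : AltForm m (2 * m), R.toAlternatingMap (fun i => stdBasis m (v i)) =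
        Equiv.Perm.sign σ • R (stdFrame m) := by
      intro R
      have h2 := R.toAlternatingMap.map_perm (stdFrame m) σ
      rw [show (fun i => stdBasis m (v i)) = stdFrame m ∘ σ from funext fun i => stdBasis_apply _]
      exact h2
    rw [h1, h1]
    congr 1
    rw [ContinuousAlternatingMap.smul_apply, volForm_coordForm_stdFrame, smul_eq_mul, mul_one]
  exact ContinuousAlternatingMap.toAlternatingMap_injective h

end TopForms

/-! ### Adapted charts -/

section Adapted

open Set Filter Topology MeasureTheory

variable {m : ℕ} {M : Type*} [TopologicalSpace M] [ChartedSpace (Fin m → ℂ) M]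
  [IsManifold 𝓘(ℂ, Fin m → ℂ) ω M]
  {L : M → Type*} [∀ x, AddCommGroup (L x)] [∀ x, Module ℂ (L x)]
  [∀ x, TopologicalSpace (L x)] [TopologicalSpace (Bundle.TotalSpace ℂ L)]
  [FiberBundle ℂ L] [VectorBundle ℂ ℂ L] [ContMDiffVectorBundle ω ℂ L 𝓘(ℂ, Fin m → ℂ)]
  {S : Submodule ℂ (HolSection m L)} {n : ℕ}

/-- A holomorphic chart together with the quotients `φ_j = S_j / S_{j₀}` of the sections of the
basis by one of them which has no zeros in the domain of the chart. -/
structure AdaptedChart (b : Module.Basis (Fin n) ℂ S) where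
  chart : OpenPartialHomeomorph M (Fin m → ℂ)
  mem_maximalAtlas : chart ∈ IsManifold.maximalAtlas 𝓘(ℂ, Fin m → ℂ) ω M
  quot : Fin n → (Fin m → ℂ) → ℂ
  index : Fin n
  contDiffOn : ∀ j, ContDiffOn ℂ ω (quot j) chart.target
  quot_index : ∀ z ∈ chart.target, quot index z = 1
  mem_zeroSet_iff : ∀ {k : ℕ} (C : Fin k → Fin n → ℂ), ∀ y ∈ chart.source,
    y ∈ zeroSet (sectionsEquiv k b C) ↔ combo C quot (chart y) = 0
  expectedForm_eq : ∀ (h : HermitianMetric m L), ∀ y ∈ chart.source,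
    expectedForm h b y = ((Complex.I / (2 * Real.pi)) •
      sumPair (projForm (fun j => quot j (chart y)) fun j =>
        fderiv ℂ (quot j) (chart y))).compContinuousLinearMap
      (mfderiv 𝓘(ℝ, Fin m → ℂ) 𝓘(ℝ, Fin m → ℂ) chart y)
  contDiffOn_pullback : ∀ {r : ℕ} (φ : DForm m M r), IsSmooth φ →
    ContDiffOn ℝ ∞ (pullback chart.symm φ) chart.target

/-- Base point freeness supplies a basis section that does not vanish at `x`; the preferred chart is
shrunk to where this section has no zeros and the frame exists. Dividing by it is another frame
change, invisible to the expected form by `projForm_mul`. -/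
theorem exists_adaptedChart (hS : IsBasePointFree S) (b : Module.Basis (Fin n) ℂ S) (x : M) :
    ∃ A : AdaptedChart b, x ∈ A.chart.source := by
  obtain ⟨j₀, hj₀⟩ := hS.exists_basis_ne_zero b x
  let B := (trivializationAt ℂ L x).baseSet
  have hB : IsOpen B := (trivializationAt ℂ L x).open_baseSet
  have hxB : x ∈ B := FiberBundle.mem_baseSet_trivializationAt' x
  let V : Set M := B ∩ frameCoord x (b j₀).1 ⁻¹' {0}ᶜ
  have hV : IsOpen V := (contMDiffOn_frameCoord x (b j₀).1).continuousOn.isOpen_inter_preimage hB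
    isOpen_compl_singleton
  have hxV : x ∈ V := ⟨hxB, (frameCoord_eq_zero_iff hxB _).not.2 hj₀⟩
  let c := chartAt (Fin m → ℂ) x
  let e := c.restr V
  have hc : c ∈ IsManifold.maximalAtlas 𝓘(ℂ, Fin m → ℂ) ω M := IsManifold.chart_mem_maximalAtlas x
  have he : e ∈ IsManifold.maximalAtlas 𝓘(ℂ, Fin m → ℂ) ω M := restr_mem_maximalAtlas _ hc hV
  have hes : e.source = c.source ∩ V := c.restr_source' V hV
  let f : Fin n → (Fin m → ℂ) → ℂ := fun j w => frameCoord x (b j).1 (e.symm w)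
  let q : Fin n → (Fin m → ℂ) → ℂ := fun j w => f j w / f j₀ w
  have hsV : ∀ y ∈ e.source, y ∈ V := fun y hy => by rw [hes] at hy; exact hy.2
  have htV : ∀ z ∈ e.target, e.symm z ∈ V := fun z hz => hsV _ (e.map_target hz)
  have hf : ∀ j, ∀ z ∈ e.target, ContDiffAt ℂ ω (f j) z := fun j z hz =>
    contDiffAt_frameCoord_comp_symm he hz (htV z hz).1 _
  have hf0 : ∀ z ∈ e.target, f j₀ z ≠ 0 := fun z hz => (htV z hz).2
  have hq : ∀ j, ∀ z ∈ e.target, ContDiffAt ℂ ω (q j) z := fun j z hz =>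
    (hf j z hz).div (hf j₀ z hz) (hf0 z hz)
  refine ⟨⟨e, he, q, j₀, fun j z hz => (hq j z hz).contDiffWithinAt, fun z hz =>
    div_self (hf0 z hz), ?_, ?_, ?_⟩, ?_⟩
  · intro k C y hy
    have hyB : y ∈ B := (hsV y hy).1
    have hfy : f j₀ (e y) ≠ 0 := hf0 _ (e.map_source hy)
    have h1 : ∀ i, combo C q (e y) i =
        frameCoord x (∑ j, C i j • (b j).1) y / f j₀ (e y) := by
      intro i
      rw [frameCoord_sum hyB, combo, Finset.sum_div]
      refine Finset.sum_congr rfl fun j _ => ?_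
      simp only [q, f, e.left_inv hy]
      ring
    have h2 : ∀ i, ((sectionsEquiv k b C i : S) : HolSection m L) = ∑ j, C i j • (b j).1 := by
      intro i
      rw [sectionsEquiv_apply, AddSubmonoidClass.coe_finset_sum]
      rfl
    constructor
    · intro h
      funext i
      have h3 := h i
      rw [h2] at h3
      rw [h1, (frameCoord_eq_zero_iff hyB _).2 h3, zero_div]
      rfl
    · intro h i
      have h3 := h1 i
      rw [h] at h3
      rw [h2, ← frameCoord_eq_zero_iff hyB]
      have h4 := (div_eq_zero_iff.1 h3.symm).resolve_right hfy
      exact h4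
  · intro h y hy
    have hyB : y ∈ B := (hsV y hy).1
    have hz := e.map_source hy
    have hv : (fun j => frameCoord x (b j).1 y) = fun j => f j₀ (e y) * q j (e y) := by
      funext j
      simp only [q]
      rw [mul_div_cancel₀ _ (hf0 _ hz)]
      simp only [f, e.left_inv hy]
    have hd : (fun j => fderiv ℂ (f j) (e y)) = fun j => f j₀ (e y) • fderiv ℂ (q j) (e y) +
        q j (e y) • fderiv ℂ (f j₀) (e y) := by
      funext j
      have h1 : f j =ᶠ[𝓝 (e y)] fun w => f j₀ w * q j w := by
        filter_upwards [e.open_target.mem_nhds hz] with w hw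
        simp only [q]
        rw [mul_div_cancel₀ _ (hf0 _ hw)]
      rw [h1.fderiv_eq]
      exact fderiv_mul ((hf j₀ _ hz).differentiableAt (by simp))
        ((hq j _ hz).differentiableAt (by simp))
    have hN : 0 < ∑ l, ‖q l (e y)‖ ^ 2 := sum_norm_sq_pos (φ := fun l => q l (e y)) (j₀ := j₀)
      (div_self (hf0 _ hz))
    have h2 : projForm (fun j => frameCoord x (b j).1 y) (fun j => fderiv ℂ (f j) (e y)) =
        fun j => (f j₀ (e y) / ((‖f j₀ (e y)‖ : ℝ) : ℂ)) •
          projForm (fun j => q j (e y)) (fun j => fderiv ℂ (q j) (e y)) j := by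
      rw [hv, hd]
      funext j
      exact projForm_mul _ _ (hf0 _ hz) hN _ j
    have hph : ‖f j₀ (e y) / ((‖f j₀ (e y)‖ : ℝ) : ℂ)‖ = 1 := by
      rw [norm_div, Complex.norm_real, norm_norm, div_self (norm_ne_zero_iff.2 (hf0 _ hz))]
    have h3 : sumPair (projForm (fun j => frameCoord x (b j).1 y) fun j => fderiv ℂ (f j) (e y)) =
        sumPair (projForm (fun j => q j (e y)) fun j => fderiv ℂ (q j) (e y)) := by
      rw [h2]
      exact sumPair_smul _ hph
    have h4 := expectedForm_eq h hS b he hy hyB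
    rw [h4]
    exact congrArg (fun s : AltForm m 2 => ((Complex.I / (2 * Real.pi)) •
      s).compContinuousLinearMap (mfderiv 𝓘(ℝ, Fin m → ℂ) 𝓘(ℝ, Fin m → ℂ) e y)) h3
  -- Smoothness of a form refers to the charts of the atlas only; it applies because this chart is a
  -- restriction of `chartAt`.
  · intro r φ hφ
    refine (hφ c (chart_mem_atlas _ x)).mono ?_
    intro z hz
    exact hz.1
  · rw [hes]
    exact ⟨mem_chart_source _ x, hxV⟩

end Adapted

/-! ### The expected zero current -/

section Main

open Set Filter Topology MeasureTheory

variable {m : ℕ} {M : Type*} [TopologicalSpace M]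
  [ChartedSpace (Fin m → ℂ) M] [IsManifold 𝓘(ℂ, Fin m → ℂ) ω M]
  {L : M → Type*} [∀ x, AddCommGroup (L x)] [∀ x, Module ℂ (L x)]
  [∀ x, TopologicalSpace (L x)] [TopologicalSpace (Bundle.TotalSpace ℂ L)]
  [FiberBundle ℂ L] [VectorBundle ℂ ℂ L] [ContMDiffVectorBundle ω ℂ L 𝓘(ℂ, Fin m → ℂ)]
  {S : Submodule ℂ (HolSection m L)} {n k : ℕ} {b : Module.Basis (Fin n) ℂ S}

theorem contDiffOn_combo_right {U : Set (Fin m → ℂ)} {φ : Fin n → (Fin m → ℂ) → ℂ}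
    (hφ : ∀ j, ContDiffOn ℂ ω (φ j) U) (C : Fin k → Fin n → ℂ) : ContDiffOn ℂ ω (combo C φ) U :=
  contDiffOn_pi.2 fun _ => ContDiffOn.sum fun j _ => contDiffOn_const.mul (hφ j)

theorem isClosed_zeroSet (hS : IsBasePointFree S) (C : Fin k → Fin n → ℂ) :
    IsClosed (zeroSet (sectionsEquiv k b C)) := by
  rw [← isOpen_compl_iff, isOpen_iff_mem_nhds]
  intro x hx
  obtain ⟨A, hA⟩ := exists_adaptedChart hS b x
  have h1 : combo C A.quot (A.chart x) ≠ 0 := fun h => hx ((A.mem_zeroSet_iff C x hA).2 h)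
  have h2 : ContinuousAt (fun y => combo C A.quot (A.chart y)) x :=
    (((contDiffOn_combo_right A.contDiffOn C).continuousOn.continuousAt
      (A.chart.open_target.mem_nhds (A.chart.map_source hA)))).comp (A.chart.continuousAt hA)
  filter_upwards [h2.eventually_ne h1, A.chart.open_source.mem_nhds hA] with y hy hys hyY
  exact hy ((A.mem_zeroSet_iff C y hys).1 hyY)

/-- Finitely many charts cover `M`, so the almost sure regularity in each of them holds
simultaneously. -/
theorem ae_isComplexSubmanifold (hkm : k ≤ m) {ι : Type*} [Finite ι] (A : ι → AdaptedChart b)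
    (hA : ∀ x, ∃ a, x ∈ (A a).chart.source) :
    ∀ᵐ C : Fin k → Fin n → ℂ, IsComplexSubmanifold m (m - k) (zeroSet (sectionsEquiv k b C)) := by
  have h : ∀ᵐ C : Fin k → Fin n → ℂ, ∀ a, ∀ z ∈ (A a).chart.target, combo C (A a).quot z = 0 →
      Function.Surjective (fderiv ℂ (combo C (A a).quot) z) :=
    ae_all_iff.2 fun a => ae_surjective_fderiv_combo (A a).chart.open_target (A a).contDiffOn
      (A a).quot_index
  filter_upwards [h] with C hC y hy
  obtain ⟨a, ha⟩ := hA y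
  have hz := (A a).chart.map_source ha
  exact exists_isSliceChart hkm (A a).mem_maximalAtlas (fun x hx => (A a).mem_zeroSet_iff C x hx) ha
    ((contDiffOn_combo_right (A a).contDiffOn C).contDiffAt
      ((A a).chart.open_target.mem_nhds hz))
    (hC a _ hz (((A a).mem_zeroSet_iff C y ha).1 hy))

theorem continuous_mul_of_continuousOn {χ : M → ℝ} (hχ : Continuous χ) {g : M → ℂ} {V : Set M}
    (hV : IsOpen V) (hg : ContinuousOn g V) (hχV : tsupport χ ⊆ V) :
    Continuous fun x => (χ x : ℂ) * g x := by
  rw [continuous_iff_continuousAt]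
  intro x
  by_cases hx : x ∈ V
  · exact (Complex.continuous_ofReal.comp hχ).continuousAt.mul (hg.continuousAt (hV.mem_nhds hx))
  · have h1 : ∀ᶠ y in 𝓝 x, (χ y : ℂ) * g y = 0 := by
      filter_upwards [(isClosed_tsupport χ).isOpen_compl.mem_nhds fun h => hx (hχV h)] with y hy
      rw [image_eq_zero_of_notMem_tsupport hy]
      simp
    exact (continuousAt_const (y := (0 : ℂ))).congr (h1.mono fun y hy => hy.symm)

theorem tsupport_ofReal_mul_subset (χ : M → ℝ) (g : M → ℂ) :
    tsupport (fun x => (χ x : ℂ) * g x) ⊆ tsupport χ := by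
  refine closure_mono fun x hx h => hx ?_
  simp [h]

/-- The inverse chart has complex linear differential, which commutes with scaling by `c`. -/
theorem AdaptedChart.pullback_bidegree (A : AdaptedChart b) {p : ℕ} {φ : DForm m M (2 * p)}
    (hφ : HasBidegree φ p p) {z : Fin m → ℂ} (hz : z ∈ A.chart.target) (c : ℂ)
    (v : Fin (2 * p) → Fin m → ℂ) :
    pullback A.chart.symm φ z (fun j => c • v j) =
      c ^ p * (starRingEnd ℂ c) ^ p * pullback A.chart.symm φ z v := by
  have h1 := mfderiv_chart_symm_real A.mem_maximalAtlas hz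
  have h2 : ∀ w : Fin (2 * p) → Fin m → ℂ, pullback A.chart.symm φ z w =
      φ (A.chart.symm z) (fun j => chartSymmDeriv A.chart z (w j)) := by
    intro w
    rw [pullback, h1]
    rfl
  rw [h2, h2, ← hφ.2]
  simp only [map_smul]

theorem AdaptedChart.pullback_comp (A : AdaptedChart b) {r : ℕ} (φ : DForm m M r) {x : M}
    (hx : x ∈ A.chart.source) :
    (pullback A.chart.symm φ (A.chart x)).compContinuousLinearMap
      (mfderiv 𝓘(ℝ, Fin m → ℂ) 𝓘(ℝ, Fin m → ℂ) A.chart x) = φ x := by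
  have h1 := mfderiv_chart_symm_real A.mem_maximalAtlas (A.chart.map_source hx)
  have h2 := mfderiv_chart_real A.mem_maximalAtlas hx
  have h3 := chartSymmDeriv_comp_chartDeriv A.mem_maximalAtlas hx
  rw [pullback, h1, h2]
  ext v
  have h4 : ∀ w : Fin m → ℂ, chartSymmDeriv A.chart (A.chart x) (chartDeriv A.chart x w) = w :=
    fun w => congrArg (fun T : (Fin m → ℂ) →L[ℂ] (Fin m → ℂ) => T w) h3
  have h5 : φ (A.chart.symm (A.chart x)) (fun j => chartSymmDeriv A.chart (A.chart x)
      (chartDeriv A.chart x (v j))) = φ x v := by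
    rw [A.chart.left_inv hx]
    exact congrArg (φ x) (funext fun j => h4 (v j))
  exact h5

theorem AdaptedChart.tsum_sliceFibre (A : AdaptedChart b) (α : Fin (m - k) → (Fin m → ℂ) →L[ℂ] ℂ)
    (ρ : M → ℂ) (C : Fin k → Fin n → ℂ) (t : Fin (m - k) → ℂ) :
    ∑' z : SliceFibre (zeroSet (sectionsEquiv k b C)) A.chart α t, ρ z =
      fibreSum A.quot α A.chart.target (fun z => ρ (A.chart.symm z)) C t := by
  let e : SliceFibre (zeroSet (sectionsEquiv k b C)) A.chart α t ≃
      {z // (z ∈ A.chart.target ∧ combo C A.quot z = 0) ∧ (fun l => α l z) = t} :=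
    { toFun := fun y => ⟨A.chart y, ⟨A.chart.map_source y.2.1.2,
        (A.mem_zeroSet_iff C _ y.2.1.2).1 y.2.1.1⟩, y.2.2⟩
      invFun := fun z => ⟨A.chart.symm z, ⟨(A.mem_zeroSet_iff C _ (A.chart.map_target z.2.1.1)).2
          (by rw [A.chart.right_inv z.2.1.1]; exact z.2.1.2), A.chart.map_target z.2.1.1⟩,
        by rw [A.chart.right_inv z.2.1.1]; exact z.2.2⟩
      left_inv := fun y => Subtype.ext (A.chart.left_inv y.2.1.2)
      right_inv := fun z => Subtype.ext (A.chart.right_inv z.2.1.1) }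
  rw [fibreSum, ← e.tsum_eq]
  refine tsum_congr fun y => ?_
  exact congrArg ρ (A.chart.left_inv y.2.1.2).symm

/-- For `Y = M` and the full coordinate map a fibre is one point or empty, so counting preimages is
ordinary integration in the chart. -/
theorem integral_tsum_sliceFibre_univ (e : OpenPartialHomeomorph M (Fin m → ℂ)) (ρ : M → ℂ) :
    ∫ t : Fin m → ℂ, ∑' z : SliceFibre univ e (coordForm (m := m)) t, ρ z =
      ∫ z in e.target, ρ (e.symm z) := by
  rw [← integral_indicator e.open_target.measurableSet]
  congr 1
  funext t
  by_cases ht : t ∈ e.target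
  · rw [indicator_of_mem ht]
    let y : SliceFibre univ e (coordForm (m := m)) t :=
      ⟨e.symm t, ⟨mem_univ _, e.map_target ht⟩, e.right_inv ht⟩
    have hy : ∀ z : SliceFibre univ e (coordForm (m := m)) t, z = y := fun z => by
      refine Subtype.ext ?_
      have h1 : e z = t := z.2.2
      rw [← e.left_inv z.2.1.2, h1]
    rw [tsum_eq_single y fun z hz => absurd (hy z) hz]
  · rw [indicator_of_notMem ht]
    have : IsEmpty (SliceFibre univ e (coordForm (m := m)) t) :=
      ⟨fun z => ht (by have h1 : e z = t := z.2.2; rw [← h1]; exact e.map_source z.2.1.2)⟩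
    exact tsum_empty

/-- The wedge product of `(i / 2π ∑ B_j ∧ B̄_j)^k` with a volume form, pulled back along `T`. -/
theorem powWedge_comp_smul_volForm {k : ℕ} (hkm : k ≤ m) (B : Fin n → (Fin m → ℂ) →L[ℂ] ℂ)
    (α : Fin (m - k) → (Fin m → ℂ) →L[ℂ] ℂ) (T : (Fin m → ℂ) →L[ℝ] (Fin m → ℂ)) (r : ℂ) :
    powWedge hkm (((Complex.I / (2 * Real.pi)) • sumPair B).compContinuousLinearMap T)
        (r • (volForm α).compContinuousLinearMap T) =
      ((((Real.pi ^ k)⁻¹ * ∑ J : Fin k → Fin n,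
        ‖(formMatrix (joinFam (fun i => B (J i)) α)).det‖ ^ 2 : ℝ) : ℂ) * r) •
        (volForm (coordForm (m := m))).compContinuousLinearMap T := by
  have h2 := eq_smul_volForm_coordForm (powWedge hkm ((Complex.I / (2 * Real.pi)) • sumPair B)
    (volForm α))
  rw [powWedge_sumPair_volForm] at h2
  rw [powWedge_smul_right, powWedge_comp, h2]
  ext v
  exact (mul_left_comm _ _ _).trans (mul_assoc _ _ _).symm

/-- This matches the two sides: the wedge product with the expected form is again a `chartForm`,
whose coefficient is the `zeroDensity` found by the Gaussian computation. -/
theorem AdaptedChart.powWedge_chartForm (A : AdaptedChart b) (h : HermitianMetric m L) (hkm : k ≤ m)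
    (α : Fin (m - k) → (Fin m → ℂ) →L[ℂ] ℂ) {ρ : M → ℂ} (hρ : tsupport ρ ⊆ A.chart.source) (x : M) :
    powWedge hkm (expectedForm h b x) (chartForm A.chart α ρ x) =
      chartForm A.chart (coordForm (m := m))
        (fun x => (zeroDensity k A.quot α (A.chart x) : ℂ) * ρ x) x := by
  let T : (Fin m → ℂ) →L[ℝ] (Fin m → ℂ) := mfderiv 𝓘(ℝ, Fin m → ℂ) 𝓘(ℝ, Fin m → ℂ) A.chart x
  by_cases hx : x ∈ A.chart.source
  · exact (congrArg (fun E : AltForm m 2 => powWedge hkm E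
      (ρ x • (volForm α).compContinuousLinearMap T)) (A.expectedForm_eq h x hx)).trans
      (powWedge_comp_smul_volForm hkm _ α T (ρ x))
  -- Off the chart domain both sides vanish with `ρ`, whatever default value the derivative of the
  -- chart takes.
  · have h0 : ρ x = 0 := image_eq_zero_of_notMem_tsupport fun h => hx (hρ h)
    let E : AltForm m 2 := expectedForm h b x
    have h1 : powWedge hkm E (ρ x • (volForm α).compContinuousLinearMap T) =
        ((zeroDensity k A.quot α (A.chart x) : ℂ) * ρ x) •
          (volForm (coordForm (m := m))).compContinuousLinearMap T := by
      rw [powWedge_smul_right, h0, mul_zero]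
      ext v
      exact (zero_mul _).trans (zero_mul _).symm
    exact h1

variable [T2Space M] [CompactSpace M]

theorem sum_smul_comp {N r : ℕ} (c : Fin N → ℂ) (V : Fin N → AltForm m r)
    (T : (Fin m → ℂ) →L[ℝ] (Fin m → ℂ)) :
    (∑ i, c i • V i).compContinuousLinearMap T = ∑ i, c i • (V i).compContinuousLinearMap T := by
  ext v
  simp [ContinuousAlternatingMap.sum_apply]

theorem eq_sum_smul_of_sum_eq_one {ι : Type*} [Fintype ι] {r : ℕ} {w : ι → ℂ} (hw : ∑ a, w a = 1)
    (ψ : AltForm m r) : ψ = ∑ a, w a • ψ := by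
  ext v
  simp [ContinuousAlternatingMap.sum_apply, ← Finset.sum_mul, hw]

/-- A test form is a finite sum of pulled back volume forms in adapted charts. -/
theorem exists_chartForm_decomposition {ι : Type*} [Fintype ι] (A : ι → AdaptedChart b)
    (hA : ∀ x, ∃ a, x ∈ (A a).chart.source) {p : ℕ} {φ : DForm m M (2 * p)} (hφ : IsTestForm φ) :
    ∃ (N : ℕ) (α : Fin N → Fin p → (Fin m → ℂ) →L[ℂ] ℂ) (ρ : ι × Fin N → M → ℂ),
      (∀ i, Continuous (ρ i)) ∧ (∀ i, tsupport (ρ i) ⊆ (A i.1).chart.source) ∧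
      φ = fun x => ∑ i, chartForm (A i.1).chart (α i.2) (ρ i) x := by
  obtain ⟨N, α, coef, hdec⟩ := exists_volForm_decomposition m p
  obtain ⟨χ, hχ⟩ := PartitionOfUnity.exists_isSubordinate (s := (univ : Set M)) isClosed_univ
    (fun a => (A a).chart.source) (fun a => (A a).chart.open_source)
    (fun x _ => mem_iUnion.2 (hA x))
  refine ⟨N, α, fun i x => (χ i.1 x : ℂ) *
    coef i.2 (pullback (A i.1).chart.symm φ ((A i.1).chart x)), fun i => ?_, fun i => ?_, ?_⟩
  · refine continuous_mul_of_continuousOn (χ i.1).continuous (A i.1).chart.open_source ?_ (hχ i.1)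
    exact (coef i.2).continuous.comp_continuousOn
      (((A i.1).contDiffOn_pullback φ hφ.1).continuousOn.comp (A i.1).chart.continuousOn
        (A i.1).chart.mapsTo)
  · exact (tsupport_ofReal_mul_subset _ _).trans (hχ i.1)
  · funext x
    have hterm : ∀ a, (χ a x : ℂ) • φ x = ∑ i, chartForm (A a).chart (α i) (fun x => (χ a x : ℂ) *
        coef i (pullback (A a).chart.symm φ ((A a).chart x))) x := by
      intro a
      by_cases hx : x ∈ (A a).chart.source
      · have h1 := hdec _ ((A a).pullback_bidegree hφ.2 ((A a).chart.map_source hx))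
        have h2 := (A a).pullback_comp φ hx
        let T : (Fin m → ℂ) →L[ℝ] (Fin m → ℂ) :=
          mfderiv 𝓘(ℝ, Fin m → ℂ) 𝓘(ℝ, Fin m → ℂ) (A a).chart x
        let c : Fin N → ℂ := fun i => coef i (pullback (A a).chart.symm φ ((A a).chart x))
        have h3 : φ x = ∑ i, c i • (volForm (α i)).compContinuousLinearMap T :=
          h2.symm.trans ((congrArg (fun P : AltForm m (2 * p) => P.compContinuousLinearMap T) h1).trans
            (sum_smul_comp c (fun i => volForm (α i)) T))
        rw [h3, Finset.smul_sum]
        exact Finset.sum_congr rfl fun i _ => (mul_smul _ _ _).symm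
      · have h0 : χ a x = 0 := image_eq_zero_of_notMem_tsupport fun h => hx (hχ a h)
        let T : (Fin m → ℂ) →L[ℝ] (Fin m → ℂ) :=
          mfderiv 𝓘(ℝ, Fin m → ℂ) 𝓘(ℝ, Fin m → ℂ) (A a).chart x
        let c : Fin N → ℂ := fun i => coef i (pullback (A a).chart.symm φ ((A a).chart x))
        let ψ : AltForm m (2 * p) := φ x
        have h3 : (χ a x : ℂ) • ψ =
            ∑ i, ((χ a x : ℂ) * c i) • (volForm (α i)).compContinuousLinearMap T := by
          ext v
          simp [h0, ContinuousAlternatingMap.sum_apply]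
        exact h3
    have hsum : ∑ a, (χ a x : ℂ) = 1 := by
      have := χ.sum_eq_one (mem_univ x)
      rw [finsum_eq_sum_of_fintype] at this
      exact_mod_cast this
    rw [Fintype.sum_prod_type]
    exact (eq_sum_smul_of_sum_eq_one hsum (φ x)).trans (Finset.sum_congr rfl fun a _ => hterm a)

/-- Fubini separates the joint integral over `(t, C)`: integrating out `t` first gives the local
zero current, and its integrability and measurability in `C` come for free. -/
theorem AdaptedChart.integrable_and_integral (A : AdaptedChart b) (hkm : k ≤ m)
    (α : Fin (m - k) → (Fin m → ℂ) →L[ℂ] ℂ) {ρ : M → ℂ} (hρc : Continuous ρ)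
    (hρ : tsupport ρ ⊆ A.chart.source) :
    Integrable (fun C : Fin k → Fin n → ℂ => (gaussWeight C : ℂ) * ∫ t : Fin (m - k) → ℂ,
      fibreSum A.quot α A.chart.target (fun z => ρ (A.chart.symm z)) C t) ∧
    ∫ C : Fin k → Fin n → ℂ, (gaussWeight C : ℂ) * ∫ t : Fin (m - k) → ℂ,
      fibreSum A.quot α A.chart.target (fun z => ρ (A.chart.symm z)) C t =
      ∫ z in A.chart.target, (zeroDensity k A.quot α z : ℂ) * ρ (A.chart.symm z) := by
  have hK : IsCompact (A.chart '' tsupport ρ) :=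
    (isClosed_tsupport ρ).isCompact.image_of_continuousOn (A.chart.continuousOn.mono hρ)
  obtain ⟨hi, hv⟩ := integrable_and_integral_fibreSum (α := α) hkm A.chart.open_target A.contDiffOn
    A.quot_index (ρ := fun z => ρ (A.chart.symm z))
    (hρc.comp_continuousOn A.chart.continuousOn_symm) hK
    (by rintro _ ⟨x, hx, rfl⟩; exact A.chart.map_source (hρ hx))
    (fun z hz hzK => image_eq_zero_of_notMem_tsupport fun h =>
      hzK ⟨A.chart.symm z, h, A.chart.right_inv hz⟩)
  have h1 := hi.integral_prod_right
  rw [integral_prod_symm _ hi] at hv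
  simp only [integral_const_mul] at h1 hv
  exact ⟨h1, hv⟩

theorem zeroCurrent_eq_sum (hS : IsBasePointFree S) {ι : Type*} [Fintype ι]
    (A : ι → AdaptedChart b) (α : ι → Fin (m - k) → (Fin m → ℂ) →L[ℂ] ℂ) (ρ : ι → M → ℂ)
    (hρc : ∀ i, Continuous (ρ i)) (hρs : ∀ i, tsupport (ρ i) ⊆ (A i).chart.source)
    (C : Fin k → Fin n → ℂ) (hC : IsComplexSubmanifold m (m - k) (zeroSet (sectionsEquiv k b C))) :
    zeroCurrent (sectionsEquiv k b C) (fun x => ∑ i, chartForm (A i).chart (α i) (ρ i) x) =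
      ∑ i, ∫ t : Fin (m - k) → ℂ, fibreSum (A i).quot (α i) (A i).chart.target
        (fun z => ρ i ((A i).chart.symm z)) C t := by
  refine (integralOver_sum_chartForm (Nat.sub_le m k) hC (isClosed_zeroSet hS C)
    (fun i => (A i).chart) (fun i => (A i).mem_maximalAtlas) α ρ hρc hρs).trans ?_
  exact Finset.sum_congr rfl fun i _ =>
    integral_congr_ae (ae_of_all _ fun t => (A i).tsum_sliceFibre (α i) (ρ i) C t)

theorem AdaptedChart.continuous_zeroDensity_mul (A : AdaptedChart b)
    (α : Fin (m - k) → (Fin m → ℂ) →L[ℂ] ℂ) {ρ : M → ℂ} (hρc : Continuous ρ)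
    (hρ : tsupport ρ ⊆ A.chart.source) :
    Continuous fun x => (zeroDensity k A.quot α (A.chart x) : ℂ) * ρ x := by
  rw [continuous_iff_continuousAt]
  intro x
  by_cases hx : x ∈ A.chart.source
  · have h1 : ContinuousOn (fun x => (zeroDensity k A.quot α (A.chart x) : ℂ)) A.chart.source :=
      Complex.continuous_ofReal.comp_continuousOn ((continuousOn_zeroDensity
        A.chart.open_target A.contDiffOn A.quot_index).comp A.chart.continuousOn A.chart.mapsTo)
    exact (h1.continuousAt (A.chart.open_source.mem_nhds hx)).mul hρc.continuousAt
  · have h1 : ∀ᶠ y in 𝓝 x, (zeroDensity k A.quot α (A.chart y) : ℂ) * ρ y = 0 := by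
      filter_upwards [(isClosed_tsupport ρ).isOpen_compl.mem_nhds
        fun h => hx (hρ h)] with y hy
      rw [image_eq_zero_of_notMem_tsupport hy, mul_zero]
    exact (continuousAt_const (y := (0 : ℂ))).congr (h1.mono fun y hy => hy.symm)

theorem integralOver_powWedge_eq_sum (h : HermitianMetric m L) (hkm : k ≤ m)
    {ι : Type*} [Fintype ι]
    (A : ι → AdaptedChart b) (α : ι → Fin (m - k) → (Fin m → ℂ) →L[ℂ] ℂ) (ρ : ι → M → ℂ)
    (hρc : ∀ i, Continuous (ρ i)) (hρs : ∀ i, tsupport (ρ i) ⊆ (A i).chart.source) :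
    integralOver univ (fun x => powWedge hkm (expectedForm h b x)
        (∑ i, chartForm (A i).chart (α i) (ρ i) x)) =
      ∑ i, ∫ z in (A i).chart.target, (zeroDensity k (A i).quot (α i) z : ℂ) *
        ρ i ((A i).chart.symm z) := by
  have hform : (fun x => powWedge hkm (expectedForm h b x)
      (∑ i, chartForm (A i).chart (α i) (ρ i) x)) = fun x =>
      ∑ i, chartForm (A i).chart (coordForm (m := m))
        (fun x => (zeroDensity k (A i).quot (α i) ((A i).chart x) : ℂ) * ρ i x) x := by
    funext x
    exact (powWedge_sum_right hkm _ _ _).trans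
      (Finset.sum_congr rfl fun i _ => (A i).powWedge_chartForm h hkm (α i) (hρs i) x)
  have hts : ∀ i, tsupport (fun x => (zeroDensity k (A i).quot (α i)
      ((A i).chart x) : ℂ) * ρ i x) ⊆ tsupport (ρ i) := fun i =>
    closure_mono fun x hx h0 => hx (by simp [h0])
  refine (congrArg (integralOver univ) hform).trans ?_
  refine (integralOver_sum_chartForm le_rfl isComplexSubmanifold_univ isClosed_univ
    (fun i => (A i).chart) (fun i => (A i).mem_maximalAtlas) (fun _ => coordForm (m := m))
    (fun i x => (zeroDensity k (A i).quot (α i) ((A i).chart x) : ℂ) * ρ i x)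
    (fun i => (A i).continuous_zeroDensity_mul (α i) (hρc i) (hρs i))
    fun i => (hts i).trans (hρs i)).trans ?_
  refine Finset.sum_congr rfl fun i _ => ?_
  refine (integral_tsum_sliceFibre_univ (A i).chart
    (fun x => (zeroDensity k (A i).quot (α i) ((A i).chart x) : ℂ) * ρ i x)).trans
    (setIntegral_congr_fun (A i).chart.open_target.measurableSet fun z hz => ?_)
  simp only [(A i).chart.right_inv hz]

theorem integrable_and_integral_zeroCurrent_sum (h : HermitianMetric m L)
    (hS : IsBasePointFree S) (hkm : k ≤ m) {ι : Type*} [Fintype ι]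
    (A : ι → AdaptedChart b) (α : ι → Fin (m - k) → (Fin m → ℂ) →L[ℂ] ℂ) (ρ : ι → M → ℂ)
    (hρc : ∀ i, Continuous (ρ i)) (hρs : ∀ i, tsupport (ρ i) ⊆ (A i).chart.source)
    (hZ : ∀ᵐ C : Fin k → Fin n → ℂ,
      IsComplexSubmanifold m (m - k) (zeroSet (sectionsEquiv k b C)))
    {φ : DForm m M (2 * (m - k))}
    (hφ : φ = fun x => ∑ i, chartForm (A i).chart (α i) (ρ i) x) :
    Integrable (fun s : Fin k → S => zeroCurrent s φ) (Measure.pi fun _ : Fin k => gaussian b) ∧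
    ∫ s : Fin k → S, zeroCurrent s φ ∂(Measure.pi fun _ : Fin k => gaussian b) =
      integralOver univ (fun x => powWedge hkm (expectedForm h b x) (φ x)) := by
  have hI := fun i => (A i).integrable_and_integral hkm (α i) (hρc i) (hρs i)
  -- The fibre-counting formula for the current needs the zero set to be a submanifold, so this
  -- identity holds only for almost every `C`.
  have hX : (fun C : Fin k → Fin n → ℂ => (gaussWeight C : ℂ) *
      zeroCurrent (sectionsEquiv k b C) φ) =ᵐ[volume] fun C => ∑ i, (gaussWeight C : ℂ) *
        ∫ t : Fin (m - k) → ℂ, fibreSum (A i).quot (α i) (A i).chart.target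
          (fun z => ρ i ((A i).chart.symm z)) C t :=
    hZ.mono fun C hC => by
      have h1 := zeroCurrent_eq_sum hS A α ρ hρc hρs C hC
      rw [← hφ] at h1
      exact (congrArg (fun z : ℂ => (gaussWeight C : ℂ) * z) h1).trans (Finset.mul_sum _ _ _)
  have hXi := (integrable_finsetSum Finset.univ fun i _ => (hI i).1).congr hX.symm
  obtain ⟨g1, g2⟩ := integrable_and_integral_pi_gaussian b (X := fun s => zeroCurrent s φ) hXi
  refine ⟨g1, g2.trans ?_⟩
  refine (integral_congr_ae hX).trans ?_
  refine (integral_finsetSum _ fun i _ => (hI i).1).trans ?_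
  refine (Finset.sum_congr rfl fun i _ => (hI i).2).trans ?_
  subst hφ
  exact (integralOver_powWedge_eq_sum h hkm A α ρ hρc hρs).symm

/-- The expected zero current of Gaussian random sections. -/
theorem integrable_and_integral_zeroCurrent (h : HermitianMetric m L) (hS : IsBasePointFree S)
    (hkm : k ≤ m) {ι : Type*} [Fintype ι] (A : ι → AdaptedChart b)
    (hA : ∀ x, ∃ a, x ∈ (A a).chart.source) {φ : DForm m M (2 * (m - k))} (hφ : IsTestForm φ) :
    Integrable (fun s : Fin k → S => zeroCurrent s φ) (Measure.pi fun _ : Fin k => gaussian b) ∧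
    ∫ s : Fin k → S, zeroCurrent s φ ∂(Measure.pi fun _ : Fin k => gaussian b) =
      integralOver univ (fun x => powWedge hkm (expectedForm h b x) (φ x)) := by
  obtain ⟨N, α, ρ, hρc, hρs, hdec⟩ := exists_chartForm_decomposition A hA hφ
  exact integrable_and_integral_zeroCurrent_sum h hS hkm (fun i : ι × Fin N => A i.1)
    (fun i => α i.2) ρ hρc hρs (ae_isComplexSubmanifold hkm A hA) hdec

theorem exists_finite_adaptedChart (hS : IsBasePointFree S) (b : Module.Basis (Fin n) ℂ S) :
    ∃ (t : Finset M) (A : t → AdaptedChart b), ∀ x, ∃ a, x ∈ (A a).chart.source := by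
  choose A hA using exists_adaptedChart hS b
  obtain ⟨t, ht⟩ := CompactSpace.elim_nhds_subcover (fun x => (A x).chart.source)
    fun x => (A x).chart.open_source.mem_nhds (hA x)
  refine ⟨t, fun x => A x, fun x => ?_⟩
  have hx : x ∈ ⋃ y ∈ t, (A y).chart.source := by rw [ht]; trivial
  obtain ⟨y, hy, hxy⟩ := mem_iUnion₂.1 hx
  exact ⟨⟨y, hy⟩, hxy⟩

end Main

end ZeroCurrent

end

open ZeroCurrent in
theorem proposition2p2
    {m : ℕ} {M : Type*} [TopologicalSpace M] [T2Space M] [CompactSpace M]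
    [ChartedSpace (Fin m → ℂ) M] [IsManifold 𝓘(ℂ, Fin m → ℂ) ω M]
    (hM : IsKahler m M)
    {L : M → Type*} [∀ x, AddCommGroup (L x)] [∀ x, Module ℂ (L x)]
    [∀ x, TopologicalSpace (L x)] [TopologicalSpace (Bundle.TotalSpace ℂ L)]
    [FiberBundle ℂ L] [VectorBundle ℂ ℂ L]
    [ContMDiffVectorBundle ω ℂ L 𝓘(ℂ, Fin m → ℂ)]
    (h : HermitianMetric m L)
    (S : Submodule ℂ (HolSection m L)) (hS : IsBasePointFree S)
    (ip : InnerProductSpace.Core ℂ S)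
    {n : ℕ} (b : Module.Basis (Fin n) ℂ S)
    (hb : ∀ i j, ip.inner (b i) (b j) = if i = j then 1 else 0)
    {k : ℕ} (hk1 : 1 ≤ k) (hkm : k ≤ m) :
    (∀ᵐ s ∂(MeasureTheory.Measure.pi fun _ : Fin k => gaussian b),
      IsComplexSubmanifold m (m - k) (zeroSet s)) ∧
    ∀ φ : DForm m M (2 * (m - k)), IsTestForm φ →
      MeasureTheory.Integrable (fun s : Fin k → S => zeroCurrent s φ)
        (MeasureTheory.Measure.pi fun _ : Fin k => gaussian b) ∧
      ∫ s : Fin k → S, zeroCurrent s φ ∂(MeasureTheory.Measure.pi fun _ : Fin k => gaussian b) =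
        integralOver Set.univ (fun x => powWedge hkm (expectedForm h b x) (φ x)) := by
  obtain ⟨t, A, hA⟩ := exists_finite_adaptedChart hS b
  exact ⟨ae_pi_gaussian_of_ae b (ae_isComplexSubmanifold hkm A hA),
    fun φ hφ => integrable_and_integral_zeroCurrent h hS hkm A hA hφ⟩
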